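/- **Setting.** Let $M$ be a smooth Riemannian manifold (without boundary, finite dimensional, Hausdorff, not necessarily compact) which is filtered: its tangent bundle carries a flag of smooth subbundles $0=H^0\subseteq H^1\subseteq\dots\subseteq H^s=TM$ (with $H^i=TM$ for $i>s$) such that $[\Gamma(H^i),\Gamma(H^j)]\subseteq\Gamma(H^{i+j})$ for all $i,j$. For $x\in M$ the graded space $\mathfrak g_xM=\bigoplus_{i\ge1}H^i_x/H^{i-1}_x$ is a Lie algebra for the bracket $$[X(x)\bmod H^{i-1}_x,\;Y(x)\bmod H^{j-1}_x]=[X,Y](x)\bmod H^{i+j-1}_x,\qquad X\in\Gamma(H^i),\ Y\in\Gamma(H^j),$$ which is well defined and bilinear. Let $d_{\mathfrak g_xM}$ be its Chevalley–Eilenberg differential on $\wedge^\bullet\mathfrak g_x^*M$. Identifying $H^i_x/H^{i-1}_x$ with the orthogonal complement of $H^{i-1}_x$ in $H^i_x$ gives an isomorphism $\mathfrak g_xM\cong T_xM$, which is used to transport the scalar product to $\mathfrak g_xM$; let $\Phi_x:\wedge^\bullet T_x^*M\to\wedge^\bullet\mathfrak g_x^*M$ be the induced isometry. For a linear map $D$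 between Euclidean spaces, $D^{-1}$ denotes its partial inverse, i.e. the orthogonal projection onto ${\rm Im}\,D$ followed by the inverse of $D:(\ker D)^\perp\to{\rm Im}\,D$. Put, pointwise on $\Omega^\bullet(M)$, $$d_0=\Phi^{-1}d_{\mathfrak gM}\Phi,\qquad d_0^{-1}=\Phi^{-1}d_{\mathfrak gM}^{-1}\Phi,\qquad \delta_0=d_0^t\ (\text{the pointwise transpose of }d_0).$$ Assume that in each degree $k$ the rank of $d_{\mathfrak g_xM}:\wedge^k\mathfrak g_x^*M\to\wedge^{k+1}\mathfrak g_x^*M$ is a locally constant function of $x$. Let $d$ be the de Rham differential, and $$\Box=d\delta_0+\delta_0d,\qquad \Box_0=d_0\delta_0+\delta_0d_0 .$$ **Statement.** The operators $d,d_0,\delta_0,d_0^{-1}$ map $\Omega^\bullet(M)$ to itself. Define $$b=d_0^{-1}d_0-d_0^{-1}d=-d_0^{-1}(d-d_0),\qquad b_1=d_0d_0^{-1}-dd_0^{-1}=-(d-d_0)d_0^{-1}.$$ 1. The maps $b$ and $b_1$ are nilpotent differential operators, $I-b$ and $I-b_1$ are invertible on $\Omega^\bullet(M)$, and $(I-b)^{-1}$,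 $(I-b_1)^{-1}$ are differential operators. Moreover $b\,d_0^{-1}=d_0^{-1}b_1$ and $(I-b)^{-1}d_0^{-1}=d_0^{-1}(I-b_1)^{-1}$. 2. The operator $$\Pi:=(I-b)^{-1}d_0^{-1}d+d(I-b)^{-1}d_0^{-1}=d_0^{-1}(I-b_1)^{-1}d+dd_0^{-1}(I-b_1)^{-1}$$ is a differential operator on $\Omega^\bullet(M)$; it is the projection onto $$F:={\rm Im}\,d_0^{-1}+{\rm Im}\,dd_0^{-1}={\rm Im}\,d_0^t+{\rm Im}\,dd_0^t$$ along $$E:=\ker d_0^{-1}\cap\ker(d_0^{-1}d)=\ker d_0^t\cap\ker(d_0^td).$$ 3. The complementary projection $I-\Pi$, onto $E$ along $F$, coincides with the spectral projection $$P=\frac1{2\pi i}\oint_{|z|=\varepsilon}(z-\Box)^{-1}\,dz,\qquad \varepsilon>0\text{ small enough},$$ in the following sense. Say that $r>0$ is a spectral gap on an open set $U\subseteq M$ if every nonzero eigenvalue of $\Box_0$ at every point of $U$ has absolute value at least $r$. Every point of $M$ has an open neighbourhood which has a spectral gap. Whenever $r>0$ is a spectral gap on an open set $U$ (possibly $U=M$),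 the operator $z-\Box$ is invertible on the complex-valued smooth forms on $U$ for every complex number $z$ with $0<|z|<r$; and for all $0<\varepsilon<r$, all $\theta\in\Omega^\bullet(M)$ and all $x\in U$, $$\bigl((I-\Pi)\theta\bigr)(x)=\frac1{2\pi i}\oint_{|z|=\varepsilon}\bigl((z-\Box)^{-1}(\theta|_U)\bigr)(x)\,dz ,$$ the integrand being (circle-)integrable. -/

import Mathlib

open scoped Manifold ContDiff Bundle DirectSum TensorProduct
open Module Bundle

noncomputable section FilteredRiemannianDefs

namespace FilteredRiemannian

/-! ### Linear algebra: scalar product on alternating forms, partial inverse -/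

section LinearAlgebra

instance altForm_finite (V : Type*) [AddCommGroup V] [Module ℝ V] [FiniteDimensional ℝ V] (k : ℕ) :
    FiniteDimensional ℝ (V [⋀^Fin k]→ₗ[ℝ] ℝ) :=
  Module.Finite.of_injective (AlternatingMap.toMultilinearMapLM (S := ℝ) (R := ℝ) (M := V) (N := ℝ) (ι := Fin k))
    AlternatingMap.coe_multilinearMap_injective

/-- The scalar product on the `k`-forms of a Euclidean space induced by that of the space: for an
orthonormal basis `e`, it is `∑_{i₁<⋯<i_k} α(e_{i₁},…,e_{i_k}) β(e_{i₁},…,e_{i_k})`, which is the same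
as `1/k!` times the sum over all `k`-tuples of indices. On decomposable forms it is
`⟨α₁∧⋯∧α_k, β₁∧⋯∧β_k⟩ = det ⟨α_i, β_j⟩`. -/
@[reducible] def altCore (V : Type*) [NormedAddCommGroup V] [InnerProductSpace ℝ V] [FiniteDimensional ℝ V]
    (k : ℕ) : InnerProductSpace.Core ℝ (V [⋀^Fin k]→ₗ[ℝ] ℝ) where
  inner α β := (Nat.factorial k : ℝ)⁻¹ * ∑ v : Fin k → Fin (finrank ℝ V),
    α (fun i => stdOrthonormalBasis ℝ V (v i)) * β (fun i => stdOrthonormalBasis ℝ V (v i))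
  conj_inner_symm α β := by simp [mul_comm]
  re_inner_nonneg α := by
    simp only [RCLike.re_to_real]
    exact mul_nonneg (by positivity) (Finset.sum_nonneg fun _ _ => mul_self_nonneg _)
  add_left α β γ := by simp [add_mul, Finset.sum_add_distrib, mul_add]
  smul_left α β c := by simp [mul_assoc, ← Finset.mul_sum, mul_left_comm]
  definite α h := by
    have hk : (Nat.factorial k : ℝ)⁻¹ ≠ 0 := by positivity
    have h0 := (mul_eq_zero.mp h).resolve_left hk
    rw [Finset.sum_eq_zero_iff_of_nonneg (fun _ _ => mul_self_nonneg _)] at h0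
    refine AlternatingMap.coe_multilinearMap_injective ?_
    refine Basis.ext_multilinear (fun _ => (stdOrthonormalBasis ℝ V).toBasis) fun v => ?_
    simpa using h0 v (Finset.mem_univ v)

instance altNormed (V : Type*) [NormedAddCommGroup V] [InnerProductSpace ℝ V]
    [FiniteDimensional ℝ V] (k : ℕ) : NormedAddCommGroup (V [⋀^Fin k]→ₗ[ℝ] ℝ) :=
  (altCore V k).toNormedAddCommGroup

instance altInner (V : Type*) [NormedAddCommGroup V] [InnerProductSpace ℝ V]
    [FiniteDimensional ℝ V] (k : ℕ) : InnerProductSpace ℝ (V [⋀^Fin k]→ₗ[ℝ] ℝ) :=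
  InnerProductSpace.ofCore (altCore V k).toCore

/-- The partial inverse `D⁻¹ pr_{Im D}`: the orthogonal projection onto `Im D` followed by the inverse
of the bijection `(ker D)ᗮ → Im D` given by `D`. -/
def partialInverse {V W : Type*} [NormedAddCommGroup V] [InnerProductSpace ℝ V]
    [FiniteDimensional ℝ V] [NormedAddCommGroup W] [InnerProductSpace ℝ W] [FiniteDimensional ℝ W]
    (D : V →ₗ[ℝ] W) : W →ₗ[ℝ] V :=
  (LinearMap.ker D)ᗮ.subtype ∘ₗ
    (D.kerComplementEquivRange
      (Submodule.isCompl_orthogonal (LinearMap.ker D)).symm).symm.toLinearMap ∘ₗ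
    (LinearMap.range D).orthogonalProjectionOnto.toLinearMap

end LinearAlgebra

/-! ### Filtered vector spaces and their graded spaces -/

/-- A finite increasing filtration `0 = H 0 ⊆ H 1 ⊆ ⋯ ⊆ H s = V`
(continued by `H i = V` for `i > s`). -/
structure FiniteFlag (V : Type*) [AddCommGroup V] [Module ℝ V] where
  H : ℕ → Submodule ℝ V
  mono : Monotone H
  zero : H 0 = ⊥
  exhausts : ∃ s, H s = ⊤

namespace FiniteFlag
section
variable {V : Type*} [AddCommGroup V] [Module ℝ V] (A : FiniteFlag V)

/-- `H i` as a subspace of `H (i+1)`. -/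
def below (i : ℕ) : Submodule ℝ (A.H (i + 1)) := (A.H i).submoduleOf (A.H (i + 1))

/-- The graded space `gr V = ⨁ i, H (i+1) / H i`; the summand of index `i` has weight `i + 1`. -/
def Gr : Type _ := ⨁ i : ℕ, (A.H (i + 1) ⧸ A.below i)

instance : AddCommGroup A.Gr := inferInstanceAs (AddCommGroup (⨁ i : ℕ, (A.H (i + 1) ⧸ A.below i)))
instance : Module ℝ A.Gr := inferInstanceAs (Module ℝ (⨁ i : ℕ, (A.H (i + 1) ⧸ A.below i)))

/-- The inclusion of the summand `H (i+1) / H i`. -/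
def ofQuotient (i : ℕ) : (A.H (i + 1) ⧸ A.below i) →ₗ[ℝ] A.Gr :=
  DirectSum.lof ℝ ℕ (fun i => A.H (i + 1) ⧸ A.below i) i

/-- The class of `v ∈ H (i+1)` modulo `H i`, in `gr V`. -/
def symbol (i : ℕ) (v : V) (hv : v ∈ A.H (i + 1)) : A.Gr :=
  A.ofQuotient i ((A.below i).mkQ ⟨v, hv⟩)
end

section
variable {V : Type*} [NormedAddCommGroup V] [InnerProductSpace ℝ V] [FiniteDimensional ℝ V]
  (A : FiniteFlag V)

/-- The identification of `H (i+1) / H i` with the orthogonal complement of `H i` in `H (i+1)`. -/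
def grPart (i : ℕ) : (A.H (i + 1) ⧸ A.below i) ≃ₗ[ℝ] (A.below i)ᗮ :=
  Submodule.quotientEquivOfIsCompl _ _ (Submodule.isCompl_orthogonal (A.below i))

/-- The map `gr V → V` sending each `H (i+1) / H i` to the orthogonal complement of `H i` in
`H (i+1)`. -/
def grMap : A.Gr →ₗ[ℝ] V :=
  DirectSum.toModule ℝ ℕ V fun i =>
    (A.H (i + 1)).subtype ∘ₗ (A.below i)ᗮ.subtype ∘ₗ (A.grPart i).toLinearMap

theorem grMap_ofQuotient (i : ℕ) (q : A.H (i + 1) ⧸ A.below i) :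
    A.grMap (A.ofQuotient i q) = ((A.grPart i q : A.H (i + 1)) : V) :=
  DirectSum.toModule_lof (R := ℝ) (φ := fun i => (A.H (i + 1)).subtype ∘ₗ (A.below i)ᗮ.subtype ∘ₗ
    (A.grPart i).toLinearMap) i q

theorem inner_grPart_of_lt {i j : ℕ} (h : i < j) (q : A.H (i + 1) ⧸ A.below i)
    (r : A.H (j + 1) ⧸ A.below j) :
    inner ℝ ((A.grPart i q : A.H (i + 1)) : V) ((A.grPart j r : A.H (j + 1)) : V) = 0 := by
  have hr := (A.grPart j r).2
  rw [Submodule.mem_orthogonal] at hr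
  have hq : ((A.grPart i q : A.H (i + 1)) : V) ∈ A.H j := A.mono h (A.grPart i q : A.H (i + 1)).2
  exact hr ⟨_, A.mono (Nat.le_succ j) hq⟩ hq

theorem inner_grMap (i : ℕ) (q : A.H (i + 1) ⧸ A.below i)
    (a : ⨁ i : ℕ, (A.H (i + 1) ⧸ A.below i)) :
    inner ℝ ((A.grPart i q : A.H (i + 1)) : V) (A.grMap a) =
      inner ℝ (A.grPart i q) (A.grPart i (a i)) := by
  induction a using DirectSum.induction_on with
  | zero =>
    have : A.grMap (0 : ⨁ i : ℕ, (A.H (i + 1) ⧸ A.below i)) = 0 := map_zero A.grMap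
    rw [this]; simp
  | of j r =>
    have h1 : A.grMap (DirectSum.of (fun i => A.H (i + 1) ⧸ A.below i) j r) = _ :=
      A.grMap_ofQuotient j r
    rw [h1]
    rcases lt_trichotomy i j with h | rfl | h
    · rw [A.inner_grPart_of_lt h, DirectSum.of_eq_of_ne _ _ _ h.ne, map_zero, inner_zero_right]
    · rw [DirectSum.of_eq_same]; rfl
    · rw [real_inner_comm, A.inner_grPart_of_lt h, DirectSum.of_eq_of_ne _ _ _ h.ne', map_zero,
        inner_zero_right]
  | add a b ha hb =>
    have : A.grMap (a + b) = A.grMap a + A.grMap b := map_add A.grMap a b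
    rw [this, inner_add_right, ha, hb, DirectSum.add_apply, map_add, inner_add_right]

theorem grMap_bijective : Function.Bijective A.grMap := by
  constructor
  · rw [injective_iff_map_eq_zero]
    intro a ha
    refine DFinsupp.ext fun i => ?_
    have h := A.inner_grMap i (DFunLike.coe (F := ⨁ i : ℕ, (A.H (i + 1) ⧸ A.below i)) a i) a
    rw [ha, inner_zero_right, eq_comm, inner_self_eq_zero, LinearEquiv.map_eq_zero_iff] at h
    exact h
  · obtain ⟨s, hs⟩ := A.exhausts
    have key : ∀ m, A.H m ≤ LinearMap.range A.grMap := by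
      intro m
      induction m with
      | zero => rw [A.zero]; exact bot_le
      | succ m ih =>
        intro v hv
        have h1 := A.grMap_ofQuotient m ((A.below m).mkQ ⟨v, hv⟩)
        have h2 : (⟨v, hv⟩ : A.H (m + 1)) -
            (A.grPart m ((A.below m).mkQ ⟨v, hv⟩) : A.H (m + 1)) ∈ A.below m := by
          rw [← Submodule.Quotient.mk_eq_zero, Submodule.Quotient.mk_sub, sub_eq_zero]
          exact (Submodule.mk_quotientEquivOfIsCompl_apply _ _).symm
        have h3 : v - ((A.grPart m ((A.below m).mkQ ⟨v, hv⟩) : A.H (m + 1)) : V) ∈ A.H m := h2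
        have h4 := (LinearMap.range A.grMap).add_mem (ih h3) ⟨_, h1⟩
        simpa using h4
    intro v
    exact key s (hs ▸ Submodule.mem_top)

/-- The identification `gr V ≃ V` given by the orthogonal gradation of `V`. -/
def grEquiv : A.Gr ≃ₗ[ℝ] V := LinearEquiv.ofBijective A.grMap A.grMap_bijective

/-- The scalar product of `gr V`: the summands are orthogonal, and each `H (i+1) / H i` carries the
scalar product of the orthogonal complement of `H i` in `H (i+1)`. -/
@[reducible] def grCore : InnerProductSpace.Core ℝ A.Gr where
  inner a b := inner ℝ (A.grEquiv a) (A.grEquiv b)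
  conj_inner_symm a b := by simp [real_inner_comm]
  re_inner_nonneg a := by simp
  add_left a b c := by simp [inner_add_left]
  smul_left a b c := by simp [real_inner_smul_left]
  definite a h := by simpa using h

instance : NormedAddCommGroup A.Gr := A.grCore.toNormedAddCommGroup
instance : InnerProductSpace ℝ A.Gr := InnerProductSpace.ofCore A.grCore.toCore
instance : FiniteDimensional ℝ A.Gr := A.grEquiv.symm.finiteDimensional

end
end FiniteFlag

/-! ### The Chevalley-Eilenberg differential -/

/-- The Chevalley-Eilenberg differential of a vector space `L` with bracket `B`, in degree `k`. It is
zero in degree `0`; in degree `k + 1` it is given for skew `B` by the usual formula, see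
`ceDifferential_apply`. The antisymmetrisation below counts each pair of indices twice,
which explains the factor `-1/2`. -/
def ceDifferential {L : Type*} [AddCommGroup L] [Module ℝ L] (B : L →ₗ[ℝ] L →ₗ[ℝ] L) :
    (k : ℕ) → (L [⋀^Fin k]→ₗ[ℝ] ℝ) →ₗ[ℝ] (L [⋀^Fin (k + 1)]→ₗ[ℝ] ℝ)
  | 0 => 0
  | k + 1 =>
    { toFun := fun α => (-(1 / 2) : ℝ) • AlternatingMap.alternatizeUncurryFin
        (AlternatingMap.alternatizeUncurryFinLM ∘ₗ B.compr₂ α.curryLeft)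
      map_add' := fun α β => by
        have : B.compr₂ (α + β).curryLeft = B.compr₂ α.curryLeft + B.compr₂ β.curryLeft := by
          ext; simp
        rw [this, LinearMap.comp_add, AlternatingMap.alternatizeUncurryFin_add, smul_add]
      map_smul' := fun c α => by
        have : B.compr₂ (c • α).curryLeft = c • B.compr₂ α.curryLeft := by
          ext; simp
        rw [this, LinearMap.comp_smul, AlternatingMap.alternatizeUncurryFin_smul, smul_comm,
          RingHom.id_apply] }

/-- `(dα)(v₀,…,v_{k+1}) = ∑_{p<q} (-1)^{p+q} α([v_p,v_q], v₀,…,v̂_p,…,v̂_q,…,v_{k+1})`; the pairs `p < q`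
are parametrised as `p = i.castSucc`, `q = j.succ` with `i ≤ j`. -/
theorem ceDifferential_apply {L : Type*} [AddCommGroup L] [Module ℝ L] (B : L →ₗ[ℝ] L →ₗ[ℝ] L)
    (hB : ∀ a b, B a b = -B b a) (k : ℕ) (α : L [⋀^Fin (k + 1)]→ₗ[ℝ] ℝ) (v : Fin (k + 2) → L) :
    ceDifferential B (k + 1) α v = ∑ i : Fin (k + 1), ∑ j ≥ i,
      (-1 : ℝ) ^ ((i.castSucc : ℕ) + (j.succ : ℕ)) *
        α (Matrix.vecCons (B (v i.castSucc) (v j.succ))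
          (j.removeNth (i.castSucc.removeNth v))) := by
  have h := AlternatingMap.alternatizeUncurryFin_alternatizeUncurryFinLM_comp_apply
    (B.compr₂ α.curryLeft) v
  change (-(1 / 2) : ℝ) * (AlternatingMap.alternatizeUncurryFin _ v : ℝ) = _
  rw [h, Finset.mul_sum]
  refine Finset.sum_congr rfl fun i _ => ?_
  rw [Finset.mul_sum]
  refine Finset.sum_congr rfl fun j _ => ?_
  have hs : ∀ w, α (Matrix.vecCons (B (v j.succ) (v i.castSucc)) w) =
      -α (Matrix.vecCons (B (v i.castSucc) (v j.succ)) w) := fun w => by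
    have := (α.curryLeft).map_neg (B (v i.castSucc) (v j.succ))
    rw [hB (v j.succ)]
    exact congrArg (fun f : L [⋀^Fin k]→ₗ[ℝ] ℝ => f w) this
  simp only [LinearMap.compr₂_apply, AlternatingMap.curryLeft_apply_apply, hs, zsmul_eq_mul,
    Fin.val_castSucc, Fin.val_succ]
  push_cast
  ring


/-! ### Forms of all degrees and pointwise operators -/

section PointwiseOperators

variable {V : Type*} [AddCommGroup V] [Module ℝ V]

/-- The full space of forms `⨁ k, ∧^k V*`, written as a product: only the degrees `k ≤ dim V`
contribute. -/
abbrev TotalForm (V : Type*) [AddCommGroup V] [Module ℝ V] : Type _ :=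
  ∀ k : ℕ, V [⋀^Fin k]→ₗ[ℝ] ℝ

/-- The operator on forms of all degrees with components `D k` from degree `k` to degree `k + 1`. -/
def raiseDegree (D : ∀ k : ℕ, (V [⋀^Fin k]→ₗ[ℝ] ℝ) →ₗ[ℝ] (V [⋀^Fin (k + 1)]→ₗ[ℝ] ℝ)) :
    TotalForm V →ₗ[ℝ] TotalForm V :=
  LinearMap.pi fun
    | 0 => 0
    | k + 1 => D k ∘ₗ LinearMap.proj k

/-- The operator on forms of all degrees with components `D k` from degree `k + 1` to degree `k`;
it vanishes in degree `0`. -/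
def lowerDegree (D : ∀ k : ℕ, (V [⋀^Fin (k + 1)]→ₗ[ℝ] ℝ) →ₗ[ℝ] (V [⋀^Fin k]→ₗ[ℝ] ℝ)) :
    TotalForm V →ₗ[ℝ] TotalForm V :=
  LinearMap.pi fun k => D k ∘ₗ LinearMap.proj (k + 1)

end PointwiseOperators

namespace FiniteFlag

variable {V : Type*} [NormedAddCommGroup V] [InnerProductSpace ℝ V] [FiniteDimensional ℝ V]
  (A : FiniteFlag V) (B : A.Gr →ₗ[ℝ] A.Gr →ₗ[ℝ] A.Gr)

/-- The map `Φ : ∧^k V* ≃ ∧^k (gr V)*` induced by the identification `gr V ≃ V`. -/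
def toOsculating (k : ℕ) : (V [⋀^Fin k]→ₗ[ℝ] ℝ) ≃ₗ[ℝ] (A.Gr [⋀^Fin k]→ₗ[ℝ] ℝ) :=
  AlternatingMap.domLCongr ℝ ℝ (Fin k) ℝ A.grEquiv.symm

/-- The base differential `d₀ = Φ⁻¹ ∘ d_𝔤 ∘ Φ`, where `d_𝔤` is the Chevalley-Eilenberg differential of
`gr V` for the bracket `B`. -/
def baseD (k : ℕ) : (V [⋀^Fin k]→ₗ[ℝ] ℝ) →ₗ[ℝ] (V [⋀^Fin (k + 1)]→ₗ[ℝ] ℝ) :=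
  (A.toOsculating (k + 1)).symm.toLinearMap ∘ₗ ceDifferential B k ∘ₗ
    (A.toOsculating k).toLinearMap

/-- The transpose `d₀ᵗ`. -/
def baseDTranspose (k : ℕ) : (V [⋀^Fin (k + 1)]→ₗ[ℝ] ℝ) →ₗ[ℝ] (V [⋀^Fin k]→ₗ[ℝ] ℝ) :=
  LinearMap.adjoint (A.baseD B k)

/-- The partial inverse `d₀⁻¹ = Φ⁻¹ ∘ d_𝔤⁻¹ ∘ Φ`. -/
def baseDInv (k : ℕ) : (V [⋀^Fin (k + 1)]→ₗ[ℝ] ℝ) →ₗ[ℝ] (V [⋀^Fin k]→ₗ[ℝ] ℝ) :=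
  (A.toOsculating k).symm.toLinearMap ∘ₗ partialInverse (ceDifferential B k) ∘ₗ
    (A.toOsculating (k + 1)).toLinearMap

end FiniteFlag

/-! ### Filtered manifolds -/

section Manifold

variable {n : ℕ} {M : Type*} [TopologicalSpace M] [ChartedSpace (EuclideanSpace ℝ (Fin n)) M]

instance tangentSpace_finite (x : M) : FiniteDimensional ℝ (TangentSpace (𝓡 n) x) :=
  inferInstanceAs (FiniteDimensional ℝ (EuclideanSpace ℝ (Fin n)))

def IsSmoothVectorField [IsManifold (𝓡 n) ∞ M] (X : ∀ x : M, TangentSpace (𝓡 n) x) : Prop :=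
  ContMDiff (𝓡 n) (𝓡 n).tangent ∞ fun x => (⟨x, X x⟩ : TangentBundle (𝓡 n) M)

variable (n M) in
/-- A filtered manifold: a filtration `0 = H 0 ⊆ H 1 ⊆ ⋯ ⊆ H s = TM` of the tangent bundle by smooth
vector subbundles with `[Γ(H i), Γ(H j)] ⊆ Γ(H (i+j))`, where `H i = TM` for `i > s`. That the `H i`
form a flag of smooth subbundles is expressed by local triviality of the flag: near every point there
is a smooth frame of `TM` adapted to it. -/
structure ManifoldFiltration [IsManifold (𝓡 n) ∞ M] where
  flag : ∀ x : M, FiniteFlag (TangentSpace (𝓡 n) x)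
  step : ℕ
  flag_step : ∀ x, (flag x).H step = ⊤
  exists_adapted_frame : ∀ x : M, ∃ U : Set M, IsOpen U ∧ x ∈ U ∧
    ∃ (w : Fin n → ℕ) (X : Fin n → ∀ y : M, TangentSpace (𝓡 n) y),
      IsLocalFrameOn (𝓡 n) (EuclideanSpace ℝ (Fin n)) ∞ X U ∧
      ∀ y ∈ U, ∀ i, (flag y).H i = Submodule.span ℝ ((fun a => X a y) '' {a | w a ≤ i})
  bracket_mem : ∀ (i j : ℕ) (X Y : ∀ x : M, TangentSpace (𝓡 n) x),
    IsSmoothVectorField X → IsSmoothVectorField Y →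
    (∀ x, X x ∈ (flag x).H i) → (∀ x, Y x ∈ (flag x).H j) →
    ∀ x, VectorField.mlieBracket (𝓡 n) X Y x ∈ (flag x).H (i + j)

namespace ManifoldFiltration

variable [IsManifold (𝓡 n) ∞ M] (F : ManifoldFiltration n M)

/-- `B` is the bracket of the osculating Lie algebra `𝔤_x M = gr (T_x M)`: for vector fields
`X ∈ Γ(H (i+1))` and `Y ∈ Γ(H (j+1))`, it sends the classes of `X x` and `Y x` in `H (i+1) / H i` and
`H (j+1) / H j` to the class of `[X, Y] x` in `H (i+j+2) / H (i+j+1)`. As every vector of `H i` at `x`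
is the value of a section of `H i`, there is at most one such `B`. -/
def IsOsculatingBracket (x : M)
    (B : (F.flag x).Gr →ₗ[ℝ] (F.flag x).Gr →ₗ[ℝ] (F.flag x).Gr) : Prop :=
  ∀ (i j : ℕ) (X Y : ∀ y : M, TangentSpace (𝓡 n) y),
    IsSmoothVectorField X → IsSmoothVectorField Y →
    ∀ (hX : ∀ y, X y ∈ (F.flag y).H (i + 1)) (hY : ∀ y, Y y ∈ (F.flag y).H (j + 1))
      (hXY : VectorField.mlieBracket (𝓡 n) X Y x ∈ (F.flag x).H (i + j + 1 + 1)),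
      B ((F.flag x).symbol i (X x) (hX x)) ((F.flag x).symbol j (Y x) (hY x)) =
        (F.flag x).symbol (i + j + 1) (VectorField.mlieBracket (𝓡 n) X Y x) hXY

open Classical in
/-- The bracket of the osculating Lie algebra `𝔤_x M`. -/
def osculatingBracket (x : M) : (F.flag x).Gr →ₗ[ℝ] (F.flag x).Gr →ₗ[ℝ] (F.flag x).Gr :=
  if h : ∃ B, F.IsOsculatingBracket x B then h.choose else 0

/-- The osculating Chevalley-Eilenberg differential `d_{𝔤_x M}` on `∧^k 𝔤_x^* M`. -/
def osculatingD (x : M) (k : ℕ) : ((F.flag x).Gr [⋀^Fin k]→ₗ[ℝ] ℝ) →ₗ[ℝ]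
    ((F.flag x).Gr [⋀^Fin (k + 1)]→ₗ[ℝ] ℝ) :=
  ceDifferential (F.osculatingBracket x) k

variable [RiemannianBundle (fun x : M => TangentSpace (𝓡 n) x)]

/-- `d₀` at `x`, on forms of all degrees. -/
def baseDAt (x : M) : TotalForm (TangentSpace (𝓡 n) x) →ₗ[ℝ] TotalForm (TangentSpace (𝓡 n) x) :=
  raiseDegree ((F.flag x).baseD (F.osculatingBracket x))

/-- `δ₀ = d₀ᵗ` at `x`, on forms of all degrees. -/
def baseDTransposeAt (x : M) : TotalForm (TangentSpace (𝓡 n) x) →ₗ[ℝ] TotalForm (TangentSpace (𝓡 n) x) :=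
  lowerDegree ((F.flag x).baseDTranspose (F.osculatingBracket x))

/-- `d₀⁻¹` at `x`, on forms of all degrees. -/
def baseDInvAt (x : M) : TotalForm (TangentSpace (𝓡 n) x) →ₗ[ℝ] TotalForm (TangentSpace (𝓡 n) x) :=
  lowerDegree ((F.flag x).baseDInv (F.osculatingBracket x))

/-- The base box `□₀ = d₀ δ₀ + δ₀ d₀` at `x`. -/
def baseBoxAt (x : M) : Module.End ℝ (TotalForm (TangentSpace (𝓡 n) x)) :=
  F.baseDAt x ∘ₗ F.baseDTransposeAt x + F.baseDTransposeAt x ∘ₗ F.baseDAt x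

/-- All nonzero eigenvalues of `□₀` at the points of `U` have absolute value at least `r`. (The operator
is symmetric, so its eigenvalues are real; through `Φ` they are those of the osculating box.) -/
def HasSpectralGap (U : Set M) (r : ℝ) : Prop :=
  ∀ x ∈ U, ∀ l : ℝ, l ≠ 0 → (F.baseBoxAt x).HasEigenvalue l → r ≤ |l|

end ManifoldFiltration
end Manifold

/-! ### Smooth forms, the exterior differential, differential operators -/

section Forms

variable {n : ℕ} {M : Type*} [TopologicalSpace M] [ChartedSpace (EuclideanSpace ℝ (Fin n)) M]

variable (n M) in
/-- Families of forms on the tangent spaces, of all degrees, without regularity. -/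
def FieldOfForms : Type _ := ∀ x : M, TotalForm (TangentSpace (𝓡 n) x)

instance : AddCommGroup (FieldOfForms n M) :=
  inferInstanceAs (AddCommGroup (∀ x : M, TotalForm (TangentSpace (𝓡 n) x)))

instance : Module ℝ (FieldOfForms n M) :=
  inferInstanceAs (Module ℝ (∀ x : M, TotalForm (TangentSpace (𝓡 n) x)))

/-- An alternating map on `ℝⁿ` is continuous. -/
def toContinuousAlt {k : ℕ} (α : (EuclideanSpace ℝ (Fin n)) [⋀^Fin k]→ₗ[ℝ] ℝ) :
    (EuclideanSpace ℝ (Fin n)) [⋀^Fin k]→L[ℝ] ℝ :=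
  { α with
    cont := by
      have h : ∀ v : Fin k → EuclideanSpace ℝ (Fin n), α v =
          ∑ r : Fin k → Fin n, (∏ i, v i (r i)) •
            α (fun i => EuclideanSpace.basisFun (Fin n) ℝ (r i)) := fun v => by
        have hv : v = fun i => ∑ j, v i j • EuclideanSpace.basisFun (Fin n) ℝ j := by
          funext i
          simpa using ((EuclideanSpace.basisFun (Fin n) ℝ).sum_repr (v i)).symm
        conv_lhs => rw [hv]
        rw [← AlternatingMap.coe_multilinearMap, MultilinearMap.map_sum]
        simp_rw [MultilinearMap.map_smul_univ]
      change Continuous fun v => α v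
      rw [funext h]
      fun_prop }

/-- The degree `k` part of `θ` read in the preferred chart at `x₀`: the pullback by the inverse chart. -/
def chartRep (x₀ : M) (θ : FieldOfForms n M) (k : ℕ) (y : EuclideanSpace ℝ (Fin n)) :
    (EuclideanSpace ℝ (Fin n)) [⋀^Fin k]→L[ℝ] ℝ :=
  toContinuousAlt ((θ ((extChartAt (𝓡 n) x₀).symm y) k).compLinearMap
    (mfderiv 𝓘(ℝ, EuclideanSpace ℝ (Fin n)) (𝓡 n) (extChartAt (𝓡 n) x₀).symm y).toLinearMap)

/-- `θ` is smooth on the open set `U`, in all charts. -/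
def IsSmoothFormOn (U : Set M) (θ : FieldOfForms n M) : Prop :=
  ∀ (k : ℕ) (x₀ : M), ContDiffOn ℝ ∞ (chartRep x₀ θ k)
    ((extChartAt (𝓡 n) x₀).target ∩ (extChartAt (𝓡 n) x₀).symm ⁻¹' U)

/-- The de Rham differential: at `x`, the exterior derivative of the representative in the chart at `x`,
pulled back by that chart. -/
def exteriorD (θ : FieldOfForms n M) : FieldOfForms n M := fun x k =>
  match k with
  | 0 => 0
  | k + 1 => (extDeriv (chartRep x θ k) (extChartAt (𝓡 n) x x)).toAlternatingMap.compLinearMap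
      (mfderiv (𝓡 n) 𝓘(ℝ, EuclideanSpace ℝ (Fin n)) (extChartAt (𝓡 n) x) x).toLinearMap

variable (n) in
/-- The space `Ω^•(U)` of smooth forms on the open set `U`, extended by zero outside `U`;
`Ω^•(M)` is the case `U = univ`. -/
def SmoothForms (U : Set M) : Submodule ℝ (FieldOfForms n M) where
  carrier := {θ | IsSmoothFormOn U θ ∧ ∀ x ∉ U, θ x = 0}
  add_mem' {θ η} hθ hη := by
    refine ⟨fun k x₀ => ((hθ.1 k x₀).add (hη.1 k x₀)).congr fun y _ => ?_, fun x hx => ?_⟩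
    · ext v; rfl
    · change θ x + η x = 0
      rw [hθ.2 x hx, hη.2 x hx, add_zero]
  zero_mem' := by
    refine ⟨fun k x₀ => (contDiffOn_const (c := 0)).congr fun y _ => ?_, fun x hx => rfl⟩
    ext v; rfl
  smul_mem' c θ hθ := by
    refine ⟨fun k x₀ => ((hθ.1 k x₀).const_smul c).congr fun y _ => ?_, fun x hx => ?_⟩
    · ext v; rfl
    · change c • θ x = 0
      rw [hθ.2 x hx, smul_zero]

open Classical in
/-- The restriction `Ω^•(M) → Ω^•(U)`. -/
def restrictForm (U : Set M) : SmoothForms n (Set.univ : Set M) →ₗ[ℝ] SmoothForms n U where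
  toFun θ := ⟨fun x => if x ∈ U then θ.1 x else 0, by
    refine ⟨fun k x₀ => ?_, fun x hx => if_neg hx⟩
    refine ((θ.2.1 k x₀).mono fun y hy => ⟨hy.1, Set.mem_univ _⟩).congr fun y hy => ?_
    have : (extChartAt (𝓡 n) x₀).symm y ∈ U := hy.2
    simp only [chartRep]
    rw [if_pos this]⟩
  map_add' θ η := by
    refine Subtype.ext (funext fun x => ?_)
    change (if x ∈ U then θ.1 x + η.1 x else 0) =
      (if x ∈ U then θ.1 x else 0) + (if x ∈ U then η.1 x else 0)
    split_ifs <;> simp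
  map_smul' c θ := by
    refine Subtype.ext (funext fun x => ?_)
    change (if x ∈ U then c • θ.1 x else 0) = c • (if x ∈ U then θ.1 x else 0)
    split_ifs <;> simp

/-- Multiplication of forms by a smooth function. -/
def mulForm [IsManifold (𝓡 n) ∞ M] (f : C^∞⟮𝓡 n, M; 𝓘(ℝ, ℝ), ℝ⟯) :
    Module.End ℝ (SmoothForms n (Set.univ : Set M)) where
  toFun θ := ⟨fun x => f x • θ.1 x, by
    refine ⟨fun k x₀ => ?_, fun x hx => absurd (Set.mem_univ x) hx⟩
    have hf : ContDiffOn ℝ ∞ (fun y => f ((extChartAt (𝓡 n) x₀).symm y))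
        ((extChartAt (𝓡 n) x₀).target ∩ (extChartAt (𝓡 n) x₀).symm ⁻¹' Set.univ) := by
      rw [← contMDiffOn_iff_contDiffOn]
      exact (f.contMDiff.comp_contMDiffOn (contMDiffOn_extChartAt_symm x₀)).mono
        Set.inter_subset_left
    refine (hf.smul (θ.2.1 k x₀)).congr fun y _ => ?_
    ext v; rfl⟩
  map_add' θ η := by
    exact Subtype.ext (funext fun x => smul_add (f x) (θ.1 x) (η.1 x))
  map_smul' c θ := by
    exact Subtype.ext (funext fun x => smul_comm (f x) c (θ.1 x))

/-- Linear differential operators on `Ω^•(M)` of order at most `m`, by induction: those of order `0`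
commute with the multiplications by functions, and `T` has order at most `m + 1` when its commutators
with all these multiplications have order at most `m`. -/
def HasOrderLE [IsManifold (𝓡 n) ∞ M] :
    ℕ → Module.End ℝ (SmoothForms n (Set.univ : Set M)) → Prop
  | 0, T => ∀ f : C^∞⟮𝓡 n, M; 𝓘(ℝ, ℝ), ℝ⟯, T * mulForm f = mulForm f * T
  | m + 1, T => ∀ f : C^∞⟮𝓡 n, M; 𝓘(ℝ, ℝ), ℝ⟯, HasOrderLE m (T * mulForm f - mulForm f * T)

def IsDifferentialOperator [IsManifold (𝓡 n) ∞ M]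
    (T : Module.End ℝ (SmoothForms n (Set.univ : Set M))) : Prop :=
  ∃ m, HasOrderLE m T

/-- The linear operator `A` of `Ω^•(U)` is given by the formula `T`. -/
def Realizes (U : Set M) (A : Module.End ℝ (SmoothForms n U))
    (T : FieldOfForms n M → FieldOfForms n M) : Prop :=
  ∀ θ : SmoothForms n U, ∀ x ∈ U, (A θ).1 x = T θ.1 x

/-- The operator on fields of forms acting by `D x` at each point `x`. -/
def pointwise (D : ∀ x : M, TotalForm (TangentSpace (𝓡 n) x) →ₗ[ℝ] TotalForm (TangentSpace (𝓡 n) x))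
    (θ : FieldOfForms n M) : FieldOfForms n M := fun x => D x (θ x)

/-- The value at the point `x`, in degree `k` and on the vectors `v`, of a complex-valued form; the space
of complex-valued smooth forms on `U` is the complexification `ℂ ⊗ Ω^•(U)`. -/
def evalForm (U : Set M) (x : M) (k : ℕ) (v : Fin k → TangentSpace (𝓡 n) x) :
    (ℂ ⊗[ℝ] SmoothForms n U) →ₗ[ℝ] ℂ :=
  (TensorProduct.rid ℝ ℂ).toLinearMap ∘ₗ LinearMap.lTensor ℂ
    { toFun := fun θ : SmoothForms n U => θ.1 x k v
      map_add' := fun _ _ => rfl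
      map_smul' := fun _ _ => rfl }

/-- The function `z ↦ ((z - A)⁻¹ θ)(x)`, in degree `k` and on the vectors `v`, where `A` is an operator
of `Ω^•(U)` extended to complex-valued forms. -/
def resolventValue {U : Set M} (A : Module.End ℝ (SmoothForms n U)) (θ : SmoothForms n U)
    (x : M) (k : ℕ) (v : Fin k → TangentSpace (𝓡 n) x) (z : ℂ) : ℂ :=
  evalForm U x k v
    (resolvent (LinearMap.baseChange ℂ A : Module.End ℂ (ℂ ⊗[ℝ] SmoothForms n U)) z (1 ⊗ₜ[ℝ] θ))

/-- The contour integral `1/(2πi) ∮_{|z|=ε} (z - A)⁻¹ θ dz` at `x`, in degree `k` and on the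
vectors `v`. -/
def contourProjection {U : Set M} (A : Module.End ℝ (SmoothForms n U)) (ε : ℝ)
    (θ : SmoothForms n U) (x : M) (k : ℕ) (v : Fin k → TangentSpace (𝓡 n) x) : ℂ :=
  (2 * Real.pi * Complex.I)⁻¹ * ∮ z in C(0, ε), resolventValue A θ x k v z

end Forms

end FilteredRiemannian

end FilteredRiemannianDefs

open FilteredRiemannian

set_option linter.unusedSectionVars false

noncomputable section FilteredRiemannianProofs

namespace FilteredRiemannian


/-! ### Scalar product on forms: independence of the orthonormal basis -/

section AltInner

variable {V V' : Type*} [NormedAddCommGroup V] [InnerProductSpace ℝ V] [FiniteDimensional ℝ V]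
  [NormedAddCommGroup V'] [InnerProductSpace ℝ V'] [FiniteDimensional ℝ V']

/-! Give a covector dual to `H^i/H^{i-1}` the weight `i`, and let weights add in products. In an
orthonormal frame adapted to the flag, Cartan's formula shows that `d` respects the filtration of
forms by weight, that `d₀` is its weight-preserving part, and that `d - d₀` raises the weight by at
least one (`OrthoFrame.exteriorD_sub_mem`). The maps `d₀`, `δ₀` and `d₀⁻¹` commute with the
dilations attached to the weights, so they preserve the filtration (`apply_mem_weightGE`,
`IsPenroseInverse.commute`). Weights are at most `n * step`; hence `d₀⁻¹(d - d₀)` and `(d - d₀)d₀⁻¹`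
are nilpotent, and the inverses of `1 - b` and `1 - b₁` are finite geometric series of differential
operators.

The rest of parts 1 and 2 is algebra (`IsBaseComplex`, `IsRetraction`). Put `Q = (1 - b)⁻¹d₀⁻¹`.
Then `d₀⁻¹dQ = d₀⁻¹ = Q d d₀⁻¹`, `Q² = 0` and `QdQ = Q`; together with `d² = 0` this makes `Π = Qd +
dQ` idempotent and gives its range and kernel. The maps `d₀⁻¹` and `δ₀` factor through each other on
both sides, so either may be used to describe `E` and `F`, and `□Π = □ = Π□`.

For part 3, `□` vanishes on the image of `1 - Π`, acts as `δ₀d` on `Im δ₀`, and acts as `dδ₀` on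
`d(Im δ₀)`, where `d` conjugates it to `δ₀d`. So `(z - □)⁻¹ = z⁻¹(1 - Π) + K(z)Qd + dK(z)Q`, with
`K(z)` the inverse of `z - δ₀d` on `Im δ₀` (`mul_boxResolvent`, `boxResolvent_mul`). Here `δ₀d`
differs from the pointwise operator `δ₀d₀` by the weight-raising term `δ₀(d - d₀)`, so `K(z)` is a
finite Neumann series starting from the pointwise resolvent of `δ₀d₀` on `Im δ₀`. The latter exists
for all `|z| < r`, including `z = 0`. Values of `K(z)` are holomorphic there by the resolvent
identity, and Cauchy's theorem leaves only the residue `1 - Π`.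

Three points are analytic or geometric. The osculating bracket is well defined because, in the
relevant weight, the components of a bracket depend only on the values of the two fields
(`OrthoFrame.inner_bracket`). The identity `d₀² = 0`, from which `δ₀² = 0`, is read off from `d² =
0` in leading weight (`ceDifferential_tangentBracket_comp`). Constancy of the rank makes `d₀⁻¹`
smooth (`SmoothLinearAt.penroseInverse`); its local boundedness then gives the spectral gap
(`exists_hasSpectralGap`). -/

theorem alternatingMap_apply_sum_basis {W ι : Type*} [AddCommGroup W] [Module ℝ W] [Fintype ι]
    {k : ℕ} (α : W [⋀^Fin k]→ₗ[ℝ] ℝ) (c : Fin k → ι → ℝ) (b : ι → W) :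
    α (fun i => ∑ j, c i j • b j) = ∑ r : Fin k → ι, (∏ i, c i (r i)) * α (fun i => b (r i)) := by
  rw [← AlternatingMap.coe_multilinearMap, MultilinearMap.map_sum]
  simp_rw [MultilinearMap.map_smul_univ, smul_eq_mul]

theorem altForm_inner_def {k : ℕ} (α β : V [⋀^Fin k]→ₗ[ℝ] ℝ) :
    inner ℝ α β = (Nat.factorial k : ℝ)⁻¹ * ∑ v : Fin k → Fin (finrank ℝ V),
      α (fun i => stdOrthonormalBasis ℝ V (v i)) * β (fun i => stdOrthonormalBasis ℝ V (v i)) := rfl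

/-- Expand every basis vector of `b` in the basis `e`: the sum over tuples of the products of
coefficients factors slot by slot, and Parseval gives a Kronecker delta in each slot. The scalar
product on forms is defined through an arbitrary basis, whereas the computations below use adapted
frames. -/
theorem sum_apply_mul_apply_eq {ι ι' : Type*} [Fintype ι] [Fintype ι'] (b : OrthonormalBasis ι ℝ V)
    (e : OrthonormalBasis ι' ℝ V) {k : ℕ} (α β : V [⋀^Fin k]→ₗ[ℝ] ℝ) :
    ∑ v : Fin k → ι, α (fun i => b (v i)) * β (fun i => b (v i)) =
      ∑ v : Fin k → ι', α (fun i => e (v i)) * β (fun i => e (v i)) := by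
  classical
  have hb : ∀ (γ : V [⋀^Fin k]→ₗ[ℝ] ℝ) (v : Fin k → ι), γ (fun i => b (v i)) =
      ∑ r : Fin k → ι', (∏ i, inner ℝ (e (r i)) (b (v i))) * γ (fun i => e (r i)) := by
    intro γ v
    rw [← alternatingMap_apply_sum_basis γ (fun i j => inner ℝ (e j) (b (v i))) e]
    congr 1
    funext i
    exact (e.sum_repr' (b (v i))).symm
  have key : ∀ r s : Fin k → ι', ∑ v : Fin k → ι,
      (∏ i, inner ℝ (e (r i)) (b (v i))) * (∏ i, inner ℝ (e (s i)) (b (v i))) =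
        if r = s then (1 : ℝ) else 0 := by
    intro r s
    simp_rw [← Finset.prod_mul_distrib]
    -- The sum over tuples of a product over slots is the product over slots of sums.
    rw [← Fintype.piFinset_univ,
      ← Finset.prod_univ_sum (fun _ => Finset.univ) (fun i j =>
        inner ℝ (e (r i)) (b j) * inner ℝ (e (s i)) (b j))]
    have : ∀ i, ∑ j, inner ℝ (e (r i)) (b j) * inner ℝ (e (s i)) (b j) =
        if r i = s i then (1 : ℝ) else 0 := by
      intro i
      have h1 := b.sum_inner_mul_inner (e (r i)) (e (s i))
      rw [orthonormal_iff_ite.mp e.orthonormal] at h1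
      rw [← h1]
      exact Finset.sum_congr rfl fun j _ => by rw [real_inner_comm (e (s i))]
    simp_rw [this]
    split_ifs with h
    · subst h; simp
    · obtain ⟨i, hi⟩ := Function.ne_iff.mp h
      exact Finset.prod_eq_zero (Finset.mem_univ i) (if_neg hi)
  calc ∑ v : Fin k → ι, α (fun i => b (v i)) * β (fun i => b (v i))
      = ∑ v : Fin k → ι, ∑ r : Fin k → ι', ∑ s : Fin k → ι',
          ((∏ i, inner ℝ (e (r i)) (b (v i))) * (∏ i, inner ℝ (e (s i)) (b (v i)))) *
            (α (fun i => e (r i)) * β (fun i => e (s i))) := by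
        refine Finset.sum_congr rfl fun v _ => ?_
        rw [hb α v, hb β v, Finset.sum_mul_sum]
        exact Finset.sum_congr rfl fun r _ => Finset.sum_congr rfl fun s _ => by ring
    _ = ∑ r : Fin k → ι', ∑ s : Fin k → ι', ∑ v : Fin k → ι,
          ((∏ i, inner ℝ (e (r i)) (b (v i))) * (∏ i, inner ℝ (e (s i)) (b (v i)))) *
            (α (fun i => e (r i)) * β (fun i => e (s i))) := by
        rw [Finset.sum_comm]
        exact Finset.sum_congr rfl fun r _ => Finset.sum_comm
    _ = _ := by
        simp_rw [← Finset.sum_mul, key]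
        simp

theorem altForm_inner_eq {ι : Type*} [Fintype ι] (b : OrthonormalBasis ι ℝ V) {k : ℕ}
    (α β : V [⋀^Fin k]→ₗ[ℝ] ℝ) :
    inner ℝ α β = (Nat.factorial k : ℝ)⁻¹ * ∑ v : Fin k → ι,
      α (fun i => b (v i)) * β (fun i => b (v i)) := by
  rw [altForm_inner_def, sum_apply_mul_apply_eq b (stdOrthonormalBasis ℝ V)]

/-- The isometry between the spaces of forms induced by an isometry between Euclidean spaces. -/
def altPullback (f : V ≃ₗᵢ[ℝ] V') (k : ℕ) : (V' [⋀^Fin k]→ₗ[ℝ] ℝ) ≃ₗᵢ[ℝ] (V [⋀^Fin k]→ₗ[ℝ] ℝ) :=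
  (AlternatingMap.domLCongr ℝ ℝ (Fin k) ℝ f.symm.toLinearEquiv).isometryOfInner fun α β => by
    rw [altForm_inner_eq (stdOrthonormalBasis ℝ V),
      altForm_inner_eq ((stdOrthonormalBasis ℝ V).map f)]
    rfl

@[simp] theorem altPullback_apply (f : V ≃ₗᵢ[ℝ] V') (k : ℕ) (α : V' [⋀^Fin k]→ₗ[ℝ] ℝ) (v : Fin k → V) :
    altPullback f k α v = α (fun i => f (v i)) := rfl

@[simp] theorem altPullback_symm_apply (f : V ≃ₗᵢ[ℝ] V') (k : ℕ) (α : V [⋀^Fin k]→ₗ[ℝ] ℝ) (v : Fin k → V') :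
    (altPullback f k).symm α v = α (fun i => f.symm (v i)) := rfl

end AltInner

/-! ### Moore–Penrose equations for the partial inverse -/

section Penrose

variable {V W V' W' : Type*} [NormedAddCommGroup V] [InnerProductSpace ℝ V] [FiniteDimensional ℝ V]
  [NormedAddCommGroup W] [InnerProductSpace ℝ W] [FiniteDimensional ℝ W]
  [NormedAddCommGroup V'] [InnerProductSpace ℝ V'] [FiniteDimensional ℝ V']
  [NormedAddCommGroup W'] [InnerProductSpace ℝ W'] [FiniteDimensional ℝ W']

/-- The Moore-Penrose equations characterizing the partial inverse. -/
structure IsPenroseInverse (D : V →ₗ[ℝ] W) (X : W →ₗ[ℝ] V) : Prop where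
  dxd : ∀ v, D (X (D v)) = D v
  xdx : ∀ w, X (D (X w)) = X w
  symm_dx : ∀ w w', inner ℝ (D (X w)) w' = inner ℝ w (D (X w'))
  symm_xd : ∀ v v', inner ℝ (X (D v)) v' = inner ℝ v (X (D v'))

theorem partialInverse_mem (D : V →ₗ[ℝ] W) (w : W) : partialInverse D w ∈ (LinearMap.ker D)ᗮ :=
  Subtype.property _

theorem apply_partialInverse (D : V →ₗ[ℝ] W) (w : W) :
    D (partialInverse D w) = (LinearMap.range D).starProjection w := by
  have h : ∀ c, D ((c : (LinearMap.ker D)ᗮ) : V) = (D.kerComplementEquivRange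
    (Submodule.isCompl_orthogonal (LinearMap.ker D)).symm c : W) := fun _ => rfl
  rw [partialInverse, LinearMap.comp_apply, LinearMap.comp_apply, Submodule.subtype_apply, h,
    LinearEquiv.coe_coe, LinearEquiv.apply_symm_apply]
  rfl

/-- Write `X` for the partial inverse: `DX` is the orthogonal projection onto `Im D` and `XD` the
one onto `(ker D)ᗮ`, and orthogonal projections are symmetric. Everything later about `d₀⁻¹` uses
only these four equations. -/
theorem isPenroseInverse_partialInverse (D : V →ₗ[ℝ] W) :
    IsPenroseInverse D (partialInverse D) := by
  have hdx : ∀ v, D (partialInverse D (D v)) = D v := fun v => by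
    rw [apply_partialInverse]
    exact Submodule.starProjection_eq_self_iff.mpr ⟨v, rfl⟩
  have huniq : ∀ u v : V, u ∈ (LinearMap.ker D)ᗮ → v ∈ (LinearMap.ker D)ᗮ → D u = D v → u = v := by
    intro u v hu hv h
    have h1 : u - v ∈ LinearMap.ker D := by simp [h]
    have h2 : u - v ∈ (LinearMap.ker D)ᗮ := Submodule.sub_mem _ hu hv
    have := Submodule.inner_right_of_mem_orthogonal h1 h2
    rw [inner_self_eq_zero] at this
    exact sub_eq_zero.mp this
  have hxd : ∀ v, partialInverse D (D v) = (LinearMap.ker D)ᗮ.starProjection v := by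
    intro v
    refine huniq _ _ (partialInverse_mem D _) (Submodule.starProjection_apply_mem _ _) ?_
    rw [hdx]
    have h1 : v - (LinearMap.ker D)ᗮ.starProjection v ∈ LinearMap.ker D := by
      have := Submodule.sub_starProjection_mem_orthogonal (K := (LinearMap.ker D)ᗮ) v
      rwa [Submodule.orthogonal_orthogonal] at this
    rw [LinearMap.mem_ker, map_sub, sub_eq_zero] at h1
    exact h1
  refine ⟨hdx, fun w => ?_, fun w w' => ?_, fun v v' => ?_⟩
  · refine huniq _ _ (partialInverse_mem D _) (partialInverse_mem D _) ?_
    rw [hdx]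
  · simp only [apply_partialInverse]
    exact Submodule.inner_starProjection_left_eq_right _ _ _
  · simp only [hxd]
    exact Submodule.inner_starProjection_left_eq_right _ _ _

namespace IsPenroseInverse

variable {D : V →ₗ[ℝ] W} {X Y : W →ₗ[ℝ] V}

/-- This identity and the next three write `Dᵗ` and `X` as multiples of each other on both sides.
They are the source of `Im d₀⁻¹ = Im δ₀` and `ker d₀⁻¹ = ker δ₀`, in a form that remains an identity
between operators on smooth forms. -/
theorem adjoint_apply_dx (h : IsPenroseInverse D X) (w : W) :
    LinearMap.adjoint D (D (X w)) = LinearMap.adjoint D w := by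
  refine ext_inner_right ℝ fun v => ?_
  rw [LinearMap.adjoint_inner_left, h.symm_dx, h.dxd, LinearMap.adjoint_inner_left]

theorem xd_adjoint (h : IsPenroseInverse D X) (w : W) :
    X (D (LinearMap.adjoint D w)) = LinearMap.adjoint D w := by
  refine ext_inner_right ℝ fun v => ?_
  rw [h.symm_xd, LinearMap.adjoint_inner_left, h.dxd, LinearMap.adjoint_inner_left]

theorem eq_adjoint_adjoint (h : IsPenroseInverse D X) (w : W) :
    X w = LinearMap.adjoint D (LinearMap.adjoint X (X w)) := by
  refine ext_inner_right ℝ fun v => ?_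
  rw [LinearMap.adjoint_inner_left, LinearMap.adjoint_inner_left, ← h.symm_xd, h.xdx]

theorem eq_apply_adjoint (h : IsPenroseInverse D X) (w : W) :
    X w = X (LinearMap.adjoint X (LinearMap.adjoint D w)) := by
  rw [← h.xdx w]
  congr 1
  refine ext_inner_right ℝ fun v => ?_
  rw [h.symm_dx, LinearMap.adjoint_inner_left, LinearMap.adjoint_inner_left]

/-- Transport of a partial inverse by isometries. -/
theorem conj (h : IsPenroseInverse D X) (f : V ≃ₗᵢ[ℝ] V') (g : W ≃ₗᵢ[ℝ] W') {D' : V' →ₗ[ℝ] W'}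
    {X' : W' →ₗ[ℝ] V'} (hD : ∀ v, D' (f v) = g (D v)) (hX : ∀ w, X' (g w) = f (X w)) :
    IsPenroseInverse D' X' := by
  have hD' : ∀ v, D' v = g (D (f.symm v)) := fun v => by rw [← hD, f.apply_symm_apply]
  have hX' : ∀ v, X' v = f (X (g.symm v)) := fun v => by rw [← hX, g.apply_symm_apply]
  constructor
  · intro v; simp [hD', hX', h.dxd]
  · intro v; simp [hD', hX', h.xdx]
  · intro v v'
    simp only [hD', hX', f.symm_apply_apply]
    rw [← g.symm.inner_map_map, ← g.symm.inner_map_map v]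
    simpa using h.symm_dx _ _
  · intro v v'
    simp only [hD', hX', g.symm_apply_apply]
    rw [← f.symm.inner_map_map, ← f.symm.inner_map_map v]
    simpa using h.symm_xd _ _

/-- A partial inverse commutes with symmetric operators commuting with the given map. -/
theorem commute (h : IsPenroseInverse D X) {R : V →ₗ[ℝ] V} {S : W →ₗ[ℝ] W}
    (hR : R.IsSymmetric) (hS : S.IsSymmetric) (hc : ∀ v, D (R v) = S (D v)) (w : W) :
    X (S w) = R (X w) := by
  -- Since `SD = DR`, the range of `D` is stable under `S`; transposing the resulting identity shows
  -- that the symmetric `S` commutes with the projection `DX`. The same argument for `R` and `XD`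
  -- follows.
  have h1 : ∀ w, D (X (S w)) = S (D (X w)) := fun w => by
    have h3 : ∀ w, D (X (S (D (X w)))) = S (D (X w)) := fun w => by
      rw [← hc, h.dxd]
    refine ext_inner_right ℝ fun v => ?_
    rw [h.symm_dx, hS, ← h3, ← h.symm_dx, ← hS, ← h.symm_dx, h3]
  have h2 : ∀ v, X (D (R v)) = R (X (D v)) := fun v => by
    have h3 : ∀ v, X (D (R (X (D v)))) = X (D (R v)) := fun v => by
      rw [hc, h.dxd, hc]
    refine ext_inner_right ℝ fun u => ?_
    calc inner ℝ (X (D (R v))) u = inner ℝ v (X (D (R (X (D u))))) := by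
          rw [← h3, h.symm_xd, hR, h.symm_xd]
      _ = inner ℝ (R (X (D v))) u := by rw [h3, ← h.symm_xd, ← hR]
  rw [← h.xdx, h1, ← hc, h2, h.xdx]

end IsPenroseInverse
end Penrose

/-! ### The Chevalley–Eilenberg differential: naturality and linearity in the bracket -/

section Naturality

/-- The differential is an antisymmetrisation, which commutes with pullback; neither skewness nor
the Jacobi identity is needed. It is applied to the identification `gr V ≃ V`, to dilations, and to
frames. -/
theorem ceDifferential_compLinearMap {L L' : Type*} [AddCommGroup L] [Module ℝ L] [AddCommGroup L']
    [Module ℝ L'] {B : L →ₗ[ℝ] L →ₗ[ℝ] L} {B' : L' →ₗ[ℝ] L' →ₗ[ℝ] L'} (f : L →ₗ[ℝ] L')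
    (hf : ∀ a b, f (B a b) = B' (f a) (f b)) (k : ℕ) (α : L' [⋀^Fin k]→ₗ[ℝ] ℝ) :
    ceDifferential B k (α.compLinearMap f) = (ceDifferential B' k α).compLinearMap f := by
  cases k with
  | zero => rfl
  | succ k =>
    ext v
    simp only [ceDifferential, LinearMap.coe_mk, AddHom.coe_mk, AlternatingMap.smul_apply,
      AlternatingMap.alternatizeUncurryFin_apply, AlternatingMap.compLinearMap_apply,
      LinearMap.comp_apply, AlternatingMap.alternatizeUncurryFinLM_apply,
      LinearMap.compr₂_apply, AlternatingMap.curryLeft_apply_apply]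
    congr 1
    refine Finset.sum_congr rfl fun i _ => ?_
    congr 1
    refine Finset.sum_congr rfl fun j _ => ?_
    congr 2
    funext l
    refine Fin.cases ?_ (fun l => ?_) l
    · simp only [Matrix.cons_val_zero, hf]; rfl
    · rfl

theorem ceDifferential_add {L : Type*} [AddCommGroup L] [Module ℝ L] (B B' : L →ₗ[ℝ] L →ₗ[ℝ] L)
    (k : ℕ) : ceDifferential (B + B') k = ceDifferential B k + ceDifferential B' k := by
  cases k with
  | zero => simp [ceDifferential]
  | succ k =>
    ext α v
    have : (B + B').compr₂ α.curryLeft = B.compr₂ α.curryLeft + B'.compr₂ α.curryLeft := by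
      ext; simp
    simp only [ceDifferential, LinearMap.coe_mk, AddHom.coe_mk, LinearMap.add_apply, this,
      LinearMap.comp_add, AlternatingMap.alternatizeUncurryFin_add, smul_add]

theorem ceDifferential_smul {L : Type*} [AddCommGroup L] [Module ℝ L] (c : ℝ)
    (B : L →ₗ[ℝ] L →ₗ[ℝ] L) (k : ℕ) : ceDifferential (c • B) k = c • ceDifferential B k := by
  cases k with
  | zero => simp [ceDifferential]
  | succ k =>
    ext α v
    have : (c • B).compr₂ α.curryLeft = c • B.compr₂ α.curryLeft := by
      ext; simp
    simp only [ceDifferential, LinearMap.coe_mk, AddHom.coe_mk, LinearMap.smul_apply, this,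
      LinearMap.comp_smul, AlternatingMap.alternatizeUncurryFin_smul]
    rw [smul_comm]

/-- The Chevalley-Eilenberg differential as a linear function of the bracket. -/
def ceDifferentialHom (L : Type*) [AddCommGroup L] [Module ℝ L] (k : ℕ) :
    (L →ₗ[ℝ] L →ₗ[ℝ] L) →ₗ[ℝ] (L [⋀^Fin k]→ₗ[ℝ] ℝ) →ₗ[ℝ] (L [⋀^Fin (k + 1)]→ₗ[ℝ] ℝ) where
  toFun B := ceDifferential B k
  map_add' B B' := ceDifferential_add B B' k
  map_smul' c B := ceDifferential_smul c B k

end Naturality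

/-! ### The base differential on `V` itself -/

namespace FiniteFlag

variable {V : Type*} [NormedAddCommGroup V] [InnerProductSpace ℝ V] [FiniteDimensional ℝ V]
  (A : FiniteFlag V) (B : A.Gr →ₗ[ℝ] A.Gr →ₗ[ℝ] A.Gr)

/-- The identification `gr V ≃ V` is an isometry. -/
def grIsometry : A.Gr ≃ₗᵢ[ℝ] V := A.grEquiv.isometryOfInner fun _ _ => rfl

/-- The bracket of `gr V` transported to `V`. -/
def flatBracket : V →ₗ[ℝ] V →ₗ[ℝ] V :=
  ((B.compr₂ A.grEquiv.toLinearMap).compl₁₂ A.grEquiv.symm.toLinearMap A.grEquiv.symm.toLinearMap)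

theorem flatBracket_apply (u v : V) :
    A.flatBracket B u v = A.grEquiv (B (A.grEquiv.symm u) (A.grEquiv.symm v)) := rfl

/-- Conjugation by `Φ` amounts to transporting the bracket to `V`. From here on quotients are
avoided: `d₀` is a Chevalley–Eilenberg differential on the tangent space. -/
theorem baseD_eq (k : ℕ) : A.baseD B k = ceDifferential (A.flatBracket B) k := by
  ext1 α
  have h := ceDifferential_compLinearMap (B := B) (B' := A.flatBracket B) A.grEquiv.toLinearMap
    (fun a b => by simp [flatBracket_apply]) k α
  have h2 : A.baseD B k α =
      (ceDifferential B k (α.compLinearMap A.grEquiv.toLinearMap)).compLinearMap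
        A.grEquiv.symm.toLinearMap := rfl
  rw [h2, h]
  ext v
  simp

/-- As `Φ` is an isometry, it carries the Moore–Penrose equations of `d_𝔤` to those of `d₀`; the
conjugated partial inverse is therefore the partial inverse of the conjugated map. -/
theorem isPenroseInverse_baseDInv (k : ℕ) : IsPenroseInverse (A.baseD B k) (A.baseDInv B k) := by
  refine (isPenroseInverse_partialInverse (ceDifferential B k)).conj (altPullback A.grIsometry k).symm
    (altPullback A.grIsometry (k + 1)).symm (fun v => ?_) (fun w => ?_)
  · exact congrArg (fun u => (A.toOsculating (k + 1)).symm (ceDifferential B k u))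
      ((altPullback A.grIsometry k).apply_symm_apply v)
  · exact congrArg (fun u => (A.toOsculating k).symm (partialInverse (ceDifferential B k) u))
      ((altPullback A.grIsometry (k + 1)).apply_symm_apply w)

theorem finrank_range_baseD (k : ℕ) :
    finrank ℝ (LinearMap.range (A.baseD B k)) = finrank ℝ (LinearMap.range (ceDifferential B k)) := by
  rw [baseD, LinearMap.range_comp, LinearMap.range_comp, LinearEquiv.range, Submodule.map_top]
  exact LinearEquiv.finrank_eq ((A.toOsculating (k + 1)).symm.submoduleMap _).symm

end FiniteFlag

/-! ### Dilations and the weight filtration on forms -/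

section Weights

variable {V : Type*} [NormedAddCommGroup V] [InnerProductSpace ℝ V] [FiniteDimensional ℝ V]
  {ι : Type*} [Fintype ι]

/-- The forms whose components of weight less than `p` vanish. -/
def weightGE (b : ι → V) (w : ι → ℕ) (k p : ℕ) : Submodule ℝ (V [⋀^Fin k]→ₗ[ℝ] ℝ) where
  carrier := {α | ∀ I : Fin k → ι, ∑ i, w (I i) < p → α (fun i => b (I i)) = 0}
  add_mem' hα hβ I hI := by simp [hα I hI, hβ I hI]
  zero_mem' I _ := rfl
  smul_mem' c α hα I hI := by simp [hα I hI]

/-- Forms are determined by their components. -/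
theorem altForm_ext_basis {k : ℕ} {α β : V [⋀^Fin k]→ₗ[ℝ] ℝ} (b : Basis ι ℝ V)
    (h : ∀ I : Fin k → ι, α (fun i => b (I i)) = β (fun i => b (I i))) : α = β :=
  AlternatingMap.coe_multilinearMap_injective (Basis.ext_multilinear (fun _ => b) h)

variable (b : OrthonormalBasis ι ℝ V) (w : ι → ℕ)

/-- The dilation multiplying the basis vector of index `i` by `2 ^ w i`. -/
def dilation : V →ₗ[ℝ] V := b.toBasis.constr ℝ fun i => (2 : ℝ) ^ w i • b i

@[simp] theorem dilation_apply (i : ι) : dilation b w (b i) = (2 : ℝ) ^ w i • b i := by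
  have := b.toBasis.constr_basis ℝ (fun i => (2 : ℝ) ^ w i • b i) i
  rwa [OrthonormalBasis.coe_toBasis] at this

/-- The pullback of forms by the dilation. -/
def altDilation (k : ℕ) : Module.End ℝ (V [⋀^Fin k]→ₗ[ℝ] ℝ) where
  toFun α := α.compLinearMap (dilation b w)
  map_add' _ _ := rfl
  map_smul' _ _ := rfl

theorem altDilation_eq (k : ℕ) (α : V [⋀^Fin k]→ₗ[ℝ] ℝ) :
    altDilation b w k α = α.compLinearMap (dilation b w) := rfl

theorem altDilation_apply_basis (k : ℕ) (α : V [⋀^Fin k]→ₗ[ℝ] ℝ) (I : Fin k → ι) :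
    altDilation b w k α (fun i => b (I i)) = (2 : ℝ) ^ (∑ i, w (I i)) * α (fun i => b (I i)) := by
  simp only [altDilation_eq, AlternatingMap.compLinearMap_apply, dilation_apply]
  rw [AlternatingMap.map_smul_univ, Finset.prod_pow_eq_pow_sum, smul_eq_mul]

theorem altDilation_isSymmetric (k : ℕ) : (altDilation b w k).IsSymmetric := by
  intro α β
  rw [altForm_inner_eq b, altForm_inner_eq b]
  congr 1
  refine Finset.sum_congr rfl fun I _ => ?_
  rw [altDilation_apply_basis, altDilation_apply_basis]
  ring

theorem aeval_altDilation_apply_basis (k : ℕ) (q : Polynomial ℝ) (α : V [⋀^Fin k]→ₗ[ℝ] ℝ)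
    (I : Fin k → ι) : Polynomial.aeval (altDilation b w k) q α (fun i => b (I i)) =
      q.eval ((2 : ℝ) ^ (∑ i, w (I i))) * α (fun i => b (I i)) := by
  induction q using Polynomial.induction_on generalizing α with
  | C a => simp [Module.algebraMap_end_apply]
  | add p q hp hq => simp [hp, hq, add_mul]
  | monomial n a ih =>
    rw [pow_succ, ← mul_assoc, map_mul, Module.End.mul_apply, ih, Polynomial.aeval_X,
      altDilation_apply_basis]
    simp only [Polynomial.eval_mul, Polynomial.eval_X]
    ring

theorem aeval_commute {V W : Type*} [AddCommGroup V] [Module ℝ V] [AddCommGroup W] [Module ℝ W]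
    (f : V →ₗ[ℝ] W) {R : Module.End ℝ V} {S : Module.End ℝ W} (h : ∀ v, f (R v) = S (f v))
    (q : Polynomial ℝ) (v : V) : f (Polynomial.aeval R q v) = Polynomial.aeval S q (f v) := by
  induction q using Polynomial.induction_on generalizing v with
  | C a => simp [Module.algebraMap_end_apply]
  | add p q hp hq => simp [hp, hq]
  | monomial n a ih =>
    rw [pow_succ, ← mul_assoc, map_mul (Polynomial.aeval R) _ Polynomial.X, Module.End.mul_apply,
      ih, map_mul (Polynomial.aeval S) _ Polynomial.X, Module.End.mul_apply, Polynomial.aeval_X,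
      Polynomial.aeval_X, h]

/-- Operators commuting with the dilations preserve the filtration by the weights. -/
theorem apply_mem_weightGE {k l : ℕ} (f : (V [⋀^Fin k]→ₗ[ℝ] ℝ) →ₗ[ℝ] (V [⋀^Fin l]→ₗ[ℝ] ℝ))
    (hf : ∀ α, f (altDilation b w k α) = altDilation b w l (f α)) {p : ℕ}
    {α : V [⋀^Fin k]→ₗ[ℝ] ℝ} (hα : α ∈ weightGE b w k p) : f α ∈ weightGE b w l p := by
  classical
  intro J hJ
  -- Any upper bound for the weights that occur would do; the sum of all of them is one.
  let N := ∑ I : Fin k → ι, ∑ i, w (I i)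
  -- This polynomial in the dilation kills the components of weight from `p` to `N`, hence all of
  -- `α`. Moving it through `f` multiplies a component of `f α` of weight less than `p` by a nonzero
  -- number, so that component is zero.
  let q : Polynomial ℝ := ∏ j ∈ Finset.Icc p N, (Polynomial.X - Polynomial.C ((2 : ℝ) ^ j))
  have hq : Polynomial.aeval (altDilation b w k) q α = 0 := by
    refine altForm_ext_basis b.toBasis fun I => ?_
    rw [OrthonormalBasis.coe_toBasis, aeval_altDilation_apply_basis]
    by_cases hI : ∑ i, w (I i) < p
    · rw [hα I hI]; simp
    · have : q.eval ((2 : ℝ) ^ (∑ i, w (I i))) = 0 := by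
        rw [Polynomial.eval_prod]
        refine Finset.prod_eq_zero (i := ∑ i, w (I i)) (Finset.mem_Icc.mpr ⟨not_lt.mp hI, ?_⟩) (by simp)
        exact Finset.single_le_sum (f := fun I : Fin k → ι => ∑ i, w (I i))
          (fun _ _ => Nat.zero_le _) (Finset.mem_univ I)
      rw [this]; simp
  have h1 := congrArg (fun β => β (fun i => b (J i))) (aeval_commute f hf q α)
  simp only [hq, map_zero, AlternatingMap.zero_apply, aeval_altDilation_apply_basis] at h1
  refine (mul_eq_zero.mp h1.symm).resolve_left ?_
  rw [Polynomial.eval_prod]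
  refine Finset.prod_ne_zero_iff.mpr fun j hj => ?_
  have hj' : ∑ i, w (J i) < j := hJ.trans_le (Finset.mem_Icc.mp hj).1
  simp only [Polynomial.eval_sub, Polynomial.eval_X, Polynomial.eval_C, ne_eq, sub_eq_zero]
  exact (pow_lt_pow_right₀ one_lt_two hj').ne

/-- A form which has weight at least `p + 1` and is pure of weight `p` vanishes. -/
theorem eq_zero_of_altDilation_of_mem {k p : ℕ} {α : V [⋀^Fin k]→ₗ[ℝ] ℝ}
    (h : altDilation b w k α = (2 : ℝ) ^ p • α) (hα : α ∈ weightGE b w k (p + 1)) : α = 0 := by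
  refine altForm_ext_basis b.toBasis fun I => ?_
  rw [OrthonormalBasis.coe_toBasis]
  by_cases hI : ∑ i, w (I i) < p + 1
  · rw [hα I hI]; simp
  · have h1 := congrArg (fun β => β (fun i => b (I i))) h
    simp only [altDilation_apply_basis, AlternatingMap.smul_apply, smul_eq_mul] at h1
    have h2 : ((2 : ℝ) ^ (∑ i, w (I i)) - 2 ^ p) * α (fun i => b (I i)) = 0 := by
      rw [sub_mul, h1, sub_self]
    refine (mul_eq_zero.mp h2).resolve_left (sub_ne_zero.mpr ?_)
    exact (pow_lt_pow_right₀ one_lt_two (by omega)).ne'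

/-- A pure form of weight `p` has weight at least `p`. -/
theorem mem_weightGE_of_altDilation {k p : ℕ} {α : V [⋀^Fin k]→ₗ[ℝ] ℝ}
    (h : altDilation b w k α = (2 : ℝ) ^ p • α) : α ∈ weightGE b w k p := by
  intro I hI
  have h1 := congrArg (fun β => β (fun i => b (I i))) h
  simp only [altDilation_apply_basis, AlternatingMap.smul_apply, smul_eq_mul] at h1
  have h2 : ((2 : ℝ) ^ (∑ i, w (I i)) - 2 ^ p) * α (fun i => b (I i)) = 0 := by
    rw [sub_mul, h1, sub_self]
  refine (mul_eq_zero.mp h2).resolve_left (sub_ne_zero.mpr ?_)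
  exact (pow_lt_pow_right₀ one_lt_two hI).ne

/-- Linear maps vanishing on the pure forms vanish. -/
theorem eq_zero_of_pure {k : ℕ} {E : Type*} [AddCommGroup E] [Module ℝ E]
    (f : (V [⋀^Fin k]→ₗ[ℝ] ℝ) →ₗ[ℝ] E)
    (h : ∀ p α, altDilation b w k α = (2 : ℝ) ^ p • α → f α = 0) : f = 0 := by
  -- A symmetric operator is diagonalisable, so the pure forms span.
  have htop : ⨆ μ, Module.End.eigenspace (altDilation b w k) μ = ⊤ := by
    have h1 := (altDilation_isSymmetric b w k).orthogonalComplement_iSup_eigenspaces_eq_bot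
    rwa [Submodule.orthogonal_eq_bot_iff] at h1
  have : (⊤ : Submodule ℝ (V [⋀^Fin k]→ₗ[ℝ] ℝ)) ≤ LinearMap.ker f := by
    rw [← htop]
    refine iSup_le fun μ α hα => ?_
    rw [Module.End.mem_eigenspace_iff] at hα
    by_cases h0 : α = 0
    · simp [h0]
    · have : ∃ I : Fin k → ι, α (fun i => b (I i)) ≠ 0 := by
        by_contra hc
        push Not at hc
        exact h0 (altForm_ext_basis b.toBasis fun I => by simpa using hc I)
      obtain ⟨I, hI⟩ := this
      have h1 := congrArg (fun β => β (fun i => b (I i))) hα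
      simp only [altDilation_apply_basis, AlternatingMap.smul_apply, smul_eq_mul] at h1
      rw [← mul_right_cancel₀ hI h1] at hα
      exact h _ α hα
  exact LinearMap.ker_eq_top.mp (top_le_iff.mp this)

/-- A graded bracket makes the Chevalley-Eilenberg differential homogeneous. -/
theorem ceDifferential_altDilation {B : V →ₗ[ℝ] V →ₗ[ℝ] V}
    (hB : ∀ i j, dilation b w (B (b i) (b j)) = (2 : ℝ) ^ (w i + w j) • B (b i) (b j)) (k : ℕ)
    (α : V [⋀^Fin k]→ₗ[ℝ] ℝ) : ceDifferential B k (altDilation b w k α) =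
      altDilation b w (k + 1) (ceDifferential B k α) := by
  refine ceDifferential_compLinearMap _ (fun u v => ?_) k α
  have : B.compr₂ (dilation b w) = B.compl₁₂ (dilation b w) (dilation b w) := by
    refine b.toBasis.ext fun i => b.toBasis.ext fun j => ?_
    simp only [OrthonormalBasis.coe_toBasis, LinearMap.compr₂_apply, hB, LinearMap.compl₁₂_apply,
      dilation_apply, map_smul, LinearMap.smul_apply, smul_smul, pow_add]
    rw [mul_comm]
  exact LinearMap.congr_fun (LinearMap.congr_fun this u) v

theorem adjoint_commute {V W : Type*} [NormedAddCommGroup V] [InnerProductSpace ℝ V]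
    [FiniteDimensional ℝ V] [NormedAddCommGroup W] [InnerProductSpace ℝ W] [FiniteDimensional ℝ W]
    {D : V →ₗ[ℝ] W} {R : V →ₗ[ℝ] V} {S : W →ₗ[ℝ] W} (hR : R.IsSymmetric) (hS : S.IsSymmetric)
    (hc : ∀ v, D (R v) = S (D v)) (x : W) :
    LinearMap.adjoint D (S x) = R (LinearMap.adjoint D x) := by
  refine ext_inner_right ℝ fun v => ?_
  rw [LinearMap.adjoint_inner_left, hS, ← hc, hR, LinearMap.adjoint_inner_left]

end Weights

/-! ### Real inverses of `|z - T|²` below the spectral gap -/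

section GapInverse

/-- The real quadratic polynomial `(t - z) (t - z̄)` evaluated at `T`. -/
def normSqPoly {A : Type*} [Ring A] [Algebra ℝ A] (T : A) (z : ℂ) : A :=
  (algebraMap ℝ A z.re - T) ^ 2 + algebraMap ℝ A (z.im ^ 2)

/-- `G` is inverse to `|z - T|²` on the image of the idempotent `pr`, and zero on its kernel. -/
structure IsGapInverse {A : Type*} [Ring A] [Algebra ℝ A] (T pr : A) (z : ℂ) (G : A) : Prop where
  left : G * normSqPoly T z = pr
  right : normSqPoly T z * G = pr
  proj_mul : pr * G = G
  mul_proj : G * pr = G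

/-- The inverse of `|z - T|²` on the image of the idempotent `pr`. -/
def gapInverse {A : Type*} [Ring A] [Algebra ℝ A] (T pr : A) (z : ℂ) : A :=
  Ring.inverse (normSqPoly T z * pr + (1 - pr)) * pr

section Algebra
variable {A A' : Type*} [Ring A] [Algebra ℝ A] [Ring A'] [Algebra ℝ A'] {T pr G G' : A} {z : ℂ}

theorem map_normSqPoly (f : A →ₐ[ℝ] A') (T : A) (z : ℂ) :
    f (normSqPoly T z) = normSqPoly (f T) z := by
  simp [normSqPoly]

theorem commute_normSqPoly {c : A} (h : Commute c T) (z : ℂ) : Commute c (normSqPoly T z) :=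
  have h1 : ∀ t : ℝ, Commute c (algebraMap ℝ A t) := fun t => (Algebra.commutes t c).symm
  ((h1 _).sub_right h).pow_right 2 |>.add_right (h1 _)

namespace IsGapInverse

/-- Insert `pr = G|z - T|²` and `pr = |z - T|²G` on the two sides of `c`. Applied to dilations, this
shows that the gap inverse preserves weights. -/
theorem commute (h : IsGapInverse T pr z G) {c : A} (hT : Commute c T) (hpr : Commute c pr) :
    Commute c G := by
  have h1 := (commute_normSqPoly hT z).eq
  calc c * G = c * pr * G := by rw [mul_assoc, h.proj_mul]
    _ = pr * c * G := by rw [hpr.eq]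
    _ = G * (normSqPoly T z * c) * G := by rw [← h.left]; simp only [mul_assoc]
    _ = G * c * (normSqPoly T z * G) := by rw [← h1]; simp only [mul_assoc]
    _ = G * (c * pr) := by rw [h.right, mul_assoc]
    _ = G * c := by rw [hpr.eq, ← mul_assoc, h.mul_proj]

theorem map (h : IsGapInverse T pr z G) (f : A →ₐ[ℝ] A') : IsGapInverse (f T) (f pr) z (f G) := by
  constructor
  · rw [← map_normSqPoly, ← map_mul, h.left]
  · rw [← map_normSqPoly, ← map_mul, h.right]
  · rw [← map_mul, h.proj_mul]
  · rw [← map_mul, h.mul_proj]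

end IsGapInverse

/-- Adding `1 - pr` makes the operator the identity on `ker pr` without disturbing the block on `Im
pr`. One may then invert in the whole ring, where inversion is smooth, and cut back by `pr`. -/
theorem isGapInverse_gapInverse (hpr : pr * pr = pr) (hT : Commute T pr)
    (hu : IsUnit (normSqPoly T z * pr + (1 - pr))) : IsGapInverse T pr z (gapInverse T pr z) := by
  have hq : Commute pr (normSqPoly T z) := commute_normSqPoly hT.symm z
  have hU : ∀ c : A, Commute c T → Commute c pr →
      Commute c (Ring.inverse (normSqPoly T z * pr + (1 - pr))) := by
    intro c h1 h2
    have h3 : Commute c (normSqPoly T z * pr + (1 - pr)) :=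
      ((commute_normSqPoly h1 z).mul_right h2).add_right ((Commute.one_right c).sub_right h2)
    calc c * Ring.inverse (normSqPoly T z * pr + (1 - pr))
        = Ring.inverse (normSqPoly T z * pr + (1 - pr)) * (normSqPoly T z * pr + (1 - pr)) * c *
            Ring.inverse (normSqPoly T z * pr + (1 - pr)) := by
          rw [Ring.inverse_mul_cancel _ hu, one_mul]
      _ = Ring.inverse (normSqPoly T z * pr + (1 - pr)) * c * ((normSqPoly T z * pr + (1 - pr)) *
            Ring.inverse (normSqPoly T z * pr + (1 - pr))) := by
          rw [mul_assoc _ _ c, ← h3.eq]; simp only [mul_assoc]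
      _ = _ := by rw [Ring.mul_inverse_cancel _ hu, mul_one]
  have hUpr : (normSqPoly T z * pr + (1 - pr)) * pr = normSqPoly T z * pr := by
    rw [add_mul, mul_assoc, hpr, sub_mul, one_mul, hpr, sub_self, add_zero]
  have hl : gapInverse T pr z * normSqPoly T z = pr := by
    have h1 : gapInverse T pr z * normSqPoly T z = Ring.inverse (normSqPoly T z * pr + (1 - pr)) *
        ((normSqPoly T z * pr + (1 - pr)) * pr) := by
      rw [gapInverse, mul_assoc, hq.eq, hUpr]
    rw [h1, ← mul_assoc, Ring.inverse_mul_cancel _ hu, one_mul]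
  refine ⟨hl, ?_, ?_, ?_⟩
  · have h1 : Commute (normSqPoly T z) (gapInverse T pr z) :=
      (hU _ (commute_normSqPoly (Commute.refl T) z).symm hq.symm).mul_right hq.symm
    rw [h1.eq, hl]
  · rw [gapInverse, ← mul_assoc, (hU pr hT.symm (Commute.refl pr)).eq, mul_assoc, hpr]
  · rw [gapInverse, mul_assoc, hpr]

end Algebra

variable {V W : Type*} [NormedAddCommGroup V] [InnerProductSpace ℝ V] [FiniteDimensional ℝ V]
  [NormedAddCommGroup W] [InnerProductSpace ℝ W] [FiniteDimensional ℝ W]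
  {D : V →ₗ[ℝ] W} {X : W →ₗ[ℝ] V}

theorem normSqPoly_apply (T : Module.End ℝ V) (z : ℂ) (v : V) : normSqPoly T z v =
    z.re • (z.re • v - T v) - T (z.re • v - T v) + z.im ^ 2 • v := by
  simp [normSqPoly, pow_two, Module.algebraMap_end_apply, smul_smul]

theorem IsPenroseInverse.proj_mul_self (h : IsPenroseInverse D X) :
    (X ∘ₗ D : Module.End ℝ V) * (X ∘ₗ D) = X ∘ₗ D := by
  ext v; exact h.xdx (D v)

theorem IsPenroseInverse.commute_proj (h : IsPenroseInverse D X) :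
    Commute (LinearMap.adjoint D ∘ₗ D : Module.End ℝ V) (X ∘ₗ D) := by
  ext v
  change LinearMap.adjoint D (D (X (D v))) = X (D (LinearMap.adjoint D (D v)))
  rw [h.dxd, h.xd_adjoint]

/-- Below the spectral gap, `|z - DᵗD|²` is invertible on `(ker D)ᗮ`. -/
theorem IsPenroseInverse.isGapInverse (h : IsPenroseInverse D X) {r : ℝ}
    (hr : ∀ l : ℝ, l ≠ 0 → ∀ v, v ≠ 0 → LinearMap.adjoint D (D v) = l • v → r ≤ |l|) {z : ℂ}
    (hz : ‖z‖ < r) :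
    IsUnit (normSqPoly (LinearMap.adjoint D ∘ₗ D : Module.End ℝ V) z * (X ∘ₗ D) + (1 - X ∘ₗ D)) := by
  rw [LinearMap.isUnit_iff_ker_eq_bot, LinearMap.ker_eq_bot']
  intro v hv
  set T : Module.End ℝ V := LinearMap.adjoint D ∘ₗ D with hT
  set pr : Module.End ℝ V := X ∘ₗ D with hpr
  have hprpr : pr * pr = pr := h.proj_mul_self
  have hcomm : Commute pr (normSqPoly T z) := commute_normSqPoly h.commute_proj.symm z
  have h1 : normSqPoly T z (pr v) = 0 := by
    have h2 : pr * (normSqPoly T z * pr + (1 - pr)) = normSqPoly T z * pr := by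
      rw [mul_add, ← mul_assoc, hcomm.eq, mul_assoc, hprpr, mul_sub, hprpr, mul_one, sub_self, add_zero]
    have h3 := LinearMap.congr_fun h2 v
    rw [Module.End.mul_apply, hv, map_zero] at h3
    exact h3.symm
  have hsym : ∀ x y, inner ℝ (T x) y = inner ℝ x (T y) := fun x y => by
    simp only [hT, LinearMap.comp_apply]
    rw [LinearMap.adjoint_inner_left, LinearMap.adjoint_inner_right]
  have hu : pr v = 0 := by
    by_contra hu
    set u := pr v with hu'
    have hpru : pr u = u := LinearMap.congr_fun hprpr v
    -- Pairing `|z - T|² u = 0` with `u` makes `u` an eigenvector for the eigenvalue `Re z`, whose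
    -- absolute value is at most `|z| < r`. This contradicts the gap unless `Re z = 0`.
    have h2 : ‖z.re • u - T u‖ ^ 2 + z.im ^ 2 * ‖u‖ ^ 2 = 0 := by
      have h3 : inner ℝ (normSqPoly T z u) u = 0 := by rw [h1, inner_zero_left]
      rw [normSqPoly_apply, inner_add_left, inner_sub_left, hsym, real_inner_smul_left,
        real_inner_smul_left, real_inner_self_eq_norm_sq] at h3
      rw [← h3, ← real_inner_self_eq_norm_sq (z.re • u - T u), inner_sub_right, real_inner_smul_right]
    have h4 : T u = z.re • u := by
      have : ‖z.re • u - T u‖ ^ 2 = 0 := by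
        nlinarith [sq_nonneg ‖z.re • u - T u‖, mul_nonneg (sq_nonneg z.im) (sq_nonneg ‖u‖)]
      exact (sub_eq_zero.mp (norm_eq_zero.mp (pow_eq_zero_iff two_ne_zero |>.mp this))).symm
    -- The eigenvalue zero is excluded because `u = X (D u)`, while `DᵗDu = 0` forces `Du = 0`.
    have h5 : z.re ≠ 0 := by
      intro h0
      rw [h0, zero_smul] at h4
      apply hu
      have h6 : D u = 0 := by
        have : inner ℝ (D u) (D u) = 0 := by
          rw [← LinearMap.adjoint_inner_left]
          change inner ℝ (T u) u = 0
          rw [h4, inner_zero_left]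
        exact inner_self_eq_zero.mp this
      rw [← hpru]
      change X (D u) = 0
      rw [h6, map_zero]
    exact absurd ((hr _ h5 u hu h4).trans (Complex.abs_re_le_norm z)) (not_le.mpr hz)
  have h2 : (normSqPoly T z * pr + (1 - pr)) v = normSqPoly T z (pr v) + (v - pr v) := rfl
  rw [h2, hu, map_zero, zero_add, sub_zero] at hv
  exact hv

end GapInverse

/-! ### Smooth families of linear maps; smoothness of the partial inverse -/

section Smooth

variable {V W : Type*} [NormedAddCommGroup V] [InnerProductSpace ℝ V] [FiniteDimensional ℝ V]
  [NormedAddCommGroup W] [InnerProductSpace ℝ W] [FiniteDimensional ℝ W]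
  {P : Type*} [NormedAddCommGroup P] [NormedSpace ℝ P]

/-- Smoothness at `p` of a family of linear maps between finite-dimensional spaces. -/
def SmoothLinearAt (D : P → V →ₗ[ℝ] W) (p : P) : Prop :=
  ContDiffAt ℝ ∞ (fun q => LinearMap.toContinuousLinearMap (D q)) p

theorem SmoothLinearAt.comp {Z : Type*} [NormedAddCommGroup Z] [InnerProductSpace ℝ Z]
    [FiniteDimensional ℝ Z] {D : P → V →ₗ[ℝ] W} {D' : P → W →ₗ[ℝ] Z} {p : P}
    (hD' : SmoothLinearAt D' p) (hD : SmoothLinearAt D p) :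
    SmoothLinearAt (fun q => D' q ∘ₗ D q) p :=
  ContDiffAt.clm_comp hD' hD

theorem SmoothLinearAt.congr {D D' : P → V →ₗ[ℝ] W} {p : P} (hD : SmoothLinearAt D p)
    (h : ∀ᶠ q in nhds p, D' q = D q) : SmoothLinearAt D' p :=
  ContDiffAt.congr_of_eventuallyEq hD (h.mono fun q hq => by simp only [hq])

theorem SmoothLinearAt.adjoint {D : P → V →ₗ[ℝ] W} {p : P} (hD : SmoothLinearAt D p) :
    SmoothLinearAt (fun q => LinearMap.adjoint (D q)) p := by
  let a : (V →L[ℝ] W) →ₗ[ℝ] (W →L[ℝ] V) :=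
    { toFun := fun A => LinearMap.toContinuousLinearMap (LinearMap.adjoint A.toLinearMap)
      map_add' := fun A B => by simp
      map_smul' := fun c A => by simp }
  have h := (LinearMap.toContinuousLinearMap a).contDiff.contDiffAt.comp (n := ∞) p hD
  refine h.congr_of_eventuallyEq (Filter.Eventually.of_forall fun q => ?_)
  simp only [Function.comp_apply, LinearMap.coe_toContinuousLinearMap']
  rfl

theorem SmoothLinearAt.apply {D : P → V →ₗ[ℝ] W} {v : P → V} {p : P} (hD : SmoothLinearAt D p)
    (hv : ContDiffAt ℝ ∞ v p) : ContDiffAt ℝ ∞ (fun q => D q (v q)) p :=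
  ContDiffAt.clm_apply hD hv

theorem smoothLinearAt_const (D : V →ₗ[ℝ] W) (p : P) : SmoothLinearAt (fun _ => D) p :=
  contDiffAt_const

theorem SmoothLinearAt.ringInverse {D : P → Module.End ℝ V} {p : P} (hD : SmoothLinearAt D p)
    (hu : IsUnit (D p)) : SmoothLinearAt (fun q => (Ring.inverse (D q) : Module.End ℝ V)) p := by
  let e : Module.End ℝ V ≃ₐ[ℝ] (V →L[ℝ] V) := Module.End.toContinuousLinearMap V
  have h1 : ∀ A : Module.End ℝ V, e (Ring.inverse A) = Ring.inverse (e A) := by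
    intro A
    by_cases hA : IsUnit A
    · obtain ⟨a, rfl⟩ := hA
      rw [Ring.inverse_unit]
      exact (Ring.inverse_unit (Units.map (e : Module.End ℝ V →* (V →L[ℝ] V)) a)).symm
    · rw [Ring.inverse_non_unit _ hA, map_zero, Ring.inverse_non_unit]
      intro h
      exact hA ((MulEquiv.isUnit_map e).mp h)
  have h2 : IsUnit (e (D p)) := hu.map e
  obtain ⟨u, hu⟩ := h2
  have h3 := contDiffAt_ringInverse ℝ (n := ∞) u
  rw [hu] at h3
  have h4 : ContDiffAt ℝ ∞ (fun q => Ring.inverse (e (D q))) p :=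
    ContDiffAt.comp (g := Ring.inverse) (f := fun q => e (D q)) p h3 hD
  have h5 : (fun q => Ring.inverse (e (D q))) = fun q => e (Ring.inverse (D q)) :=
    funext fun q => (h1 _).symm
  rw [h5] at h4
  exact h4

theorem SmoothLinearAt.eventually_isUnit {D : P → Module.End ℝ V} {p : P} (hD : SmoothLinearAt D p)
    (hu : IsUnit (D p)) : ∀ᶠ q in nhds p, IsUnit (D q) := by
  let e : Module.End ℝ V ≃ₐ[ℝ] (V →L[ℝ] V) := Module.End.toContinuousLinearMap V
  have h2 : IsUnit (e (D p)) := hu.map e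
  have h3 : ContinuousAt (fun q => e (D q)) p := hD.continuousAt
  filter_upwards [h3.preimage_mem_nhds (Units.isOpen.mem_nhds h2)] with q hq
  exact (MulEquiv.isUnit_map e).mp hq

theorem SmoothLinearAt.add {D D' : P → V →ₗ[ℝ] W} {p : P} (hD : SmoothLinearAt D p)
    (hD' : SmoothLinearAt D' p) : SmoothLinearAt (fun q => D q + D' q) p :=
  (ContDiffAt.add hD hD').congr_of_eventuallyEq (Filter.Eventually.of_forall fun q => by simp)

theorem SmoothLinearAt.sub {D D' : P → V →ₗ[ℝ] W} {p : P} (hD : SmoothLinearAt D p)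
    (hD' : SmoothLinearAt D' p) : SmoothLinearAt (fun q => D q - D' q) p :=
  (ContDiffAt.sub hD hD').congr_of_eventuallyEq (Filter.Eventually.of_forall fun q => by simp)

theorem SmoothLinearAt.smul {D : P → V →ₗ[ℝ] W} {c : P → ℝ} {p : P} (hc : ContDiffAt ℝ ∞ c p)
    (hD : SmoothLinearAt D p) : SmoothLinearAt (fun q => c q • D q) p :=
  (ContDiffAt.smul hc hD).congr_of_eventuallyEq (Filter.Eventually.of_forall fun q => by simp)

/-- The partial inverse of a smooth family of linear maps of constant rank is smooth. -/
theorem SmoothLinearAt.penroseInverse {D : P → V →ₗ[ℝ] W} {X : P → W →ₗ[ℝ] V} {p : P}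
    (hD : SmoothLinearAt D p) (hX : ∀ᶠ q in nhds p, IsPenroseInverse (D q) (X q))
    (hr : ∀ᶠ q in nhds p, finrank ℝ (LinearMap.range (D q)) = finrank ℝ (LinearMap.range (D p))) :
    SmoothLinearAt X p := by
  -- The range at the base point serves as a fixed parameter space: for `q` near `p`, the
  -- restriction of `D_qᵗ` to `R` is still injective, and constancy of the rank makes its image all
  -- of `Im D_qᵗ`.
  let R := LinearMap.range (D p)
  let B : P → R →ₗ[ℝ] V := fun q => LinearMap.adjoint (D q) ∘ₗ R.subtype
  have hB : SmoothLinearAt B p := hD.adjoint.comp (smoothLinearAt_const R.subtype p)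
  let C : P → Module.End ℝ R := fun q => LinearMap.adjoint (B q) ∘ₗ B q
  have hC : SmoothLinearAt C p := hB.adjoint.comp hB
  have hBinj : ∀ v, B p v = 0 → v = 0 := by
    rintro ⟨_, u, rfl⟩ hv
    have h1 : LinearMap.adjoint (D p) (D p u) = 0 := hv
    have h2 : inner ℝ (D p u) (D p u) = 0 := by
      rw [← LinearMap.adjoint_inner_left, h1, inner_zero_left]
    exact Subtype.ext (inner_self_eq_zero.mp h2)
  have hCu : IsUnit (C p) := by
    rw [LinearMap.isUnit_iff_ker_eq_bot, LinearMap.ker_eq_bot']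
    intro v hv
    apply hBinj
    have h2 : inner ℝ (B p v) (B p v) = 0 := by
      rw [← LinearMap.adjoint_inner_left]
      change inner ℝ (C p v) v = 0
      rw [hv, inner_zero_left]
    exact inner_self_eq_zero.mp h2
  -- The usual formula `B(BᵗB)⁻¹Bᵗ` for the orthogonal projection onto the image of `B`; that image
  -- is `(ker D_q)ᗮ`, so this is `XD`.
  let Q : P → Module.End ℝ V := fun q => B q ∘ₗ (Ring.inverse (C q) ∘ₗ LinearMap.adjoint (B q))
  have hQ : SmoothLinearAt Q p := hB.comp ((hC.ringInverse hCu).comp hB.adjoint)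
  have hQpr : ∀ᶠ q in nhds p, Q q = X q ∘ₗ D q := by
    filter_upwards [hC.eventually_isUnit hCu, hX, hr] with q hu hXq hrq
    have hBinj' : Function.Injective (B q) := by
      rw [injective_iff_map_eq_zero]
      intro v hv
      have h1 : C q v = 0 := by
        change LinearMap.adjoint (B q) (B q v) = 0
        rw [hv, map_zero]
      rw [LinearMap.isUnit_iff_ker_eq_bot, LinearMap.ker_eq_bot'] at hu
      exact hu v h1
    have hrange : LinearMap.range (B q) = LinearMap.range (LinearMap.adjoint (D q)) := by
      refine Submodule.eq_of_le_of_finrank_eq (LinearMap.range_comp_le_range _ _) ?_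
      rw [LinearMap.finrank_range_of_inj hBinj', LinearMap.finrank_range_adjoint, hrq]
    have hQB : ∀ v, Q q (B q v) = B q v := by
      intro v
      change B q ((Ring.inverse (C q) * C q) v) = B q v
      rw [Ring.inverse_mul_cancel _ hu]; rfl
    have hQD : ∀ w, Q q (LinearMap.adjoint (D q) w) = LinearMap.adjoint (D q) w := by
      intro w
      have : LinearMap.adjoint (D q) w ∈ LinearMap.range (B q) := hrange ▸ ⟨w, rfl⟩
      obtain ⟨v, hv⟩ := this
      rw [← hv, hQB]
    have hQX : ∀ w, Q q (X q w) = X q w := by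
      intro w
      rw [hXq.eq_adjoint_adjoint, hQD]
    -- the difference vanishes on the range of `D q` and on its orthogonal
    have hker : ∀ v, D q v = 0 → Q q v = 0 := by
      intro v hv
      have : LinearMap.adjoint (B q) v = 0 := by
        refine ext_inner_right ℝ fun u => ?_
        rw [LinearMap.adjoint_inner_left]
        change inner ℝ v (LinearMap.adjoint (D q) (u : W)) = _
        rw [LinearMap.adjoint_inner_right, hv, inner_zero_left, inner_zero_left]
      change B q (Ring.inverse (C q) (LinearMap.adjoint (B q) v)) = 0
      rw [this, map_zero, map_zero]
    ext v
    have h1 : Q q (v - X q (D q v)) = 0 := hker _ (by rw [map_sub, hXq.dxd, sub_self])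
    rw [map_sub, hQX, sub_eq_zero] at h1
    exact h1
  -- `DᵗD + (1 - XD)` is invertible and sends `X` to `DᵗDX = Dᵗ`, so `X = U⁻¹Dᵗ` is smooth.
  let U : P → Module.End ℝ V := fun q => LinearMap.adjoint (D q) ∘ₗ D q + (LinearMap.id - Q q)
  have hU : SmoothLinearAt U p :=
    (hD.adjoint.comp hD).add ((smoothLinearAt_const LinearMap.id p).sub hQ)
  have hUu : IsUnit (U p) := by
    rw [LinearMap.isUnit_iff_ker_eq_bot, LinearMap.ker_eq_bot']
    intro v hv
    have hXp := hX.self_of_nhds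
    have h1 : U p v = LinearMap.adjoint (D p) (D p v) + (v - X p (D p v)) := by
      change LinearMap.adjoint (D p) (D p v) + (v - Q p v) = _
      rw [hQpr.self_of_nhds]; rfl
    have h2 : D p (U p v) = D p (LinearMap.adjoint (D p) (D p v)) := by
      rw [h1, map_add, map_sub, hXp.dxd, sub_self, add_zero]
    rw [hv, map_zero] at h2
    have h3 : LinearMap.adjoint (D p) (D p v) = 0 := by
      rw [← hXp.xd_adjoint, ← h2, map_zero]
    have h4 : D p v = 0 := by
      have : inner ℝ (D p v) (D p v) = 0 := by
        rw [← LinearMap.adjoint_inner_left, h3, inner_zero_left]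
      exact inner_self_eq_zero.mp this
    rw [h1, h4, map_zero, map_zero, sub_zero, zero_add] at hv
    exact hv
  refine ((hU.ringInverse hUu).comp hD.adjoint).congr ?_
  filter_upwards [hU.eventually_isUnit hUu, hX, hQpr] with q hu hXq hq
  have h1 : U q ∘ₗ X q = LinearMap.adjoint (D q) := by
    ext w
    change LinearMap.adjoint (D q) (D q (X q w)) + (X q w - Q q (X q w)) = _
    rw [hq, LinearMap.comp_apply, hXq.xdx, sub_self, add_zero, hXq.adjoint_apply_dx]
  rw [← h1, ← LinearMap.comp_assoc]
  have h2 : Ring.inverse (U q) ∘ₗ U q = LinearMap.id := Ring.inverse_mul_cancel _ hu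
  rw [h2, LinearMap.id_comp]

theorem SmoothLinearAt.gapInverse {T pr : P → Module.End ℝ V} {z : P → ℂ} {p : P}
    (hT : SmoothLinearAt T p) (hpr : SmoothLinearAt pr p) (hz : ContDiffAt ℝ ∞ z p)
    (hu : IsUnit (normSqPoly (T p) (z p) * pr p + (1 - pr p))) :
    SmoothLinearAt (fun q => gapInverse (T q) (pr q) (z q)) p := by
  have hre : ContDiffAt ℝ ∞ (fun q => (z q).re) p := Complex.reCLM.contDiff.contDiffAt.comp p hz
  have him : ContDiffAt ℝ ∞ (fun q => (z q).im) p := Complex.imCLM.contDiff.contDiffAt.comp p hz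
  have h1 := smoothLinearAt_const (LinearMap.id : V →ₗ[ℝ] V) p
  have h2 : SmoothLinearAt (fun q => (z q).re • LinearMap.id - T q) p := (h1.smul hre).sub hT
  have h3 : SmoothLinearAt (fun q => normSqPoly (T q) (z q)) p := by
    refine ((h2.comp h2).add (h1.smul (him.pow 2))).congr (Filter.Eventually.of_forall fun q => ?_)
    simp only [normSqPoly, pow_two, Algebra.algebraMap_eq_smul_one]
    rfl
  exact (SmoothLinearAt.ringInverse ((h3.comp hpr).add (h1.sub hpr)) hu).comp hpr

end Smooth

/-! ### Smoothness of forms through components -/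

section AltCalculus

variable {P F G : Type*} [NormedAddCommGroup P] [NormedSpace ℝ P] [NormedAddCommGroup F]
  [NormedSpace ℝ F] [NormedAddCommGroup G] [NormedSpace ℝ G] [FiniteDimensional ℝ F]
  [FiniteDimensional ℝ G]

theorem contDiffAt_of_injective_comp {L : F →ₗ[ℝ] G} (hL : Function.Injective L) {f : P → F} {p : P}
    (h : ContDiffAt ℝ ∞ (fun q => L (f q)) p) : ContDiffAt ℝ ∞ f p := by
  obtain ⟨g, hg⟩ := L.exists_leftInverse_of_injective (LinearMap.ker_eq_bot.mpr hL)
  have h1 := (LinearMap.toContinuousLinearMap g).contDiff.contDiffAt.comp (n := ∞) p h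
  refine h1.congr_of_eventuallyEq (Filter.Eventually.of_forall fun q => ?_)
  exact (LinearMap.congr_fun hg (f q)).symm

/-- The Euclidean space on which the manifolds are modelled. -/
abbrev ModelSpace (n : ℕ) : Type := EuclideanSpace ℝ (Fin n)

variable {n k : ℕ}

instance continuousAltForm_finite :
    FiniteDimensional ℝ ((ModelSpace n) [⋀^Fin k]→L[ℝ] ℝ) :=
  Module.Finite.of_injective (ContinuousAlternatingMap.toAlternatingMapLinear (R := ℝ) (A := ℝ)
    (M := ModelSpace n) (N := ℝ) (ι := Fin k))
    ContinuousAlternatingMap.toAlternatingMap_injective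

/-- The standard basis of the model space. -/
abbrev stdBasis (n : ℕ) : OrthonormalBasis (Fin n) ℝ (ModelSpace n) :=
  EuclideanSpace.basisFun (Fin n) ℝ

theorem contDiffAt_altForm_iff {V : Type*} [NormedAddCommGroup V] [InnerProductSpace ℝ V]
    [FiniteDimensional ℝ V] {ι : Type*} [Fintype ι] (b : Basis ι ℝ V)
    {f : P → V [⋀^Fin k]→ₗ[ℝ] ℝ} {p : P} :
    ContDiffAt ℝ ∞ f p ↔ ∀ I : Fin k → ι, ContDiffAt ℝ ∞ (fun q => f q (fun i => b (I i))) p := by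
  let L : (V [⋀^Fin k]→ₗ[ℝ] ℝ) →ₗ[ℝ] ((Fin k → ι) → ℝ) :=
    { toFun := fun α I => α fun i => b (I i)
      map_add' := fun _ _ => rfl
      map_smul' := fun _ _ => rfl }
  constructor
  · intro h I
    exact (LinearMap.toContinuousLinearMap (LinearMap.proj I ∘ₗ L)).contDiff.contDiffAt.comp p h
  · intro h
    refine contDiffAt_of_injective_comp (L := L) (fun α β hαβ => ?_) (contDiffAt_pi.mpr h)
    exact altForm_ext_basis b fun I => congrFun hαβ I

theorem contDiffAt_continuousAltForm_iff {f : P → (ModelSpace n) [⋀^Fin k]→L[ℝ] ℝ} {p : P} :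
    ContDiffAt ℝ ∞ f p ↔
      ∀ I : Fin k → Fin n, ContDiffAt ℝ ∞ (fun q => f q (fun i => stdBasis n (I i))) p := by
  let L : ((ModelSpace n) [⋀^Fin k]→L[ℝ] ℝ) →ₗ[ℝ] ((Fin k → Fin n) → ℝ) :=
    { toFun := fun α I => α fun i => stdBasis n (I i)
      map_add' := fun _ _ => rfl
      map_smul' := fun _ _ => rfl }
  constructor
  · intro h I
    exact (LinearMap.toContinuousLinearMap (LinearMap.proj I ∘ₗ L)).contDiff.contDiffAt.comp p h
  · intro h
    refine contDiffAt_of_injective_comp (L := L) (fun α β hαβ => ?_) (contDiffAt_pi.mpr h)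
    refine ContinuousAlternatingMap.toAlternatingMap_injective
      (altForm_ext_basis (stdBasis n).toBasis fun I => ?_)
    rw [OrthonormalBasis.coe_toBasis]
    exact congrFun hαβ I

/-- Smoothness of a form evaluated on combinations of vectors with smooth coefficients. -/
theorem contDiffAt_apply_of_combination {W : P → Type*} [∀ q, AddCommGroup (W q)]
    [∀ q, Module ℝ (W q)] {ι : Type*} [Fintype ι] {f : ∀ q, (W q) [⋀^Fin k]→ₗ[ℝ] ℝ}
    {g : ∀ q, Fin k → W q} {e : ∀ q, ι → W q} {c : Fin k → ι → P → ℝ} {p : P}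
    (hf : ∀ I : Fin k → ι, ContDiffAt ℝ ∞ (fun q => f q fun i => e q (I i)) p)
    (hc : ∀ i j, ContDiffAt ℝ ∞ (c i j) p)
    (hg : ∀ᶠ q in nhds p, ∀ i, g q i = ∑ j, c i j q • e q j) :
    ContDiffAt ℝ ∞ (fun q => f q (g q)) p := by
  have h1 : ContDiffAt ℝ ∞ (fun q => ∑ r : Fin k → ι, (∏ i, c i (r i) q) *
      f q (fun i => e q (r i))) p :=
    ContDiffAt.sum fun r _ => (contDiffAt_prod fun i _ => hc i (r i)).mul (hf r)
  refine h1.congr_of_eventuallyEq ?_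
  filter_upwards [hg] with q hq
  rw [← alternatingMap_apply_sum_basis (f q) (fun i j => c i j q) (e q)]
  congr 1
  exact funext hq

theorem contDiffAt_continuousAltForm_apply {f : P → (ModelSpace n) [⋀^Fin k]→L[ℝ] ℝ}
    {g : Fin k → P → ModelSpace n} {p : P} (hf : ContDiffAt ℝ ∞ f p)
    (hg : ∀ i, ContDiffAt ℝ ∞ (g i) p) : ContDiffAt ℝ ∞ (fun q => f q fun i => g i q) p := by
  refine contDiffAt_apply_of_combination (W := fun _ => ModelSpace n)
    (f := fun q => (f q).toAlternatingMap) (g := fun q i => g i q) (e := fun _ j => stdBasis n j)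
    (c := fun i j q => g i q j) (contDiffAt_continuousAltForm_iff.mp hf) (fun i j => ?_)
    (Filter.Eventually.of_forall fun q i => ?_)
  · exact (EuclideanSpace.proj (𝕜 := ℝ) (ι := Fin n) j).contDiff.contDiffAt.comp p (hg i)
  · simpa using ((stdBasis n).sum_repr (g i q)).symm

/-- The linear map sending the standard basis to the vectors `e a`. -/
def frameMap {W : Type*} [AddCommGroup W] [Module ℝ W] (e : Fin n → W) : ModelSpace n →ₗ[ℝ] W :=
  (stdBasis n).toBasis.constr ℝ e

@[simp] theorem frameMap_basis {W : Type*} [AddCommGroup W] [Module ℝ W] (e : Fin n → W) (a : Fin n) :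
    frameMap e (stdBasis n a) = e a := by
  have := (stdBasis n).toBasis.constr_basis ℝ e a
  rwa [OrthonormalBasis.coe_toBasis] at this

theorem frameMap_apply {W : Type*} [AddCommGroup W] [Module ℝ W] (e : Fin n → W) (v : ModelSpace n) :
    frameMap e v = ∑ a, v a • e a := by
  conv_lhs => rw [← (stdBasis n).sum_repr v]
  simp only [map_sum, map_smul, frameMap_basis]
  rfl

/-- The coefficients of a fixed vector in a smooth frame are smooth. -/
theorem exists_smooth_coefficients {e : Fin n → P → ModelSpace n} {p : P}
    (he : ∀ a, ContDiffAt ℝ ∞ (e a) p) (hli : LinearIndependent ℝ fun a => e a p)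
    (v : ModelSpace n) : ∃ c : Fin n → P → ℝ, (∀ a, ContDiffAt ℝ ∞ (c a) p) ∧
      ∀ᶠ q in nhds p, v = ∑ a, c a q • e a q := by
  -- The coefficients are obtained by applying the inverse of the frame matrix to `v`; it is
  -- invertible near `p` because the frame is independent at `p`.
  let A : P → Module.End ℝ (ModelSpace n) := fun q => frameMap fun a => e a q
  have hA : SmoothLinearAt A p := by
    have h1 : ∀ a, SmoothLinearAt (fun q => ((EuclideanSpace.proj (𝕜 := ℝ) (ι := Fin n) a :
        ModelSpace n →L[ℝ] ℝ).smulRight (e a q)).toLinearMap) p := by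
      intro a
      have := (ContinuousLinearMap.smulRightL ℝ (ModelSpace n) (ModelSpace n)
        (EuclideanSpace.proj (𝕜 := ℝ) (ι := Fin n) a)).contDiff.contDiffAt.comp (n := ∞) p (he a)
      exact this
    have h2 : ContDiffAt ℝ ∞ (fun q => ∑ a, LinearMap.toContinuousLinearMap
        ((EuclideanSpace.proj (𝕜 := ℝ) (ι := Fin n) a :
        ModelSpace n →L[ℝ] ℝ).smulRight (e a q)).toLinearMap) p := ContDiffAt.sum fun a _ => h1 a
    refine h2.congr_of_eventuallyEq (Filter.Eventually.of_forall fun q => ?_)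
    ext1 u
    simp [A, frameMap_apply]
  have hu : IsUnit (A p) := by
    rw [LinearMap.isUnit_iff_ker_eq_bot, LinearMap.ker_eq_bot']
    intro u hu
    have h1 : ∑ a, u a • e a p = 0 := by rw [← frameMap_apply]; exact hu
    have h2 := Fintype.linearIndependent_iff.mp hli _ h1
    ext a
    exact h2 a
  refine ⟨fun a q => (Ring.inverse (A q) : Module.End ℝ (ModelSpace n)) v a, fun a => ?_, ?_⟩
  · exact (EuclideanSpace.proj (𝕜 := ℝ) (ι := Fin n) a).contDiff.contDiffAt.comp p
      ((hA.ringInverse hu).apply contDiffAt_const)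
  · filter_upwards [hA.eventually_isUnit hu] with q hq
    rw [← frameMap_apply]
    exact (LinearMap.congr_fun (Ring.mul_inverse_cancel _ hq) v).symm

end AltCalculus

/-! ### Vector fields and forms in charts -/

section Charts

variable {n : ℕ} {M : Type*} [TopologicalSpace M] [ChartedSpace (ModelSpace n) M]
  [IsManifold (𝓡 n) ∞ M]

theorem mdifferentiableAt_chart_symm (x₀ : M) {u : ModelSpace n}
    (hu : u ∈ (extChartAt (𝓡 n) x₀).target) :
    MDifferentiableAt 𝓘(ℝ, ModelSpace n) (𝓡 n) (extChartAt (𝓡 n) x₀).symm u :=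
  ((contMDiffOn_extChartAt_symm (n := ∞) x₀).contMDiffAt
    ((isOpen_extChartAt_target x₀).mem_nhds hu)).mdifferentiableAt (by simp)

theorem mdifferentiableAt_chart (x₀ : M) {x : M} (hx : x ∈ (extChartAt (𝓡 n) x₀).source) :
    MDifferentiableAt (𝓡 n) 𝓘(ℝ, ModelSpace n) (extChartAt (𝓡 n) x₀) x :=
  mdifferentiableAt_extChartAt (by rwa [extChartAt_source] at hx)

theorem mfderiv_chart_comp_symm (x₀ : M) {u : ModelSpace n}
    (hu : u ∈ (extChartAt (𝓡 n) x₀).target) :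
    (mfderiv (𝓡 n) 𝓘(ℝ, ModelSpace n) (extChartAt (𝓡 n) x₀) ((extChartAt (𝓡 n) x₀).symm u)).comp
      (mfderiv 𝓘(ℝ, ModelSpace n) (𝓡 n) (extChartAt (𝓡 n) x₀).symm u) =
      ContinuousLinearMap.id ℝ _ := by
  have := mfderiv_extChartAt_comp_mfderivWithin_extChartAt_symm (I := 𝓡 n) hu
  rwa [ModelWithCorners.range_eq_univ, mfderivWithin_univ] at this

theorem mfderiv_symm_comp_chart (x₀ : M) {u : ModelSpace n}
    (hu : u ∈ (extChartAt (𝓡 n) x₀).target) :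
    (mfderiv 𝓘(ℝ, ModelSpace n) (𝓡 n) (extChartAt (𝓡 n) x₀).symm u).comp
    (mfderiv (𝓡 n) 𝓘(ℝ, ModelSpace n) (extChartAt (𝓡 n) x₀) ((extChartAt (𝓡 n) x₀).symm u)) =
      ContinuousLinearMap.id ℝ _ := by
  have := mfderivWithin_extChartAt_symm_comp_mfderiv_extChartAt (I := 𝓡 n) hu
  rwa [ModelWithCorners.range_eq_univ, mfderivWithin_univ] at this

/-- The representative of a vector field in the chart at `x₀`. -/
def chartField (x₀ : M) (X : ∀ y : M, TangentSpace (𝓡 n) y) (u : ModelSpace n) : ModelSpace n :=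
  mfderiv (𝓡 n) 𝓘(ℝ, ModelSpace n) (extChartAt (𝓡 n) x₀) ((extChartAt (𝓡 n) x₀).symm u)
    (X ((extChartAt (𝓡 n) x₀).symm u))

theorem mfderiv_symm_chartField (x₀ : M) (X : ∀ y : M, TangentSpace (𝓡 n) y) {u : ModelSpace n}
    (hu : u ∈ (extChartAt (𝓡 n) x₀).target) :
    mfderiv 𝓘(ℝ, ModelSpace n) (𝓡 n) (extChartAt (𝓡 n) x₀).symm u (chartField x₀ X u) =
      X ((extChartAt (𝓡 n) x₀).symm u) :=
  DFunLike.congr_fun (mfderiv_symm_comp_chart x₀ hu) _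

theorem chartField_eq_mpullback (x₀ : M) (X : ∀ y : M, TangentSpace (𝓡 n) y) {u : ModelSpace n}
    (hu : u ∈ (extChartAt (𝓡 n) x₀).target) : chartField x₀ X u =
      VectorField.mpullback 𝓘(ℝ, ModelSpace n) (𝓡 n) (extChartAt (𝓡 n) x₀).symm X u := by
  rw [VectorField.mpullback_apply, ContinuousLinearMap.inverse_eq (mfderiv_symm_comp_chart x₀ hu)
    (mfderiv_chart_comp_symm x₀ hu)]
  rfl

theorem contDiffAt_chartField (x₀ : M) {X : ∀ y : M, TangentSpace (𝓡 n) y} {u : ModelSpace n}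
    (hu : u ∈ (extChartAt (𝓡 n) x₀).target)
    (hX : ContMDiffAt (𝓡 n) (𝓡 n).tangent ∞ (fun y => (⟨y, X y⟩ : TangentBundle (𝓡 n) M))
      ((extChartAt (𝓡 n) x₀).symm u)) : ContDiffAt ℝ ∞ (chartField x₀ X) u := by
  have hopen := (isOpen_extChartAt_target (I := 𝓡 n) x₀).mem_nhds hu
  have h1 := ContMDiffAt.mpullback_vectorField_preimage (n := ∞) hX
    ((contMDiffOn_extChartAt_symm (n := ∞) x₀).contMDiffAt hopen)
    (.of_inverse (mfderiv_symm_comp_chart x₀ hu) (mfderiv_chart_comp_symm x₀ hu)) (by simp)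
  have h2 := contMDiffAt_vectorSpace_iff_contDiffAt.mp h1
  refine h2.congr_of_eventuallyEq ?_
  filter_upwards [hopen] with y hy
  exact chartField_eq_mpullback x₀ X hy

theorem chartRep_apply (x₀ : M) (θ : FieldOfForms n M) (k : ℕ) (u : ModelSpace n)
    (v : Fin k → ModelSpace n) : chartRep x₀ θ k u v = θ ((extChartAt (𝓡 n) x₀).symm u) k
      (fun i => mfderiv 𝓘(ℝ, ModelSpace n) (𝓡 n) (extChartAt (𝓡 n) x₀).symm u (v i)) := rfl

theorem chartRep_chartField (x₀ : M) (θ : FieldOfForms n M) (k : ℕ) {u : ModelSpace n}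
    (hu : u ∈ (extChartAt (𝓡 n) x₀).target) (X : Fin k → ∀ y : M, TangentSpace (𝓡 n) y) :
    chartRep x₀ θ k u (fun i => chartField x₀ (X i) u) =
      θ ((extChartAt (𝓡 n) x₀).symm u) k (fun i => X i ((extChartAt (𝓡 n) x₀).symm u)) := by
  rw [chartRep_apply]
  congr 1
  funext i
  exact mfderiv_symm_chartField x₀ (X i) hu

/-- A family of forms is smooth in a chart at a point when its components in a smooth frame are. -/
theorem contDiffAt_chartRep_iff {P : Type*} [NormedAddCommGroup P] [NormedSpace ℝ P]
    (x₀ : M) {u : ModelSpace n} (hu : u ∈ (extChartAt (𝓡 n) x₀).target)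
    {e : Fin n → ∀ y : M, TangentSpace (𝓡 n) y}
    (he : ∀ a, ContMDiffAt (𝓡 n) (𝓡 n).tangent ∞ (fun y => (⟨y, e a y⟩ : TangentBundle (𝓡 n) M))
      ((extChartAt (𝓡 n) x₀).symm u))
    (hli : LinearIndependent ℝ fun a => e a ((extChartAt (𝓡 n) x₀).symm u))
    (θ : P → FieldOfForms n M) (k : ℕ) (p : P) :
    ContDiffAt ℝ ∞ (fun q : P × ModelSpace n => chartRep x₀ (θ q.1) k q.2) (p, u) ↔
      ∀ I : Fin k → Fin n, ContDiffAt ℝ ∞ (fun q : P × ModelSpace n =>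
        θ q.1 ((extChartAt (𝓡 n) x₀).symm q.2) k
          (fun i => e (I i) ((extChartAt (𝓡 n) x₀).symm q.2))) (p, u) := by
  have hopen := (isOpen_extChartAt_target (I := 𝓡 n) x₀).mem_nhds hu
  have hev : ∀ᶠ q in nhds (p, u), q.2 ∈ (extChartAt (𝓡 n) x₀).target :=
    continuousAt_snd.preimage_mem_nhds hopen
  have hê : ∀ a, ContDiffAt ℝ ∞ (fun q : P × ModelSpace n => chartField x₀ (e a) q.2) (p, u) :=
    fun a => (contDiffAt_chartField x₀ hu (he a)).comp (p, u) contDiffAt_snd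
  constructor
  · intro h I
    refine (contDiffAt_continuousAltForm_apply h (fun i => hê (I i))).congr_of_eventuallyEq ?_
    filter_upwards [hev] with q hq
    exact (chartRep_chartField x₀ (θ q.1) k hq fun i => e (I i)).symm
  · intro h
    have hli' : LinearIndependent ℝ fun a => chartField x₀ (e a) u := by
      refine LinearIndependent.map' hli (mfderiv (𝓡 n) 𝓘(ℝ, ModelSpace n) (extChartAt (𝓡 n) x₀)
        ((extChartAt (𝓡 n) x₀).symm u)).toLinearMap (LinearMap.ker_eq_bot.mpr ?_)
      exact Function.LeftInverse.injective
        (g := mfderiv 𝓘(ℝ, ModelSpace n) (𝓡 n) (extChartAt (𝓡 n) x₀).symm u)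
        (fun v => DFunLike.congr_fun (mfderiv_symm_comp_chart x₀ hu) v)
    rw [contDiffAt_continuousAltForm_iff]
    -- Conversely, the constant basis vectors are combinations, with smooth coefficients, of the
    -- frame read in the chart.
    intro J
    choose c hc hcv using fun i : Fin k =>
      exists_smooth_coefficients (p := (p, u)) hê hli' (stdBasis n (J i))
    refine contDiffAt_apply_of_combination (W := fun _ => ModelSpace n)
      (f := fun q : P × ModelSpace n => (chartRep x₀ (θ q.1) k q.2).toAlternatingMap)
      (g := fun _ i => stdBasis n (J i)) (e := fun q a => chartField x₀ (e a) q.2)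
      (c := c) (fun I => ?_) hc (Filter.eventually_all.mpr hcv)
    refine (h I).congr_of_eventuallyEq ?_
    filter_upwards [hev] with q hq
    exact chartRep_chartField x₀ (θ q.1) k hq fun i => e (I i)

end Charts

/-! ### The de Rham differential: chart independence, smoothness, `d² = 0`, Leibniz rule -/

section ExteriorDerivative

variable {n : ℕ} {M : Type*} [TopologicalSpace M] [ChartedSpace (ModelSpace n) M]
  [IsManifold (𝓡 n) ∞ M]

theorem minSmoothness_two_le_infty : minSmoothness ℝ 2 ≤ (∞ : WithTop ℕ∞) := by
  rw [minSmoothness_of_isRCLikeNormedField]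
  exact ENat.LEInfty.out

theorem exteriorD_zero (θ : FieldOfForms n M) (x : M) : exteriorD θ x 0 = 0 := rfl

/-- The pullback to `T_x M` of forms on the model space, by the chart at `x`. -/
def chartPullback (x : M) (k : ℕ) : ((ModelSpace n) [⋀^Fin k]→L[ℝ] ℝ) →ₗ[ℝ]
    (TangentSpace (𝓡 n) x) [⋀^Fin k]→ₗ[ℝ] ℝ where
  toFun α := α.toAlternatingMap.compLinearMap
    (mfderiv (𝓡 n) 𝓘(ℝ, ModelSpace n) (extChartAt (𝓡 n) x) x).toLinearMap
  map_add' _ _ := rfl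
  map_smul' _ _ := rfl

theorem chartPullback_apply (x : M) (k : ℕ) (α : (ModelSpace n) [⋀^Fin k]→L[ℝ] ℝ)
    (v : Fin k → TangentSpace (𝓡 n) x) : chartPullback x k α v =
      α (fun i => mfderiv (𝓡 n) 𝓘(ℝ, ModelSpace n) (extChartAt (𝓡 n) x) x (v i)) := rfl

theorem exteriorD_succ (θ : FieldOfForms n M) (x : M) (k : ℕ) : exteriorD θ x (k + 1) =
    chartPullback x (k + 1) (extDeriv (chartRep x θ k) (extChartAt (𝓡 n) x x)) := rfl

/-- The product of a field of forms with a function. -/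
def scaleForm (f : M → ℝ) (θ : FieldOfForms n M) : FieldOfForms n M := fun x => f x • θ x

/-- The transition map from the chart at `x₀` to the chart at `x`. -/
def transition (x₀ x : M) (u : ModelSpace n) : ModelSpace n :=
  extChartAt (𝓡 n) x ((extChartAt (𝓡 n) x₀).symm u)

theorem eventually_mem_charts (x₀ : M) {u : ModelSpace n} (hu : u ∈ (extChartAt (𝓡 n) x₀).target)
    {U : Set M} (hU : IsOpen U) (hx : (extChartAt (𝓡 n) x₀).symm u ∈ U) :
    ∀ᶠ v in nhds u, v ∈ (extChartAt (𝓡 n) x₀).target ∧ (extChartAt (𝓡 n) x₀).symm v ∈ U := by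
  have hopen := (isOpen_extChartAt_target (I := 𝓡 n) x₀).mem_nhds hu
  exact Filter.Eventually.and hopen
    (((continuousOn_extChartAt_symm (I := 𝓡 n) x₀).continuousAt hopen).preimage_mem_nhds
      (hU.mem_nhds hx))

theorem hasFDerivAt_transition (x₀ x : M) {u : ModelSpace n}
    (hu : u ∈ (extChartAt (𝓡 n) x₀).target)
    (hx : (extChartAt (𝓡 n) x₀).symm u ∈ (extChartAt (𝓡 n) x).source) :
    fderiv ℝ (transition x₀ x) u =
      (mfderiv (𝓡 n) 𝓘(ℝ, ModelSpace n) (extChartAt (𝓡 n) x) ((extChartAt (𝓡 n) x₀).symm u)).comp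
      (mfderiv 𝓘(ℝ, ModelSpace n) (𝓡 n) (extChartAt (𝓡 n) x₀).symm u) := by
  rw [← mfderiv_eq_fderiv]
  exact mfderiv_comp u (mdifferentiableAt_chart x hx) (mdifferentiableAt_chart_symm x₀ hu)

theorem contDiffAt_transition (x₀ x : M) {u : ModelSpace n}
    (hu : u ∈ (extChartAt (𝓡 n) x₀).target)
    (hx : (extChartAt (𝓡 n) x₀).symm u ∈ (extChartAt (𝓡 n) x).source) :
    ContDiffAt ℝ ∞ (transition x₀ x) u := by
  rw [← contMDiffAt_iff_contDiffAt]
  have h1 := (contMDiffOn_extChartAt_symm (I := 𝓡 n) (n := ∞) x₀).contMDiffAt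
    ((isOpen_extChartAt_target x₀).mem_nhds hu)
  have h2 := contMDiffAt_extChartAt' (I := 𝓡 n) (n := ∞)
    (x := x) (x' := (extChartAt (𝓡 n) x₀).symm u) (by rwa [extChartAt_source] at hx)
  exact h2.comp u h1

/-- Two representatives of a form differ by pullback along the transition map, because the chart and
its inverse have mutually inverse derivatives. With naturality of the exterior derivative on the
model space, this makes `exteriorD` independent of the chart. -/
theorem chartRep_eq_pullback (x₀ x : M) (θ : FieldOfForms n M) (k : ℕ) {u : ModelSpace n}
    (hu : u ∈ (extChartAt (𝓡 n) x₀).target)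
    (hx : (extChartAt (𝓡 n) x₀).symm u ∈ (extChartAt (𝓡 n) x).source) :
    chartRep x₀ θ k u = (chartRep x θ k (transition x₀ x u)).compContinuousLinearMap
      (fderiv ℝ (transition x₀ x) u) := by
  ext v
  have h1 : (extChartAt (𝓡 n) x).symm (transition x₀ x u) = (extChartAt (𝓡 n) x₀).symm u :=
    (extChartAt (𝓡 n) x).left_inv hx
  have h2 : transition x₀ x u ∈ (extChartAt (𝓡 n) x).target := (extChartAt (𝓡 n) x).map_source hx
  have h3 := mfderiv_symm_comp_chart x h2
  rw [hasFDerivAt_transition x₀ x hu hx]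
  change θ ((extChartAt (𝓡 n) x₀).symm u) k _ =
    θ ((extChartAt (𝓡 n) x).symm (transition x₀ x u)) k (fun i =>
      mfderiv 𝓘(ℝ, ModelSpace n) (𝓡 n) (extChartAt (𝓡 n) x).symm (transition x₀ x u) _)
  -- The base point is generalised so that the equality of points can be substituted: tangent spaces
  -- at propositionally equal points are different types.
  have key : ∀ (y : M) (hy : y = (extChartAt (𝓡 n) x₀).symm u)
      (A : ModelSpace n →L[ℝ] TangentSpace (𝓡 n) y)
      (_ : ∀ w, (A : ModelSpace n → ModelSpace n) (mfderiv (𝓡 n) 𝓘(ℝ, ModelSpace n)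
        (extChartAt (𝓡 n) x) ((extChartAt (𝓡 n) x₀).symm u) w) = w),
      θ ((extChartAt (𝓡 n) x₀).symm u) k (fun i => mfderiv 𝓘(ℝ, ModelSpace n) (𝓡 n)
        (extChartAt (𝓡 n) x₀).symm u (v i)) = θ y k (fun i =>
        A (mfderiv (𝓡 n) 𝓘(ℝ, ModelSpace n) (extChartAt (𝓡 n) x) ((extChartAt (𝓡 n) x₀).symm u)
        (mfderiv 𝓘(ℝ, ModelSpace n) (𝓡 n) (extChartAt (𝓡 n) x₀).symm u (v i)))) := by
    rintro y rfl A hA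
    congr 1
    funext i
    exact (hA _).symm
  refine key _ h1 (mfderiv 𝓘(ℝ, ModelSpace n) (𝓡 n) (extChartAt (𝓡 n) x).symm
    (transition x₀ x u)) (fun w => ?_)
  rw [h1] at h3
  exact DFunLike.congr_fun h3 w

theorem chartRep_self (x : M) (θ : FieldOfForms n M) (k : ℕ) (v : Fin k → TangentSpace (𝓡 n) x) :
    chartRep x θ k (extChartAt (𝓡 n) x x)
      (fun i => mfderiv (𝓡 n) 𝓘(ℝ, ModelSpace n) (extChartAt (𝓡 n) x) x (v i)) = θ x k v := by
  refine (chartRep_apply _ _ _ _ _).trans ?_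
  have h5 := mfderiv_symm_comp_chart x (mem_extChartAt_target (I := 𝓡 n) x)
  have key : ∀ (y : M) (_ : y = x) (A : ModelSpace n →L[ℝ] TangentSpace (𝓡 n) y)
      (_ : ∀ w, (A : ModelSpace n → ModelSpace n) (mfderiv (𝓡 n) 𝓘(ℝ, ModelSpace n)
        (extChartAt (𝓡 n) x) x w) = w), θ y k (fun j => A
          (mfderiv (𝓡 n) 𝓘(ℝ, ModelSpace n) (extChartAt (𝓡 n) x) x (v j))) = θ x k v := by
    rintro y rfl A hA
    congr 1
    funext j
    exact hA _
  refine key _ (extChartAt_to_inv x) _ fun w => ?_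
  rw [extChartAt_to_inv] at h5
  exact DFunLike.congr_fun h5 w

/-- The exterior derivative can be computed in any chart. -/
theorem chartRep_exteriorD (x₀ : M) (θ : FieldOfForms n M) (k : ℕ) {u : ModelSpace n}
    (hu : u ∈ (extChartAt (𝓡 n) x₀).target)
    (hθ : DifferentiableAt ℝ (chartRep ((extChartAt (𝓡 n) x₀).symm u) θ k)
      (extChartAt (𝓡 n) ((extChartAt (𝓡 n) x₀).symm u) ((extChartAt (𝓡 n) x₀).symm u))) :
    chartRep x₀ (exteriorD θ) (k + 1) u = extDeriv (chartRep x₀ θ k) u := by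
  set x := (extChartAt (𝓡 n) x₀).symm u with hx
  have hxs : x ∈ (extChartAt (𝓡 n) x).source := mem_extChartAt_source x
  have h1 : chartRep x₀ θ k =ᶠ[nhds u] fun v => (chartRep x θ k (transition x₀ x v)).compContinuousLinearMap
      (fderiv ℝ (transition x₀ x) v) := by
    filter_upwards [eventually_mem_charts x₀ hu (isOpen_extChartAt_source (I := 𝓡 n) x) hxs] with v hv
    exact chartRep_eq_pullback x₀ x θ k hv.1 hv.2
  rw [h1.extDeriv_eq, extDeriv_pullback (r := ∞) (by exact hθ)
    (contDiffAt_transition x₀ x hu hxs) minSmoothness_two_le_infty, hasFDerivAt_transition x₀ x hu hxs]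
  rfl

/-- Families of forms depending smoothly on a parameter in `D` and on the point of `U`. -/
def SmoothFamilyOn (D : Set ℂ) (U : Set M) (θ : ℂ → FieldOfForms n M) : Prop :=
  ∀ (k : ℕ) (x₀ : M) (u : ModelSpace n), u ∈ (extChartAt (𝓡 n) x₀).target →
    (extChartAt (𝓡 n) x₀).symm u ∈ U → ∀ z ∈ D,
      ContDiffAt ℝ ∞ (fun q : ℂ × ModelSpace n => chartRep x₀ (θ q.1) k q.2) (z, u)

variable {D : Set ℂ} {U : Set M} {θ η : ℂ → FieldOfForms n M}

theorem isOpen_chart_inter (x₀ : M) (hU : IsOpen U) :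
    IsOpen ((extChartAt (𝓡 n) x₀).target ∩ (extChartAt (𝓡 n) x₀).symm ⁻¹' U) :=
  (continuousOn_extChartAt_symm x₀).isOpen_inter_preimage (isOpen_extChartAt_target x₀) hU

theorem IsSmoothFormOn.contDiffAt (hU : IsOpen U) {ψ : FieldOfForms n M} (h : IsSmoothFormOn U ψ)
    (k : ℕ) {x₀ : M} {u : ModelSpace n} (hu : u ∈ (extChartAt (𝓡 n) x₀).target)
    (hx : (extChartAt (𝓡 n) x₀).symm u ∈ U) : ContDiffAt ℝ ∞ (chartRep x₀ ψ k) u :=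
  (h k x₀).contDiffAt ((isOpen_chart_inter x₀ hU).mem_nhds ⟨hu, hx⟩)

theorem IsSmoothFormOn.contDiffAt_self (hU : IsOpen U) {ψ : FieldOfForms n M}
    (h : IsSmoothFormOn U ψ) (k : ℕ) {x : M} (hx : x ∈ U) :
    ContDiffAt ℝ ∞ (chartRep x ψ k) (extChartAt (𝓡 n) x x) :=
  h.contDiffAt hU k (mem_extChartAt_target x) (by rwa [extChartAt_to_inv])

theorem SmoothFamilyOn.isSmoothFormOn (h : SmoothFamilyOn D U θ) {z : ℂ} (hz : z ∈ D) :
    IsSmoothFormOn U (θ z) := fun k x₀ u hu =>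
  (ContDiffAt.comp (g := fun q : ℂ × ModelSpace n => chartRep x₀ (θ q.1) k q.2)
    (f := fun v : ModelSpace n => (z, v)) u (h k x₀ u hu.1 hu.2 z hz)
    (contDiffAt_const.prodMk contDiffAt_id)).contDiffWithinAt

theorem IsSmoothFormOn.smoothFamilyOn (hU : IsOpen U) {ψ : FieldOfForms n M}
    (h : IsSmoothFormOn U ψ) : SmoothFamilyOn D U fun _ => ψ := fun k _ _ hu hx _ _ =>
  ContDiffAt.comp (g := chartRep _ ψ k) (f := fun q : ℂ × ModelSpace n => q.2) _
    (h.contDiffAt hU k hu hx) contDiffAt_snd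

theorem SmoothFamilyOn.add (hθ : SmoothFamilyOn D U θ) (hη : SmoothFamilyOn D U η) :
    SmoothFamilyOn D U fun z => θ z + η z := fun k x₀ u hu hx z hz =>
  ((hθ k x₀ u hu hx z hz).add (hη k x₀ u hu hx z hz)).congr_of_eventuallyEq
    (Filter.Eventually.of_forall fun q => by ext v; rfl)

theorem SmoothFamilyOn.smul {c : ℂ → ℝ} (hc : ContDiff ℝ ∞ c) (hθ : SmoothFamilyOn D U θ) :
    SmoothFamilyOn D U fun z => c z • θ z := fun k x₀ u hu hx z hz =>
  (ContDiffAt.smul (hc.contDiffAt.comp (z, u) contDiffAt_fst)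
    (hθ k x₀ u hu hx z hz)).congr_of_eventuallyEq
    (Filter.Eventually.of_forall fun q => by ext v; rfl)

theorem SmoothFamilyOn.congr (hD : IsOpen D) (hU : IsOpen U) (hθ : SmoothFamilyOn D U θ)
    (h : ∀ z ∈ D, ∀ x ∈ U, η z x = θ z x) : SmoothFamilyOn D U η := by
  intro k x₀ u hu hx z hz
  refine (hθ k x₀ u hu hx z hz).congr_of_eventuallyEq ?_
  have h1 : ∀ᶠ q in nhds (z, u), q.1 ∈ D := continuousAt_fst.preimage_mem_nhds (hD.mem_nhds hz)
  have h2 : ∀ᶠ q in nhds (z, u), q.2 ∈ (extChartAt (𝓡 n) x₀).target ∧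
      (extChartAt (𝓡 n) x₀).symm q.2 ∈ U := (continuous_snd.tendsto (z, u)).eventually (eventually_mem_charts x₀ hu hU hx)
  filter_upwards [h1, h2] with q hq1 hq2
  ext v
  rw [chartRep_apply, chartRep_apply, h _ hq1 _ hq2.2]

/-- In a chart, `d` differentiates in the point variable only, and a partial derivative of a jointly
smooth map is jointly smooth. Joint smoothness in `z` is carried along to obtain continuity, and
then holomorphy, of resolvent values. -/
theorem SmoothFamilyOn.exteriorD (hD : IsOpen D) (hU : IsOpen U) (hθ : SmoothFamilyOn D U θ) :
    SmoothFamilyOn D U fun z => exteriorD (θ z) := by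
  intro k x₀ u hu hx z hz
  cases k with
  | zero =>
    refine (contDiffAt_const (c := 0)).congr_of_eventuallyEq (Filter.Eventually.of_forall fun q => ?_)
    ext v; rfl
  | succ k =>
    have h1 : ∀ᶠ q in nhds (z, u), q.1 ∈ D := continuousAt_fst.preimage_mem_nhds (hD.mem_nhds hz)
    have h2 : ∀ᶠ q in nhds (z, u), q.2 ∈ (extChartAt (𝓡 n) x₀).target ∧
        (extChartAt (𝓡 n) x₀).symm q.2 ∈ U :=
      (continuous_snd.tendsto (z, u)).eventually (eventually_mem_charts x₀ hu hU hx)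
    have h3 : ContDiffAt ℝ ∞ (fun q : ℂ × ModelSpace n =>
        extDeriv (chartRep x₀ (θ q.1) k) q.2) (z, u) := by
      have h4 : ContDiffAt ℝ ∞ (fun q : ℂ × ModelSpace n =>
          fderiv ℝ (chartRep x₀ (θ q.1) k) q.2) (z, u) := by
        refine ContDiffAt.fderiv (n := ∞) (f := fun q : ℂ × ModelSpace n => chartRep x₀ (θ q.1) k)
          (g := fun q => q.2) ?_ contDiffAt_snd (by simp)
        exact ContDiffAt.comp (g := fun q : ℂ × ModelSpace n => chartRep x₀ (θ q.1) k q.2)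
          (f := fun q : (ℂ × ModelSpace n) × ModelSpace n => (q.1.1, q.2)) ((z, u), u)
          (hθ k x₀ u hu hx z hz)
          ((contDiffAt_fst.comp _ contDiffAt_fst).prodMk contDiffAt_snd)
      exact (ContinuousAlternatingMap.alternatizeUncurryFinCLM ℝ (ModelSpace n) ℝ).contDiff.contDiffAt.comp
        (z, u) h4
    refine h3.congr_of_eventuallyEq ?_
    filter_upwards [h1, h2] with q hq1 hq2
    exact chartRep_exteriorD x₀ (θ q.1) k hq2.1
      (((hθ.isSmoothFormOn hq1).contDiffAt_self hU k hq2.2).differentiableAt (by simp))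

theorem IsSmoothFormOn.exteriorD (hU : IsOpen U) {ψ : FieldOfForms n M} (h : IsSmoothFormOn U ψ) :
    IsSmoothFormOn U (exteriorD ψ) :=
  (SmoothFamilyOn.exteriorD isOpen_univ hU (h.smoothFamilyOn hU (D := Set.univ))).isSmoothFormOn
    (Set.mem_univ 0)

/-- Locality of `d`. Formulas for operators on an open set are only asserted there, forms being
extended by zero outside, so locality is what allows them to be substituted under `d`. -/
theorem exteriorD_congr (hU : IsOpen U) {ψ ψ' : FieldOfForms n M} (h : ∀ x ∈ U, ψ x = ψ' x) {x : M}
    (hx : x ∈ U) : exteriorD ψ x = exteriorD ψ' x := by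
  funext k
  cases k with
  | zero => rfl
  | succ k =>
    rw [exteriorD_succ, exteriorD_succ]
    have h1 : chartRep x ψ k =ᶠ[nhds (extChartAt (𝓡 n) x x)] chartRep x ψ' k := by
      filter_upwards [eventually_mem_charts x (mem_extChartAt_target x) hU
        (by rwa [extChartAt_to_inv])] with u hu
      ext v
      rw [chartRep_apply, chartRep_apply, h _ hu.2]
    rw [h1.extDeriv_eq]

theorem exteriorD_add (hU : IsOpen U) {ψ ψ' : FieldOfForms n M} (h : IsSmoothFormOn U ψ)
    (h' : IsSmoothFormOn U ψ') {x : M} (hx : x ∈ U) :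
    exteriorD (ψ + ψ') x = exteriorD ψ x + exteriorD ψ' x := by
  funext k
  cases k with
  | zero => exact (add_zero _).symm
  | succ k =>
    have h1 : chartRep x (ψ + ψ') k = fun u => chartRep x ψ k u + chartRep x ψ' k u := by
      funext u; ext v; rfl
    rw [exteriorD_succ, h1, extDeriv_fun_add
      ((h.contDiffAt_self hU k hx).differentiableAt (by simp))
      ((h'.contDiffAt_self hU k hx).differentiableAt (by simp)), map_add]
    rfl

theorem exteriorD_smul (c : ℝ) (ψ : FieldOfForms n M) (x : M) :
    exteriorD (c • ψ) x = c • exteriorD ψ x := by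
  funext k
  cases k with
  | zero => exact (smul_zero (A := (TangentSpace (𝓡 n) x) [⋀^Fin 0]→ₗ[ℝ] ℝ) c).symm
  | succ k =>
    have h1 : chartRep x (c • ψ) k = fun u => c • chartRep x ψ k u := by
      funext u; ext v; rfl
    have h2 : extDeriv (chartRep x (c • ψ) k) (extChartAt (𝓡 n) x x) =
        c • extDeriv (chartRep x ψ k) (extChartAt (𝓡 n) x x) := by
      rw [h1]
      exact extDeriv_fun_smul c _
    rw [exteriorD_succ, h2, map_smul]
    rfl

/-- `exteriorD` uses at each nearby point the chart of that point; chart independence identifies it,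
near `x`, with the exterior derivative in the single chart at `x`, where `d² = 0` is known. The two
lowest degrees are separate because the degree zero part of `dψ` is zero by definition. -/
theorem exteriorD_exteriorD (hU : IsOpen U) {ψ : FieldOfForms n M} (h : IsSmoothFormOn U ψ) {x : M}
    (hx : x ∈ U) : exteriorD (exteriorD ψ) x = 0 := by
  have hx' : (extChartAt (𝓡 n) x).symm (extChartAt (𝓡 n) x x) ∈ U := by rwa [extChartAt_to_inv]
  funext k
  match k with
  | 0 => rfl
  | 1 =>
    have h1 : chartRep x (exteriorD ψ) 0 = fun _ => 0 := by
      funext u; ext v; rfl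
    have h2 : extDeriv (chartRep x (exteriorD ψ) 0) (extChartAt (𝓡 n) x x) = 0 := by
      ext v
      rw [h1, extDeriv, fderiv_const_apply, ContinuousAlternatingMap.alternatizeUncurryFin_apply]
      simp
    rw [exteriorD_succ, h2, map_zero]
    rfl
  | k + 2 =>
    have h1 : chartRep x (exteriorD ψ) (k + 1) =ᶠ[nhds (extChartAt (𝓡 n) x x)]
        extDeriv (chartRep x ψ k) := by
      filter_upwards [eventually_mem_charts x (mem_extChartAt_target x) hU hx'] with u hu
      exact chartRep_exteriorD x ψ k hu.1
        ((h.contDiffAt_self hU k hu.2).differentiableAt (by simp))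
    rw [exteriorD_succ, h1.extDeriv_eq, extDeriv_extDeriv_apply (r := ∞)
      (h.contDiffAt_self hU k hx) minSmoothness_two_le_infty, map_zero]
    rfl

/-- The Leibniz rule, in the weak form needed for the order of the exterior derivative. -/
theorem exists_exteriorD_mul {f : M → ℝ} (hf : ContMDiff (𝓡 n) 𝓘(ℝ, ℝ) ∞ f) (x : M) :
    ∃ L : TotalForm (TangentSpace (𝓡 n) x) →ₗ[ℝ] TotalForm (TangentSpace (𝓡 n) x),
      ∀ ψ : FieldOfForms n M, IsSmoothFormOn Set.univ ψ →
        exteriorD (scaleForm f ψ) x = f x • exteriorD ψ x + L (ψ x) := by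
  let g : ModelSpace n → ℝ := fun u => f ((extChartAt (𝓡 n) x).symm u)
  have hg : ContDiffAt ℝ ∞ g (extChartAt (𝓡 n) x x) := by
    rw [← contMDiffAt_iff_contDiffAt]
    exact hf.contMDiffAt.comp _ ((contMDiffOn_extChartAt_symm (I := 𝓡 n) (n := ∞) x).contMDiffAt
      ((isOpen_extChartAt_target x).mem_nhds (mem_extChartAt_target x)))
  let df : TangentSpace (𝓡 n) x →ₗ[ℝ] ℝ :=
    (fderiv ℝ g (extChartAt (𝓡 n) x x)).toLinearMap ∘ₗ
      (mfderiv (𝓡 n) 𝓘(ℝ, ModelSpace n) (extChartAt (𝓡 n) x) x).toLinearMap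
  refine ⟨raiseDegree fun k =>
    { toFun := fun α => AlternatingMap.alternatizeUncurryFin (df.smulRight α)
      map_add' := fun α β => by
        rw [← AlternatingMap.alternatizeUncurryFin_add]; congr 1; ext u v; simp
      map_smul' := fun c α => by
        rw [← AlternatingMap.alternatizeUncurryFin_smul]; congr 1; ext u v; simp [mul_left_comm] },
    fun ψ hψ => ?_⟩
  funext k
  cases k with
  | zero =>
    change (0 : (TangentSpace (𝓡 n) x) [⋀^Fin 0]→ₗ[ℝ] ℝ) = f x • 0 + 0
    simp
  | succ k =>
    have h1 : chartRep x (scaleForm f ψ) k = fun u => g u • chartRep x ψ k u := by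
      funext u; ext v; rfl
    have h2 : DifferentiableAt ℝ (chartRep x ψ k) (extChartAt (𝓡 n) x x) :=
      (hψ.contDiffAt_self isOpen_univ k (Set.mem_univ x)).differentiableAt (by simp)
    have h3 : g (extChartAt (𝓡 n) x x) = f x := by simp [g]
    rw [exteriorD_succ, h1, extDeriv, fderiv_fun_smul (hg.differentiableAt (by simp)) h2,
      ContinuousAlternatingMap.alternatizeUncurryFin_add,
      ContinuousAlternatingMap.alternatizeUncurryFin_smul, h3, map_add, map_smul]
    change f x • (exteriorD ψ x (k + 1)) + _ = f x • (exteriorD ψ x (k + 1)) +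
      AlternatingMap.alternatizeUncurryFin (df.smulRight (ψ x k))
    congr 1
    ext v
    rw [chartPullback_apply, AlternatingMap.alternatizeUncurryFin_apply]
    refine (ContinuousAlternatingMap.alternatizeUncurryFin_apply _ _).trans ?_
    refine Finset.sum_congr rfl fun i _ => ?_
    have h5 : ∀ (A : ModelSpace n →L[ℝ] ℝ) (α : (ModelSpace n) [⋀^Fin k]→L[ℝ] ℝ) (u : ModelSpace n)
        (w : Fin k → ModelSpace n), (A.smulRight α u) w = A u * α w := fun _ _ _ _ => by simp
    congr 1
    refine (h5 _ _ _ _).trans ?_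
    exact congrArg (fun c => df (v i) * c) (chartRep_self x ψ k (i.removeNth v))

end ExteriorDerivative

/-! ### Gram–Schmidt and initial segments -/

section GramSchmidt

open InnerProductSpace

variable {E : Type*} [NormedAddCommGroup E] [InnerProductSpace ℝ E]

/-- Gram–Schmidt is triangular, so it preserves the spans of initial segments. A frame sorted by
weight therefore remains adapted to the flag. -/
theorem span_gramSchmidtNormed_lowerSet {m : ℕ} (f : Fin m → E) {s : Set (Fin m)} (hs : IsLowerSet s) :
    Submodule.span ℝ (gramSchmidtNormed ℝ f '' s) = Submodule.span ℝ (f '' s) := by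
  rw [span_gramSchmidtNormed]
  refine le_antisymm (Submodule.span_le.mpr ?_) (Submodule.span_le.mpr ?_)
  · rintro _ ⟨a, ha, rfl⟩
    refine Submodule.span_mono (Set.image_mono fun b hb => ?_)
      (gramSchmidt_mem_span ℝ f (le_refl a))
    exact hs hb ha
  · rintro _ ⟨a, ha, rfl⟩
    refine Submodule.span_mono (Set.image_mono fun b hb => ?_)
      (mem_span_gramSchmidt ℝ f (le_refl a))
    exact hs hb ha

end GramSchmidt

/-! ### Smooth orthonormal frames adapted to the filtration -/

section Frames

variable {n : ℕ} {M : Type*} [TopologicalSpace M] [ChartedSpace (ModelSpace n) M]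
  [IsManifold (𝓡 n) ∞ M]

/-- Smoothness of a vector field at a point. -/
abbrev SmoothFieldAt (X : ∀ y : M, TangentSpace (𝓡 n) y) (x : M) : Prop :=
  ContMDiffAt (𝓡 n) (𝓡 n).tangent ∞ (fun y => (⟨y, X y⟩ : TangentBundle (𝓡 n) M)) x

theorem SmoothFieldAt.smul {X : ∀ y : M, TangentSpace (𝓡 n) y} {f : M → ℝ} {x : M}
    (hf : ContMDiffAt (𝓡 n) 𝓘(ℝ, ℝ) ∞ f x) (hX : SmoothFieldAt X x) :
    SmoothFieldAt (fun y => f y • X y) x :=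
  ContMDiffAt.smul_section hf hX

theorem SmoothFieldAt.sum {ι : Type*} {s : Finset ι} {X : ι → ∀ y : M, TangentSpace (𝓡 n) y} {x : M}
    (hX : ∀ a ∈ s, SmoothFieldAt (X a) x) : SmoothFieldAt (fun y => ∑ a ∈ s, X a y) x :=
  ContMDiffAt.sum_section hX

theorem SmoothFieldAt.sub {X Y : ∀ y : M, TangentSpace (𝓡 n) y} {x : M}
    (hX : SmoothFieldAt X x) (hY : SmoothFieldAt Y x) : SmoothFieldAt (fun y => X y - Y y) x :=
  ContMDiffAt.sub_section hX hY

variable [RiemannianBundle (fun x : M => TangentSpace (𝓡 n) x)]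
  [IsContMDiffRiemannianBundle (𝓡 n) ∞ (EuclideanSpace ℝ (Fin n)) (fun x : M => TangentSpace (𝓡 n) x)]

theorem SmoothFieldAt.inner {X Y : ∀ y : M, TangentSpace (𝓡 n) y} {x : M} (hX : SmoothFieldAt X x)
    (hY : SmoothFieldAt Y x) :
    ContMDiffAt (𝓡 n) 𝓘(ℝ, ℝ) ∞ (fun y => (inner ℝ (X y) (Y y) : ℝ)) x :=
  ContMDiffAt.inner_bundle (F := EuclideanSpace ℝ (Fin n)) hX hY

/-- By induction: the explicit formula divides only by squared norms of earlier vectors, which are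
nonzero at `x` by independence. -/
theorem smoothFieldAt_gramSchmidt {m : ℕ} {X : Fin m → ∀ y : M, TangentSpace (𝓡 n) y} {x : M}
    (hX : ∀ a, SmoothFieldAt (X a) x) (hli : LinearIndependent ℝ fun a => X a x) (a : Fin m) :
    SmoothFieldAt (fun y => InnerProductSpace.gramSchmidt ℝ (fun b => X b y) a) x := by
  induction a using WellFoundedLT.induction with
  | _ a ih =>
    have h1 : SmoothFieldAt (fun y => X a y - ∑ b ∈ Finset.Iio a,
        ((inner ℝ (InnerProductSpace.gramSchmidt ℝ (fun b => X b y) b) (X a y) : ℝ) /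
          inner ℝ (InnerProductSpace.gramSchmidt ℝ (fun b => X b y) b)
            (InnerProductSpace.gramSchmidt ℝ (fun b => X b y) b)) •
          InnerProductSpace.gramSchmidt ℝ (fun b => X b y) b) x := by
      refine (hX a).sub (SmoothFieldAt.sum fun b hb => ?_)
      have hb' := ih b (Finset.mem_Iio.mp hb)
      refine SmoothFieldAt.smul ?_ hb'
      refine (hb'.inner (hX a)).div₀ (hb'.inner hb') ?_
      rw [inner_self_ne_zero]
      exact InnerProductSpace.gramSchmidt_ne_zero b hli
    refine h1.congr_of_eventuallyEq (Filter.Eventually.of_forall fun y => ?_)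
    refine congrArg (fun v => (⟨y, v⟩ : TangentBundle (𝓡 n) M)) ?_
    refine (InnerProductSpace.gramSchmidt_def ℝ (fun b => X b y) a).trans ?_
    refine congrArg (X a y - ·) (Finset.sum_congr rfl fun b _ => ?_)
    rw [Submodule.starProjection_singleton, real_inner_self_eq_norm_sq]
    rfl

theorem smoothFieldAt_gramSchmidtNormed {m : ℕ} {X : Fin m → ∀ y : M, TangentSpace (𝓡 n) y} {x : M}
    (hX : ∀ a, SmoothFieldAt (X a) x) (hli : LinearIndependent ℝ fun a => X a x) (a : Fin m) :
    SmoothFieldAt (fun y => InnerProductSpace.gramSchmidtNormed ℝ (fun b => X b y) a) x := by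
  have h1 := smoothFieldAt_gramSchmidt hX hli a
  have h2 : (inner ℝ (InnerProductSpace.gramSchmidt ℝ (fun b => X b x) a)
      (InnerProductSpace.gramSchmidt ℝ (fun b => X b x) a) : ℝ) ≠ 0 := by
    rw [inner_self_ne_zero]
    exact InnerProductSpace.gramSchmidt_ne_zero a hli
  have h3 : ContDiffAt ℝ ∞ (fun t : ℝ => (√t)⁻¹)
      (inner ℝ (InnerProductSpace.gramSchmidt ℝ (fun b => X b x) a)
        (InnerProductSpace.gramSchmidt ℝ (fun b => X b x) a)) := by
    refine (Real.contDiffAt_sqrt h2).inv ?_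
    exact (Real.sqrt_pos.mpr (lt_of_le_of_ne real_inner_self_nonneg (Ne.symm h2))).ne'
  have h4 := (contMDiffAt_iff_contDiffAt.mpr h3).comp x (h1.inner h1)
  refine (SmoothFieldAt.smul h4 h1).congr_of_eventuallyEq (Filter.Eventually.of_forall fun y => ?_)
  refine congrArg (fun v => (⟨y, v⟩ : TangentBundle (𝓡 n) M)) ?_
  change (_ : ℝ)⁻¹ • _ = (√(inner ℝ _ _ : ℝ))⁻¹ • _
  rw [← norm_eq_sqrt_real_inner]
  rfl

/-- A smooth orthonormal frame on the open set `N`, adapted to the filtration; `w a` is the weight of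
the vector field `e a`. -/
structure OrthoFrame (F : ManifoldFiltration n M) where
  N : Set M
  isOpen : IsOpen N
  w : Fin n → ℕ
  e : Fin n → ∀ y : M, TangentSpace (𝓡 n) y
  smooth : ∀ a, ∀ y ∈ N, SmoothFieldAt (e a) y
  orthonormal : ∀ y ∈ N, Orthonormal ℝ fun a => e a y
  span : ∀ y ∈ N, ∀ i, (F.flag y).H i = Submodule.span ℝ ((fun a => e a y) '' {a | w a ≤ i})

theorem exists_orthoFrame (F : ManifoldFiltration n M) (x : M) : ∃ A : OrthoFrame F, x ∈ A.N := by
  obtain ⟨U, hU, hx, w, X, hX, hspan⟩ := F.exists_adapted_frame x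
  -- After sorting, the indices of weight at most `i` form an initial segment for every `i` at once.
  let σ := Tuple.sort w
  have hli : ∀ y ∈ U, LinearIndependent ℝ fun a => X (σ a) y := fun y hy =>
    (hX.linearIndependent hy).comp σ σ.injective
  refine ⟨⟨U, hU, w ∘ σ, fun a y => InnerProductSpace.gramSchmidtNormed ℝ (fun b => X (σ b) y) a,
    fun a y hy => smoothFieldAt_gramSchmidtNormed (fun b => hX.contMDiffAt hU hy (σ b)) (hli y hy) a,
    fun y hy => InnerProductSpace.gramSchmidtNormed_orthonormal (hli y hy), fun y hy i => ?_⟩, hx⟩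
  have hs : IsLowerSet {a | (w ∘ σ) a ≤ i} := fun a b hab ha =>
    (Tuple.monotone_sort w hab).trans ha
  refine (hspan y hy i).trans (Eq.trans ?_
    (span_gramSchmidtNormed_lowerSet (fun b => X (σ b) y) hs).symm)
  congr 1
  ext v
  constructor
  · rintro ⟨a, ha, rfl⟩
    exact ⟨σ.symm a, by simpa using ha, by simp⟩
  · rintro ⟨a, ha, rfl⟩
    exact ⟨σ a, ha, rfl⟩

end Frames

/-! ### Cutting off local vector fields -/

section Bump

variable {n : ℕ} {M : Type*} [TopologicalSpace M] [T2Space M] [ChartedSpace (ModelSpace n) M]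
  [IsManifold (𝓡 n) ∞ M]

theorem exists_cutoff {N : Set M} (hN : IsOpen N) {x : M} (hx : x ∈ N) : ∃ ρ : M → ℝ,
    ContMDiff (𝓡 n) 𝓘(ℝ, ℝ) ∞ ρ ∧ (∀ᶠ y in nhds x, ρ y = 1) ∧ tsupport ρ ⊆ N := by
  obtain ⟨f, -, hf⟩ := ((SmoothBumpFunction.nhds_basis_tsupport (I := 𝓡 n) x).mem_iff).mp
    (hN.mem_nhds hx)
  exact ⟨f, f.contMDiff, f.eventuallyEq_one, hf⟩

/-- A vector field on an open set, cut off, is smooth everywhere. -/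
theorem isSmoothVectorField_cutoff {N : Set M} {ρ : M → ℝ} (hρ : ContMDiff (𝓡 n) 𝓘(ℝ, ℝ) ∞ ρ)
    (hs : tsupport ρ ⊆ N) {X : ∀ y : M, TangentSpace (𝓡 n) y} (hX : ∀ y ∈ N, SmoothFieldAt X y) :
    IsSmoothVectorField (n := n) fun y => ρ y • X y := by
  intro y
  by_cases hy : y ∈ N
  · exact SmoothFieldAt.smul hρ.contMDiffAt (hX y hy)
  · have h0 : SmoothFieldAt (n := n) (fun y : M => (0 : TangentSpace (𝓡 n) y)) y :=
      contMDiff_zeroSection ℝ (TangentSpace (𝓡 n) (M := M)) y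
    refine h0.congr_of_eventuallyEq ?_
    filter_upwards [notMem_tsupport_iff_eventuallyEq.mp (fun h => hy (hs h))] with z hz
    refine congrArg (fun v => (⟨z, v⟩ : TangentBundle (𝓡 n) M)) ?_
    rw [hz]
    exact zero_smul ℝ _

end Bump

/-! ### Lie brackets of frame fields and structure functions -/

section Bracket

variable {n : ℕ} {M : Type*} [TopologicalSpace M] [ChartedSpace (ModelSpace n) M]
  [IsManifold (𝓡 n) ∞ M]

theorem SmoothFieldAt.mdifferentiableAt {X : ∀ y : M, TangentSpace (𝓡 n) y} {x : M}
    (hX : SmoothFieldAt X x) : MDifferentiableAt (𝓡 n) (𝓡 n).tangent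
      (fun y => (⟨y, X y⟩ : TangentBundle (𝓡 n) M)) x :=
  ContMDiffAt.mdifferentiableAt hX (by simp)

theorem mlieBracket_congr {X X' Y Y' : ∀ y : M, TangentSpace (𝓡 n) y} {x : M}
    (hX : ∀ᶠ y in nhds x, X y = X' y) (hY : ∀ᶠ y in nhds x, Y y = Y' y) :
    VectorField.mlieBracket (𝓡 n) X Y x = VectorField.mlieBracket (𝓡 n) X' Y' x :=
  Filter.EventuallyEq.mlieBracket_vectorField_eq hX hY

theorem isManifold_minSmoothness : IsManifold (𝓡 n) (minSmoothness ℝ 2) M :=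
  IsManifold.of_le minSmoothness_two_le_infty

attribute [local instance] isManifold_minSmoothness

theorem smoothFieldAt_mlieBracket {X Y : ∀ y : M, TangentSpace (𝓡 n) y} {x : M}
    (hX : SmoothFieldAt X x) (hY : SmoothFieldAt Y x) :
    SmoothFieldAt (VectorField.mlieBracket (𝓡 n) X Y) x := by
  have : IsManifold (𝓡 n) (((⊤ : ℕ∞) : WithTop ℕ∞) + 1) M := inferInstanceAs (IsManifold (𝓡 n) ∞ M)
  refine ContMDiffAt.mlieBracket_vectorField (n := (⊤ : ℕ∞)) hX hY ?_
  rw [minSmoothness_of_isRCLikeNormedField]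
  exact le_rfl

/-- The numbers `c a`, derivatives of the coefficients along `W`, are left unspecified: the identity
is later paired with a frame vector orthogonal to all `E a`, which removes them. -/
theorem exists_mlieBracket_sum_smul {ι : Type*} (s : Finset ι) {f : ι → M → ℝ}
    {E : ι → ∀ y : M, TangentSpace (𝓡 n) y} (W : ∀ y : M, TangentSpace (𝓡 n) y) {x : M}
    (hf : ∀ a ∈ s, ContMDiffAt (𝓡 n) 𝓘(ℝ, ℝ) ∞ (f a) x) (hE : ∀ a ∈ s, SmoothFieldAt (E a) x) :
    ∃ c : ι → ℝ, VectorField.mlieBracket (𝓡 n) (fun y => ∑ a ∈ s, f a y • E a y) W x =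
      ∑ a ∈ s, (f a x • VectorField.mlieBracket (𝓡 n) (E a) W x + c a • E a x) := by
  classical
  induction s using Finset.induction_on with
  | empty =>
    refine ⟨0, ?_⟩
    exact congrFun (VectorField.mlieBracket_zero_left (I := 𝓡 n) (W := W)) x
  | insert a s ha ih =>
    obtain ⟨c, hc⟩ := ih (fun b hb => hf b (Finset.mem_insert_of_mem hb))
      fun b hb => hE b (Finset.mem_insert_of_mem hb)
    have hfa := hf a (Finset.mem_insert_self a s)
    have hEa := hE a (Finset.mem_insert_self a s)
    have h1 : (fun y => ∑ a ∈ insert a s, f a y • E a y) =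
        (f a • E a) + fun y => ∑ a ∈ s, f a y • E a y := by
      funext y
      exact Finset.sum_insert ha
    have h2 : SmoothFieldAt (fun y => ∑ a ∈ s, f a y • E a y) x :=
      SmoothFieldAt.sum fun b hb => SmoothFieldAt.smul (hf b (Finset.mem_insert_of_mem hb))
        (hE b (Finset.mem_insert_of_mem hb))
    have h3 : SmoothFieldAt (f a • E a) x := SmoothFieldAt.smul hfa hEa
    refine ⟨Function.update c a (- mvfderiv (𝓡 n) (f a) x (W x)), ?_⟩
    rw [h1, VectorField.mlieBracket_add_left h3.mdifferentiableAt h2.mdifferentiableAt, hc,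
      Finset.sum_insert ha, VectorField.mlieBracket_smul_left (hfa.mdifferentiableAt (by simp))
      hEa.mdifferentiableAt]
    congr 1
    · rw [Function.update_self, add_comm]
    · refine Finset.sum_congr rfl fun b hb => ?_
      rw [Function.update_of_ne (by rintro rfl; exact ha hb)]


variable [RiemannianBundle (fun x : M => TangentSpace (𝓡 n) x)]
  [IsContMDiffRiemannianBundle (𝓡 n) ∞ (EuclideanSpace ℝ (Fin n)) (fun x : M => TangentSpace (𝓡 n) x)]

namespace OrthoFrame

variable {F : ManifoldFiltration n M} (A : OrthoFrame F) {x : M}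

/-- The orthonormal basis given by the frame. -/
def basis (hx : x ∈ A.N) : OrthonormalBasis (Fin n) ℝ (TangentSpace (𝓡 n) x) :=
  OrthonormalBasis.mk (A.orthonormal x hx) (by
    have h := (A.orthonormal x hx).linearIndependent
    refine (LinearIndependent.span_eq_top_of_card_eq_finrank' h ?_).ge
    exact (Fintype.card_fin n).trans (finrank_euclideanSpace_fin (𝕜 := ℝ) (n := n)).symm)

@[simp] theorem basis_apply (hx : x ∈ A.N) (a : Fin n) : A.basis hx a = A.e a x :=
  congrFun (OrthonormalBasis.coe_mk (A.orthonormal x hx) _) a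

theorem sum_inner_smul (hx : x ∈ A.N) (v : TangentSpace (𝓡 n) x) :
    ∑ a, (inner ℝ (A.e a x) v : ℝ) • A.e a x = v := by
  have := (A.basis hx).sum_repr' v
  simpa only [basis_apply] using this

theorem inner_eq (hx : x ∈ A.N) (a b : Fin n) :
    (inner ℝ (A.e a x) (A.e b x) : ℝ) = if a = b then 1 else 0 :=
  orthonormal_iff_ite.mp (A.orthonormal x hx) a b

theorem ext_inner (hx : x ∈ A.N) {u v : TangentSpace (𝓡 n) x}
    (h : ∀ a, (inner ℝ (A.e a x) u : ℝ) = inner ℝ (A.e a x) v) : u = v := by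
  rw [← A.sum_inner_smul hx u, ← A.sum_inner_smul hx v]
  exact Finset.sum_congr rfl fun a _ => by rw [h a]

theorem e_mem (hx : x ∈ A.N) (a : Fin n) {i : ℕ} (h : A.w a ≤ i) : A.e a x ∈ (F.flag x).H i := by
  rw [A.span x hx]
  exact Submodule.subset_span ⟨a, h, rfl⟩

theorem mem_H_iff (hx : x ∈ A.N) {i : ℕ} {v : TangentSpace (𝓡 n) x} :
    v ∈ (F.flag x).H i ↔ ∀ c, i < A.w c → (inner ℝ (A.e c x) v : ℝ) = 0 := by
  constructor
  · intro hv c hc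
    rw [A.span x hx] at hv
    refine Submodule.span_induction (p := fun v _ => (inner ℝ (A.e c x) v : ℝ) = 0) ?_ ?_ ?_ ?_ hv
    · rintro _ ⟨a, ha, rfl⟩
      refine (A.inner_eq hx c a).trans (if_neg ?_)
      rintro rfl
      exact absurd ha (not_le.mpr hc)
    · exact inner_zero_right _
    · intro u v _ _ hu hv
      rw [inner_add_right, hu, hv, add_zero]
    · intro c u _ hu
      rw [real_inner_smul_right, hu, mul_zero]
  · intro h
    rw [← A.sum_inner_smul hx v]
    refine Submodule.sum_mem _ fun a _ => ?_
    by_cases ha : A.w a ≤ i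
    · exact Submodule.smul_mem _ _ (A.e_mem hx a ha)
    · rw [h a (not_le.mp ha), zero_smul]
      exact Submodule.zero_mem _

theorem w_pos (hx : x ∈ A.N) (a : Fin n) : 1 ≤ A.w a := by
  by_contra h
  have h1 := A.e_mem hx a (i := 0) (by omega)
  rw [(F.flag x).zero, Submodule.mem_bot] at h1
  have h2 := A.inner_eq hx a a
  rw [h1, inner_zero_left, if_pos rfl] at h2
  exact zero_ne_one h2

theorem eventually_mem (hx : x ∈ A.N) : ∀ᶠ y in nhds x, y ∈ A.N := A.isOpen.mem_nhds hx

/-- The vector fields of the frame extend to sections of the filtration. -/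
theorem exists_extension [T2Space M] (hx : x ∈ A.N) (a : Fin n) :
    ∃ X : ∀ y : M, TangentSpace (𝓡 n) y, IsSmoothVectorField (n := n) X ∧
      (∀ y i, A.w a ≤ i → X y ∈ (F.flag y).H i) ∧ ∀ᶠ y in nhds x, X y = A.e a y := by
  obtain ⟨ρ, hρ, h1, hs⟩ := exists_cutoff (n := n) A.isOpen hx
  refine ⟨fun y => ρ y • A.e a y, isSmoothVectorField_cutoff hρ hs (A.smooth a), fun y i hi => ?_, ?_⟩
  · by_cases hy : y ∈ A.N
    · exact Submodule.smul_mem _ _ (A.e_mem hy a hi)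
    · have : ρ y = 0 := image_eq_zero_of_notMem_tsupport fun h => hy (hs h)
      change ρ y • A.e a y ∈ _
      rw [this, zero_smul]
      exact Submodule.zero_mem _
  · filter_upwards [h1] with y hy
    rw [hy]
    exact one_smul ℝ _

/-- The hypothesis on brackets concerns global sections; cut-off extensions of the frame fields have
the same germ at `x`, and the bracket is local. -/
theorem bracket_mem [T2Space M] (hx : x ∈ A.N) (a b : Fin n) :
    VectorField.mlieBracket (𝓡 n) (A.e a) (A.e b) x ∈ (F.flag x).H (A.w a + A.w b) := by
  obtain ⟨X, hX, hX1, hX2⟩ := A.exists_extension hx a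
  obtain ⟨Y, hY, hY1, hY2⟩ := A.exists_extension hx b
  rw [← mlieBracket_congr hX2 hY2]
  exact F.bracket_mem _ _ X Y hX hY (fun y => hX1 y _ le_rfl) (fun y => hY1 y _ le_rfl) x

/-- The structure function `⟨e_c, [e_a, e_b]⟩`. -/
def structureFun (a b c : Fin n) (y : M) : ℝ :=
  inner ℝ (A.e c y) (VectorField.mlieBracket (𝓡 n) (A.e a) (A.e b) y)

theorem structureFun_of_lt [T2Space M] (hx : x ∈ A.N) {a b c : Fin n} (h : A.w a + A.w b < A.w c) :
    A.structureFun a b c x = 0 :=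
  (A.mem_H_iff hx).mp (A.bracket_mem hx a b) c h

theorem structureFun_skew (a b c : Fin n) (y : M) :
    A.structureFun a b c y = -A.structureFun b a c y := by
  rw [structureFun, VectorField.mlieBracket_swap_apply, inner_neg_right]
  rfl

theorem contMDiffAt_structureFun (hx : x ∈ A.N) (a b c : Fin n) :
    ContMDiffAt (𝓡 n) 𝓘(ℝ, ℝ) ∞ (A.structureFun a b c) x :=
  SmoothFieldAt.inner (A.smooth c x hx)
    (smoothFieldAt_mlieBracket (A.smooth a x hx) (A.smooth b x hx))

/-- Near `x` the field `X` is a combination of the `e_a` with `a ≠ c`. The terms where the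
coefficients are differentiated are multiples of these `e_a`, hence orthogonal to `e_c`. -/
theorem inner_bracket_left (hx : x ∈ A.N) {X : ∀ y : M, TangentSpace (𝓡 n) y}
    (W : ∀ y : M, TangentSpace (𝓡 n) y) (hX : SmoothFieldAt X x) {c : Fin n}
    (hc : ∀ᶠ y in nhds x, (inner ℝ (A.e c y) (X y) : ℝ) = 0) :
    (inner ℝ (A.e c x) (VectorField.mlieBracket (𝓡 n) X W x) : ℝ) =
      ∑ a, inner ℝ (A.e a x) (X x) *
        inner ℝ (A.e c x) (VectorField.mlieBracket (𝓡 n) (A.e a) W x) := by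
  classical
  have h1 : ∀ᶠ y in nhds x, X y = ∑ a ∈ Finset.univ.erase c, (inner ℝ (A.e a y) (X y) : ℝ) • A.e a y := by
    filter_upwards [hc, A.eventually_mem hx] with y hy hyN
    refine (A.sum_inner_smul hyN (X y)).symm.trans ?_
    rw [← Finset.add_sum_erase _ _ (Finset.mem_univ c), hy, zero_smul, zero_add]
  obtain ⟨g, hg⟩ := exists_mlieBracket_sum_smul (Finset.univ.erase c)
    (f := fun a y => (inner ℝ (A.e a y) (X y) : ℝ)) (E := A.e) W (x := x)
    (fun a _ => (A.smooth a x hx).inner hX) (fun a _ => A.smooth a x hx)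
  rw [mlieBracket_congr h1 (Filter.Eventually.of_forall fun y => rfl : ∀ᶠ y in nhds x, W y = W y), hg, inner_sum, ← Finset.add_sum_erase _ _ (Finset.mem_univ c), hc.self_of_nhds, zero_mul, zero_add]
  refine Finset.sum_congr rfl fun a ha => ?_
  rw [inner_add_right, real_inner_smul_right, real_inner_smul_right, A.inner_eq hx,
    if_neg (Finset.ne_of_mem_erase ha).symm, mul_zero, add_zero]

/-- Under these vanishing conditions the `e_c` component of a bracket depends only on the values of
the fields at `x`. This is the reason why the osculating bracket is well defined. -/
theorem inner_bracket (hx : x ∈ A.N) {X Y : ∀ y : M, TangentSpace (𝓡 n) y}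
    (hX : SmoothFieldAt X x) (hY : SmoothFieldAt Y x) {c : Fin n}
    (hXc : ∀ᶠ y in nhds x, (inner ℝ (A.e c y) (X y) : ℝ) = 0)
    (hYc : ∀ᶠ y in nhds x, (inner ℝ (A.e c y) (Y y) : ℝ) = 0) :
    (inner ℝ (A.e c x) (VectorField.mlieBracket (𝓡 n) X Y x) : ℝ) =
      ∑ a, ∑ b, inner ℝ (A.e a x) (X x) * inner ℝ (A.e b x) (Y x) * A.structureFun a b c x := by
  rw [A.inner_bracket_left hx Y hX hXc]
  refine Finset.sum_congr rfl fun a _ => ?_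
  rw [VectorField.mlieBracket_swap_apply, inner_neg_right, A.inner_bracket_left hx (A.e a) hY hYc,
    ← Finset.sum_neg_distrib, Finset.mul_sum]
  refine Finset.sum_congr rfl fun b _ => ?_
  rw [A.structureFun_skew a b, structureFun]
  ring

end OrthoFrame

end Bracket

/-! ### Classes in the graded space through the orthogonal gradation -/

namespace FiniteFlag

variable {V : Type*} [NormedAddCommGroup V] [InnerProductSpace ℝ V] [FiniteDimensional ℝ V]
  (A : FiniteFlag V)

theorem grEquiv_symbol_mem (i : ℕ) (v : V) (hv : v ∈ A.H (i + 1)) :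
    A.grEquiv (A.symbol i v hv) ∈ A.H (i + 1) := by
  have h1 : A.grEquiv (A.symbol i v hv) = _ := A.grMap_ofQuotient i ((A.below i).mkQ ⟨v, hv⟩)
  rw [h1]
  exact (A.grPart i ((A.below i).mkQ ⟨v, hv⟩) : A.H (i + 1)).2

theorem sub_grEquiv_symbol_mem (i : ℕ) (v : V) (hv : v ∈ A.H (i + 1)) :
    v - A.grEquiv (A.symbol i v hv) ∈ A.H i := by
  have h1 : A.grEquiv (A.symbol i v hv) = _ := A.grMap_ofQuotient i ((A.below i).mkQ ⟨v, hv⟩)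
  have h2 : (⟨v, hv⟩ : A.H (i + 1)) -
      (A.grPart i ((A.below i).mkQ ⟨v, hv⟩) : A.H (i + 1)) ∈ A.below i := by
    rw [← Submodule.Quotient.mk_eq_zero, Submodule.Quotient.mk_sub, sub_eq_zero]
    exact (Submodule.mk_quotientEquivOfIsCompl_apply _ _).symm
  rw [h1]
  exact h2

theorem inner_grEquiv_symbol (i : ℕ) (v : V) (hv : v ∈ A.H (i + 1)) {u : V} (hu : u ∈ A.H i) :
    (inner ℝ u (A.grEquiv (A.symbol i v hv)) : ℝ) = 0 := by
  have h1 : A.grEquiv (A.symbol i v hv) = _ := A.grMap_ofQuotient i ((A.below i).mkQ ⟨v, hv⟩)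
  have h2 := (A.grPart i ((A.below i).mkQ ⟨v, hv⟩)).2
  rw [Submodule.mem_orthogonal] at h2
  rw [h1]
  exact h2 ⟨u, A.mono (Nat.le_succ i) hu⟩ hu

end FiniteFlag

/-! ### The osculating bracket in an adapted frame -/

section Osculating

variable {n : ℕ} {M : Type*} [TopologicalSpace M] [T2Space M] [ChartedSpace (ModelSpace n) M]
  [IsManifold (𝓡 n) ∞ M] [RiemannianBundle (fun x : M => TangentSpace (𝓡 n) x)]
  [IsContMDiffRiemannianBundle (𝓡 n) ∞ (EuclideanSpace ℝ (Fin n)) (fun x : M => TangentSpace (𝓡 n) x)]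
  {F : ManifoldFiltration n M}

namespace OrthoFrame

variable (A : OrthoFrame F) {x : M}

/-- The quotient kills components of weight at most `i`, and membership in `H (i + 1)` excludes
those above `i + 1`. So exactly the components of weight `i + 1` survive. -/
theorem inner_symbol (hx : x ∈ A.N) (i : ℕ) (v : TangentSpace (𝓡 n) x)
    (hv : v ∈ (F.flag x).H (i + 1)) (c : Fin n) :
    (inner ℝ (A.e c x) ((F.flag x).grEquiv ((F.flag x).symbol i v hv)) : ℝ) =
      if A.w c = i + 1 then inner ℝ (A.e c x) v else 0 := by
  split_ifs with h
  · have h1 := (A.mem_H_iff hx).mp ((F.flag x).sub_grEquiv_symbol_mem i v hv) c (by omega)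
    rw [inner_sub_right, sub_eq_zero] at h1
    exact h1.symm
  · rcases lt_or_gt_of_ne h with h | h
    · exact (F.flag x).inner_grEquiv_symbol i v hv (A.e_mem hx c (by omega))
    · exact (A.mem_H_iff hx).mp ((F.flag x).grEquiv_symbol_mem i v hv) c h

/-- The bracket of the osculating algebra, in terms of the structure functions. -/
def gradedBracket (hx : x ∈ A.N) :
    TangentSpace (𝓡 n) x →ₗ[ℝ] TangentSpace (𝓡 n) x →ₗ[ℝ] TangentSpace (𝓡 n) x :=
  (A.basis hx).toBasis.constr ℝ fun a => (A.basis hx).toBasis.constr ℝ fun b =>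
    ∑ c, (if A.w c = A.w a + A.w b then A.structureFun a b c x else 0) • A.e c x

theorem gradedBracket_apply (hx : x ∈ A.N) (a b : Fin n) : A.gradedBracket hx (A.e a x) (A.e b x) =
    ∑ c, (if A.w c = A.w a + A.w b then A.structureFun a b c x else 0) • A.e c x := by
  have h : ∀ a, A.e a x = (A.basis hx).toBasis a := fun a => by
    rw [OrthonormalBasis.coe_toBasis, basis_apply]
  rw [h a, h b, gradedBracket, Basis.constr_basis, Basis.constr_basis]

theorem inner_sum_smul (hx : x ∈ A.N) (g : Fin n → ℝ) (c : Fin n) :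
    (inner ℝ (A.e c x) (∑ a, g a • A.e a x) : ℝ) = g c := by
  rw [inner_sum, Finset.sum_eq_single c]
  · rw [real_inner_smul_right, A.inner_eq hx, if_pos rfl, mul_one]
  · intro b _ hb
    rw [real_inner_smul_right, A.inner_eq hx, if_neg hb.symm, mul_zero]
  · intro h
    exact absurd (Finset.mem_univ c) h

theorem inner_gradedBracket (hx : x ∈ A.N) (u v : TangentSpace (𝓡 n) x) (c : Fin n) :
    (inner ℝ (A.e c x) (A.gradedBracket hx u v) : ℝ) = ∑ a, ∑ b,
      inner ℝ (A.e a x) u * inner ℝ (A.e b x) v *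
        (if A.w c = A.w a + A.w b then A.structureFun a b c x else 0) := by
  conv_lhs => rw [← A.sum_inner_smul hx u, ← A.sum_inner_smul hx v]
  rw [map_sum (A.gradedBracket hx), LinearMap.sum_apply, inner_sum]
  refine Finset.sum_congr rfl fun a _ => ?_
  rw [map_sum, inner_sum]
  refine Finset.sum_congr rfl fun b _ => ?_
  rw [map_smul, map_smul, LinearMap.smul_apply, gradedBracket_apply, real_inner_smul_right,
    real_inner_smul_right, A.inner_sum_smul hx]
  ring

/-- Compare components along an `e_c` of weight `i + j + 2`. In the bilinear expression for `[X,
Y]`, a pair `(a, b)` with `w a > i + 1` or `w b > j + 1` has a zero coefficient, and one of total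
weight below `w c` has zero structure function. There remain the pairs of weights exactly `i + 1`
and `j + 1`, which are the terms of the graded bracket. -/
theorem isOsculatingBracket (hx : x ∈ A.N) : F.IsOsculatingBracket x
    ((A.gradedBracket hx).compr₂ (F.flag x).grEquiv.symm.toLinearMap |>.compl₁₂
      (F.flag x).grEquiv.toLinearMap (F.flag x).grEquiv.toLinearMap) := by
  intro i j X Y hX hY hXm hYm hXY
  apply (F.flag x).grEquiv.injective
  change (F.flag x).grEquiv ((F.flag x).grEquiv.symm (A.gradedBracket hx ((F.flag x).grEquiv _)
    ((F.flag x).grEquiv _))) = _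
  rw [LinearEquiv.apply_symm_apply]
  refine A.ext_inner hx fun c => ?_
  rw [A.inner_symbol hx, A.inner_gradedBracket hx]
  have hX0 : ∀ y ∈ A.N, ∀ a, i + 1 < A.w a → (inner ℝ (A.e a y) (X y) : ℝ) = 0 := fun y hy a ha =>
    (A.mem_H_iff hy).mp (hXm y) a ha
  have hY0 : ∀ y ∈ A.N, ∀ a, j + 1 < A.w a → (inner ℝ (A.e a y) (Y y) : ℝ) = 0 := fun y hy a ha =>
    (A.mem_H_iff hy).mp (hYm y) a ha
  split_ifs with hc
  · rw [A.inner_bracket hx (hX x) (hY x)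
      (Filter.mem_of_superset (A.eventually_mem hx) fun y hy => hX0 y hy c (by omega))
      (Filter.mem_of_superset (A.eventually_mem hx) fun y hy => hY0 y hy c (by omega))]
    refine Finset.sum_congr rfl fun a _ => Finset.sum_congr rfl fun b _ => ?_
    rw [A.inner_symbol hx, A.inner_symbol hx]
    by_cases ha : A.w a = i + 1
    · by_cases hb : A.w b = j + 1
      · rw [if_pos ha, if_pos hb, if_pos (by omega)]
      · rw [if_neg hb, mul_zero, zero_mul]
        rcases lt_or_gt_of_ne hb with h | h
        · rw [A.structureFun_of_lt hx (by omega), mul_zero]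
        · rw [hY0 x hx b h, mul_zero, zero_mul]
    · rw [if_neg ha, zero_mul, zero_mul]
      rcases lt_or_gt_of_ne ha with h | h
      · by_cases hb : j + 1 < A.w b
        · rw [hY0 x hx b hb, mul_zero, zero_mul]
        · rw [A.structureFun_of_lt hx (by omega), mul_zero]
      · rw [hX0 x hx a h, zero_mul, zero_mul]
  · refine Finset.sum_eq_zero fun a _ => Finset.sum_eq_zero fun b _ => ?_
    rw [A.inner_symbol hx, A.inner_symbol hx]
    split_ifs <;> first | omega | simp

end OrthoFrame

/-- A bracket with the required property exists, so the choice in `osculatingBracket` is not its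
default value `0`. -/
theorem isOsculatingBracket_osculatingBracket (F : ManifoldFiltration n M) (x : M) :
    F.IsOsculatingBracket x (F.osculatingBracket x) := by
  obtain ⟨A, hx⟩ := exists_orthoFrame F x
  have h : ∃ B, F.IsOsculatingBracket x B := ⟨_, A.isOsculatingBracket hx⟩
  rw [ManifoldFiltration.osculatingBracket, dif_pos h]
  exact h.choose_spec

/-- The osculating bracket at `x`, transported to the tangent space. -/
def ManifoldFiltration.tangentBracket (F : ManifoldFiltration n M) (x : M) :
    TangentSpace (𝓡 n) x →ₗ[ℝ] TangentSpace (𝓡 n) x →ₗ[ℝ] TangentSpace (𝓡 n) x :=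
  (F.flag x).flatBracket (F.osculatingBracket x)

namespace OrthoFrame

variable (A : OrthoFrame F) {x : M}

/-- Frame vectors at `x` are values of global sections of the right weight, so the defining property
determines the bracket on them. This gives the bracket by explicit smooth structure functions. -/
theorem tangentBracket_eq (hx : x ∈ A.N) : F.tangentBracket x = A.gradedBracket hx := by
  refine (A.basis hx).toBasis.ext fun a => (A.basis hx).toBasis.ext fun b => ?_
  rw [OrthonormalBasis.coe_toBasis, basis_apply, basis_apply, gradedBracket_apply]
  -- Frame weights are at least `1` because `H 0 = 0`; the graded summand of index `i` has weight `i
  -- + 1`.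
  obtain ⟨i, hi⟩ := Nat.exists_eq_add_of_le' (A.w_pos hx a)
  obtain ⟨j, hj⟩ := Nat.exists_eq_add_of_le' (A.w_pos hx b)
  obtain ⟨X, hX, hX1, hX2⟩ := A.exists_extension hx a
  obtain ⟨Y, hY, hY1, hY2⟩ := A.exists_extension hx b
  have hXm : ∀ y, X y ∈ (F.flag y).H (i + 1) := fun y => hX1 y _ hi.le
  have hYm : ∀ y, Y y ∈ (F.flag y).H (j + 1) := fun y => hY1 y _ hj.le
  have hXY : VectorField.mlieBracket (𝓡 n) X Y x ∈ (F.flag x).H (i + j + 1 + 1) := by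
    have := F.bracket_mem (i + 1) (j + 1) X Y hX hY hXm hYm x
    rwa [show i + 1 + (j + 1) = i + j + 1 + 1 by ring] at this
  have hs : ∀ (a : Fin n) (i : ℕ) (Z : TangentSpace (𝓡 n) x) (hZ : Z ∈ (F.flag x).H (i + 1)),
      A.w a = i + 1 → Z = A.e a x →
      (F.flag x).grEquiv.symm (A.e a x) = (F.flag x).symbol i Z hZ := by
    rintro a i _ hZ ha rfl
    rw [LinearEquiv.symm_apply_eq]
    refine A.ext_inner hx fun c => ?_
    rw [A.inner_symbol hx, A.inner_eq hx]
    split_ifs with h1 h2 h2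
    · rfl
    · exact absurd (h1 ▸ ha) h2
    · rfl
    · rfl
  have h := isOsculatingBracket_osculatingBracket F x i j X Y hX hY hXm hYm hXY
  rw [ManifoldFiltration.tangentBracket, FiniteFlag.flatBracket_apply,
    hs a i (X x) (hXm x) hi hX2.self_of_nhds, hs b j (Y x) (hYm x) hj hY2.self_of_nhds, h]
  refine A.ext_inner hx fun c => ?_
  rw [A.inner_symbol hx, A.inner_sum_smul hx, mlieBracket_congr hX2 hY2]
  have : A.w a + A.w b = i + j + 1 + 1 := by omega
  rw [this]
  rfl

theorem tangentBracket_apply (hx : x ∈ A.N) (a b : Fin n) :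
    F.tangentBracket x (A.e a x) (A.e b x) =
      ∑ c, (if A.w c = A.w a + A.w b then A.structureFun a b c x else 0) • A.e c x := by
  rw [A.tangentBracket_eq hx, gradedBracket_apply]

theorem dilation_tangentBracket (hx : x ∈ A.N) (a b : Fin n) :
    dilation (A.basis hx) A.w (F.tangentBracket x (A.basis hx a) (A.basis hx b)) =
      (2 : ℝ) ^ (A.w a + A.w b) • F.tangentBracket x (A.basis hx a) (A.basis hx b) := by
  simp only [basis_apply, A.tangentBracket_apply hx, map_sum, Finset.smul_sum]
  refine Finset.sum_congr rfl fun c _ => ?_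
  rw [map_smul, ← A.basis_apply hx c, dilation_apply]
  split_ifs with h
  · rw [h, smul_comm]
  · rw [zero_smul, zero_smul, smul_zero]

end OrthoFrame

theorem tangentBracket_skew (F : ManifoldFiltration n M) (x : M) (u v : TangentSpace (𝓡 n) x) :
    F.tangentBracket x u v = -F.tangentBracket x v u := by
  obtain ⟨A, hx⟩ := exists_orthoFrame F x
  rw [A.tangentBracket_eq hx]
  refine A.ext_inner hx fun c => ?_
  rw [inner_neg_right, A.inner_gradedBracket hx, A.inner_gradedBracket hx, Finset.sum_comm,
    ← Finset.sum_neg_distrib]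
  refine Finset.sum_congr rfl fun a _ => ?_
  rw [← Finset.sum_neg_distrib]
  refine Finset.sum_congr rfl fun b _ => ?_
  rw [add_comm (A.w b), A.structureFun_skew b a]
  split_ifs <;> ring

end Osculating

/-! ### Cartan's formula on manifolds -/

section Cartan

variable {n : ℕ} {M : Type*} [TopologicalSpace M] [ChartedSpace (ModelSpace n) M]
  [IsManifold (𝓡 n) ∞ M]

theorem mfderiv_chart_mlieBracket (X Y : ∀ y : M, TangentSpace (𝓡 n) y) (x : M) :
    mfderiv (𝓡 n) 𝓘(ℝ, ModelSpace n) (extChartAt (𝓡 n) x) x (VectorField.mlieBracket (𝓡 n) X Y x) =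
      VectorField.lieBracket ℝ (chartField x X) (chartField x Y) (extChartAt (𝓡 n) x x) := by
  have hx := mem_extChartAt_target (I := 𝓡 n) x
  have hopen := (isOpen_extChartAt_target (I := 𝓡 n) x).mem_nhds hx
  have hX : ∀ Z : ∀ y : M, TangentSpace (𝓡 n) y,
      VectorField.mpullbackWithin 𝓘(ℝ, ModelSpace n) (𝓡 n) (extChartAt (𝓡 n) x).symm Z
        (Set.range (𝓡 n)) =ᶠ[nhds (extChartAt (𝓡 n) x x)] chartField x Z := fun Z => by
    filter_upwards [hopen] with u hu
    rw [chartField_eq_mpullback x Z hu, ModelWithCorners.range_eq_univ,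
      VectorField.mpullbackWithin_univ]
  have h1 : VectorField.mlieBracket (𝓡 n) X Y x =
      (mfderiv (𝓡 n) 𝓘(ℝ, ModelSpace n) (extChartAt (𝓡 n) x) x).inverse
        (VectorField.lieBracket ℝ (chartField x X) (chartField x Y) (extChartAt (𝓡 n) x x)) := by
    rw [← VectorField.mlieBracketWithin_univ, VectorField.mlieBracketWithin_apply]
    congr 1
    have key : ∀ (V W V' W' : ModelSpace n → ModelSpace n) (s : Set (ModelSpace n)) (p : ModelSpace n),
        s = Set.univ → V =ᶠ[nhds p] V' → W =ᶠ[nhds p] W' →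
        VectorField.lieBracketWithin ℝ V W s p = VectorField.lieBracket ℝ V' W' p := by
      rintro V W V' W' s p rfl h h'
      rw [VectorField.lieBracketWithin_univ, h.lieBracket_vectorField_eq h']
    exact key _ _ _ _ _ _ (by simp) (hX X) (hX Y)
  have h2 := mfderiv_chart_comp_symm x hx
  have h3 := mfderiv_symm_comp_chart x hx
  rw [extChartAt_to_inv] at h2 h3
  have h4 : (mfderiv (𝓡 n) 𝓘(ℝ, ModelSpace n) (extChartAt (𝓡 n) x) x).inverse = _ :=
    ContinuousLinearMap.inverse_eq h2 h3
  rw [h1, h4]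
  exact DFunLike.congr_fun h2 _

/-- Cartan's formula for the exterior derivative. -/
theorem exteriorD_apply_vectorField {ψ : FieldOfForms n M} {x : M} {k : ℕ}
    (hψ : ContDiffAt ℝ ∞ (chartRep x ψ (k + 1)) (extChartAt (𝓡 n) x x))
    {X : Fin (k + 2) → ∀ y : M, TangentSpace (𝓡 n) y} (hX : ∀ i, SmoothFieldAt (X i) x)
    (h0 : ∀ i : Fin (k + 2), ∀ᶠ y in nhds x, ψ y (k + 1) (i.removeNth fun l => X l y) = 0) :
    exteriorD ψ x (k + 2) (fun l => X l x) = ∑ i : Fin (k + 1), ∑ j ≥ i,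
      (-1 : ℝ) ^ ((i.castSucc : ℕ) + (j.succ : ℕ)) *
        ψ x (k + 1) (Matrix.vecCons (VectorField.mlieBracket (𝓡 n) (X i.castSucc) (X j.succ) x)
          (j.removeNth (i.castSucc.removeNth fun l => X l x))) := by
  have hx := mem_extChartAt_target (I := 𝓡 n) x
  have hV : ∀ i, DifferentiableAt ℝ (chartField x (X i)) (extChartAt (𝓡 n) x x) := fun i =>
    (contDiffAt_chartField x hx (by rw [extChartAt_to_inv]; exact hX i)).differentiableAt (by simp)
  have h1 := extDeriv_apply_vectorField (hψ.differentiableAt (by simp)) hV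
  have h2 : ∀ Z : ∀ y : M, TangentSpace (𝓡 n) y, chartField x Z (extChartAt (𝓡 n) x x) =
      mfderiv (𝓡 n) 𝓘(ℝ, ModelSpace n) (extChartAt (𝓡 n) x) x (Z x) := fun Z => by
    have key : ∀ y : M, y = x → (mfderiv (𝓡 n) 𝓘(ℝ, ModelSpace n) (extChartAt (𝓡 n) x) y (Z y) :
        ModelSpace n) = mfderiv (𝓡 n) 𝓘(ℝ, ModelSpace n) (extChartAt (𝓡 n) x) x (Z x) := by
      rintro y rfl; rfl
    exact key _ (extChartAt_to_inv x)
  have h3 : exteriorD ψ x (k + 2) (fun l => X l x) = extDeriv (chartRep x ψ (k + 1))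
      (extChartAt (𝓡 n) x x) (fun l => chartField x (X l) (extChartAt (𝓡 n) x x)) := by
    rw [exteriorD_succ, chartPullback_apply]
    congr 1
    funext l
    exact (h2 (X l)).symm
  -- By `h0` the functions to be differentiated vanish near `x`, so Cartan's formula keeps only its
  -- bracket terms. Only this case is needed.
  rw [h3, h1, Finset.sum_eq_zero, zero_sub, ← Finset.sum_neg_distrib]
  · refine Finset.sum_congr rfl fun i _ => ?_
    rw [← Finset.sum_neg_distrib]
    refine Finset.sum_congr rfl fun j _ => ?_
    rw [← chartRep_self x ψ (k + 1)]
    have h5 : (fun l => mfderiv (𝓡 n) 𝓘(ℝ, ModelSpace n) (extChartAt (𝓡 n) x) x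
        ((Matrix.vecCons (VectorField.mlieBracket (𝓡 n) (X i.castSucc) (X j.succ) x)
          (j.removeNth (i.castSucc.removeNth fun l => X l x)) : Fin (k + 1) → TangentSpace (𝓡 n) x) l)) =
        Matrix.vecCons (VectorField.lieBracket ℝ (chartField x (X i.castSucc))
          (chartField x (X j.succ)) (extChartAt (𝓡 n) x x))
          (j.removeNth (i.castSucc.removeNth fun l => chartField x (X l) (extChartAt (𝓡 n) x x))) := by
      funext l
      refine Fin.cases ?_ (fun l => ?_) l
      · exact mfderiv_chart_mlieBracket _ _ _
      · exact (h2 _).symm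
    rw [h5]
    simp only [Fin.val_castSucc, Fin.val_succ]
    ring
  · intro i _
    have h6 : (fun u => chartRep x ψ (k + 1) u (i.removeNth fun l => chartField x (X l) u))
        =ᶠ[nhds (extChartAt (𝓡 n) x x)] fun _ => (0 : ℝ) := by
      have hc : Filter.Tendsto (extChartAt (𝓡 n) x).symm (nhds (extChartAt (𝓡 n) x x)) (nhds x) := by
        have := continuousAt_extChartAt_symm (I := 𝓡 n) x
        rwa [ContinuousAt, extChartAt_to_inv] at this
      filter_upwards [(isOpen_extChartAt_target (I := 𝓡 n) x).mem_nhds hx, hc.eventually (h0 i)]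
        with u hu hu0
      exact (chartRep_chartField x ψ (k + 1) hu (fun l => X (i.succAbove l))).trans hu0
    rw [h6.fderiv_eq]
    simp

theorem exteriorD_one_eq_zero {ψ : FieldOfForms n M} {x : M} (h0 : ∀ᶠ y in nhds x, ψ y 0 = 0) :
    exteriorD ψ x 1 = 0 := by
  have hx := mem_extChartAt_target (I := 𝓡 n) x
  have h1 : chartRep x ψ 0 =ᶠ[nhds (extChartAt (𝓡 n) x x)] fun _ => 0 := by
    have hc : Filter.Tendsto (extChartAt (𝓡 n) x).symm (nhds (extChartAt (𝓡 n) x x)) (nhds x) := by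
      have := continuousAt_extChartAt_symm (I := 𝓡 n) x
      rwa [ContinuousAt, extChartAt_to_inv] at this
    filter_upwards [hc.eventually h0] with u hu
    ext v
    rw [chartRep_apply, hu]
    rfl
  have h2 : extDeriv (chartRep x ψ 0) (extChartAt (𝓡 n) x x) = 0 := by
    ext v
    rw [extDeriv, h1.fderiv_eq, fderiv_const_apply, ContinuousAlternatingMap.alternatizeUncurryFin_apply]
    simp
  rw [exteriorD_succ, h2, map_zero]

end Cartan

/-! ### The weight filtration and the leading part of `d` -/

section WeightFiltration

variable {n : ℕ} {M : Type*} [TopologicalSpace M] [ChartedSpace (ModelSpace n) M]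
  [IsManifold (𝓡 n) ∞ M]

/-- The forms vanishing on all families of vectors of total weight less than `p`. -/
def ManifoldFiltration.weightFilt (F : ManifoldFiltration n M) (x : M) (p k : ℕ) :
    Submodule ℝ ((TangentSpace (𝓡 n) x) [⋀^Fin k]→ₗ[ℝ] ℝ) where
  carrier := {α | ∀ (m : Fin k → ℕ) (v : Fin k → TangentSpace (𝓡 n) x),
    (∀ i, v i ∈ (F.flag x).H (m i)) → ∑ i, m i < p → α v = 0}
  add_mem' hα hβ m v hv hm := by simp [hα m v hv hm, hβ m v hv hm]
  zero_mem' _ _ _ _ := rfl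
  smul_mem' c α hα m v hv hm := by simp [hα m v hv hm]

variable [RiemannianBundle (fun x : M => TangentSpace (𝓡 n) x)]
  [IsContMDiffRiemannianBundle (𝓡 n) ∞ (EuclideanSpace ℝ (Fin n)) (fun x : M => TangentSpace (𝓡 n) x)]
  {F : ManifoldFiltration n M}

namespace OrthoFrame

variable (A : OrthoFrame F) {x : M}

/-- The intrinsic filtration does not depend on a frame, whereas the dilations do. This equality
lets the dilation arguments be applied one point at a time. -/
theorem weightFilt_eq (hx : x ∈ A.N) (p k : ℕ) :
    F.weightFilt x p k = weightGE (A.basis hx) A.w k p := by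
  ext α
  constructor
  · intro h I hI
    refine h (fun i => A.w (I i)) _ (fun i => ?_) hI
    rw [basis_apply]
    exact A.e_mem hx (I i) le_rfl
  · intro h m v hv hm
    have h1 : v = fun i => ∑ a, (inner ℝ (A.e a x) (v i) : ℝ) • A.e a x :=
      funext fun i => (A.sum_inner_smul hx (v i)).symm
    rw [h1, alternatingMap_apply_sum_basis α (fun i a => (inner ℝ (A.e a x) (v i) : ℝ))]
    refine Finset.sum_eq_zero fun r _ => ?_
    by_cases hr : ∀ i, A.w (r i) ≤ m i
    · have h2 := h r (lt_of_le_of_lt (Finset.sum_le_sum fun i _ => hr i) hm)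
      simp only [basis_apply] at h2
      rw [h2, mul_zero]
    · push Not at hr
      obtain ⟨i, hi⟩ := hr
      rw [Finset.prod_eq_zero (Finset.mem_univ i) ((A.mem_H_iff hx).mp (hv i) _ hi), zero_mul]

theorem mem_weightFilt_iff (hx : x ∈ A.N) {p k : ℕ} {α : (TangentSpace (𝓡 n) x) [⋀^Fin k]→ₗ[ℝ] ℝ} :
    α ∈ F.weightFilt x p k ↔
      ∀ I : Fin k → Fin n, ∑ i, A.w (I i) < p → α (fun i => A.e (I i) x) = 0 := by
  rw [A.weightFilt_eq hx]
  change (∀ I : Fin k → Fin n, _ → _) ↔ _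
  simp only [basis_apply]

theorem apply_mem_weightFilt (hx : x ∈ A.N) {k l : ℕ}
    (f : ((TangentSpace (𝓡 n) x) [⋀^Fin k]→ₗ[ℝ] ℝ) →ₗ[ℝ] ((TangentSpace (𝓡 n) x) [⋀^Fin l]→ₗ[ℝ] ℝ))
    (hf : ∀ α, f (altDilation (A.basis hx) A.w k α) = altDilation (A.basis hx) A.w l (f α)) {p : ℕ}
    {α : (TangentSpace (𝓡 n) x) [⋀^Fin k]→ₗ[ℝ] ℝ} (hα : α ∈ F.weightFilt x p k) :
    f α ∈ F.weightFilt x p l := by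
  rw [A.weightFilt_eq hx] at hα ⊢
  exact apply_mem_weightGE (A.basis hx) A.w f hf hα

end OrthoFrame

theorem weightFilt_zero (F : ManifoldFiltration n M) (x : M) (k : ℕ) : F.weightFilt x 0 k = ⊤ :=
  eq_top_iff.mpr fun _ _ _ _ _ h => absurd h (Nat.not_lt_zero _)

/-- Forms of degree larger than the dimension vanish. -/
theorem altForm_eq_zero_of_lt {x : M} {k : ℕ} (hk : n < k) (α : (TangentSpace (𝓡 n) x) [⋀^Fin k]→ₗ[ℝ] ℝ) :
    α = 0 := by
  ext v
  refine α.map_linearDependent v fun h => ?_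
  have h1 := h.fintype_card_le_finrank
  rw [Fintype.card_fin] at h1
  have h2 : finrank ℝ (TangentSpace (𝓡 n) x) = n := finrank_euclideanSpace_fin (𝕜 := ℝ) (n := n)
  omega

/-- A nonzero form has degree at most `n`, and every tangent vector lies in `H step`. Hence no
nonzero form has weight above `n * step`, which bounds the orders of nilpotency. -/
theorem weightFilt_eq_bot (F : ManifoldFiltration n M) (x : M) (k : ℕ) {p : ℕ}
    (hp : n * F.step < p) : F.weightFilt x p k = ⊥ := by
  refine eq_bot_iff.mpr fun α hα => ?_
  rw [Submodule.mem_bot]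
  by_cases hk : n < k
  · exact altForm_eq_zero_of_lt hk α
  · ext v
    refine hα (fun _ => F.step) v (fun i => ?_) ?_
    · rw [F.flag_step]; exact Submodule.mem_top
    · simp only [Finset.sum_const, Finset.card_univ, Fintype.card_fin, smul_eq_mul]
      exact lt_of_le_of_lt (Nat.mul_le_mul_right _ (not_lt.mp hk)) hp

variable [T2Space M]

namespace OrthoFrame

variable (A : OrthoFrame F) {x : M}

theorem mlieBracket_sub_tangentBracket_mem (hx : x ∈ A.N) {a b : Fin n} {q : ℕ}
    (hq : A.w a + A.w b = q + 1) :
    VectorField.mlieBracket (𝓡 n) (A.e a) (A.e b) x - F.tangentBracket x (A.e a x) (A.e b x) ∈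
      (F.flag x).H q := by
  rw [A.mem_H_iff hx]
  intro c hc
  rw [inner_sub_right, A.tangentBracket_apply hx, A.inner_sum_smul hx, sub_eq_zero]
  change A.structureFun a b c x = _
  split_ifs with h
  · rfl
  · exact A.structureFun_of_lt hx (by omega)

/-- The operator `d - d₀` increases the weight. -/
theorem exteriorD_sub_mem (hx : x ∈ A.N) {ψ : FieldOfForms n M} {p k : ℕ}
    (hψ : ContDiffAt ℝ ∞ (chartRep x ψ k) (extChartAt (𝓡 n) x x))
    (hp : ∀ᶠ y in nhds x, ψ y k ∈ F.weightFilt y p k) :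
    exteriorD ψ x (k + 1) - ceDifferential (F.tangentBracket x) k (ψ x k) ∈
      F.weightFilt x (p + 1) (k + 1) := by
  rw [A.mem_weightFilt_iff hx]
  intro I hI
  rw [AlternatingMap.sub_apply, sub_eq_zero]
  cases k with
  | zero =>
    -- The test vector has weight at least `1` and less than `p + 1`, so `p ≥ 1`; a function of
    -- positive weight is zero.
    have h0 : ∀ᶠ y in nhds x, ψ y 0 = 0 := by
      filter_upwards [hp] with y hy
      ext v
      refine hy (fun _ => 0) v (fun i => i.elim0) ?_
      have := A.w_pos hx (I 0)
      rw [Fin.sum_univ_one] at hI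
      simp only [Finset.univ_eq_empty, Finset.sum_empty]
      omega
    rw [exteriorD_one_eq_zero h0]
    rfl
  | succ k =>
    have hsum : ∀ i : Fin (k + 2), A.w (I i) + ∑ l, A.w (I (i.succAbove l)) = ∑ l, A.w (I l) :=
      fun i => (Fin.sum_univ_succAbove (fun l => A.w (I l)) i).symm
    -- Both sides are evaluated on frame fields of total weight at most `p`. Omitting one field, of
    -- weight at least `1`, brings the total below `p`, so the derivative terms of Cartan's formula
    -- vanish near `x`.
    rw [exteriorD_apply_vectorField (X := fun l => A.e (I l)) hψ (fun l => A.smooth (I l) x hx)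
      (fun i => ?_), ceDifferential_apply _ (tangentBracket_skew F x)]
    · refine Finset.sum_congr rfl fun i _ => Finset.sum_congr rfl fun j hj => ?_
      congr 1
      have h1 := A.w_pos hx (I i.castSucc)
      have h2 : 0 < A.w (I i.castSucc) + A.w (I j.succ) := by omega
      obtain ⟨q, hq⟩ := Nat.exists_eq_add_of_le' h2
      have hmem := A.mlieBracket_sub_tangentBracket_mem hx hq
      -- Replacing the Lie bracket by the osculating one costs a vector of weight `w a + w b - 1`.
      -- With the remaining fields the total weight is below `p`, so `ψ` does not see the
      -- difference.
      have hw := hp.self_of_nhds (Fin.cons q fun l => A.w (I (i.castSucc.succAbove (j.succAbove l))))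
        (Matrix.vecCons (VectorField.mlieBracket (𝓡 n) (A.e (I i.castSucc)) (A.e (I j.succ)) x -
          F.tangentBracket x (A.e (I i.castSucc) x) (A.e (I j.succ) x))
          (j.removeNth (i.castSucc.removeNth fun l => A.e (I l) x))) (fun l => ?_) ?_
      · have h3 : ∀ (α : (TangentSpace (𝓡 n) x) [⋀^Fin (k + 1)]→ₗ[ℝ] ℝ) (u v : TangentSpace (𝓡 n) x)
            (r : Fin k → TangentSpace (𝓡 n) x), α (Matrix.vecCons (u - v) r) =
            α (Matrix.vecCons u r) - α (Matrix.vecCons v r) := fun α u v r => by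
          have := congrArg (fun f : (TangentSpace (𝓡 n) x) [⋀^Fin k]→ₗ[ℝ] ℝ => f r)
            (α.curryLeft.map_sub u v)
          exact this
        rw [h3, sub_eq_zero] at hw
        exact hw
      · refine Fin.cases ?_ (fun l => ?_) l
        · exact hmem
        · exact A.e_mem hx _ le_rfl
      · rw [Fin.sum_univ_succ]
        simp only [Fin.cons_zero, Fin.cons_succ]
        have h4 := hsum i.castSucc
        have h5 := Fin.sum_univ_succAbove (fun l => A.w (I (i.castSucc.succAbove l))) j
        rw [Fin.succAbove_castSucc_of_le i j (Finset.mem_Ici.mp hj)] at h5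
        omega
    · filter_upwards [hp, A.eventually_mem hx] with y hy hyN
      refine hy (fun l => A.w (I (i.succAbove l))) _ (fun l => A.e_mem hyN _ le_rfl) ?_
      have h1 := A.w_pos hx (I i)
      have h2 := hsum i
      omega

end OrthoFrame

end WeightFiltration

/-! ### Extension of forms and `d₀² = 0` -/

section SquareZero

variable {n : ℕ} {M : Type*} [TopologicalSpace M] [ChartedSpace (ModelSpace n) M]
  [IsManifold (𝓡 n) ∞ M] [RiemannianBundle (fun x : M => TangentSpace (𝓡 n) x)]
  [IsContMDiffRiemannianBundle (𝓡 n) ∞ (EuclideanSpace ℝ (Fin n)) (fun x : M => TangentSpace (𝓡 n) x)]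
  {F : ManifoldFiltration n M} [T2Space M]

namespace OrthoFrame

variable (A : OrthoFrame F) {x : M}

theorem contDiffAt_chartRep_iff {P : Type*} [NormedAddCommGroup P] [NormedSpace ℝ P]
    (x₀ : M) {u : ModelSpace n} (hu : u ∈ (extChartAt (𝓡 n) x₀).target)
    (hx : (extChartAt (𝓡 n) x₀).symm u ∈ A.N) (θ : P → FieldOfForms n M) (k : ℕ) (p : P) :
    ContDiffAt ℝ ∞ (fun q : P × ModelSpace n => chartRep x₀ (θ q.1) k q.2) (p, u) ↔
      ∀ I : Fin k → Fin n, ContDiffAt ℝ ∞ (fun q : P × ModelSpace n =>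
        θ q.1 ((extChartAt (𝓡 n) x₀).symm q.2) k
          (fun i => A.e (I i) ((extChartAt (𝓡 n) x₀).symm q.2))) (p, u) :=
  FilteredRiemannian.contDiffAt_chartRep_iff x₀ hu (fun a => A.smooth a _ hx)
    (A.orthonormal _ hx).linearIndependent θ k p

/-- The transport of forms at `x` to forms at `y`, with the same components in the frame. -/
def transport (x y : M) : TangentSpace (𝓡 n) y →ₗ[ℝ] TangentSpace (𝓡 n) x :=
  ∑ a, (innerSL ℝ (A.e a y)).toLinearMap.smulRight (A.e a x)

theorem transport_apply {y : M} (hy : y ∈ A.N) (b : Fin n) :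
    A.transport x y (A.e b y) = A.e b x := by
  rw [transport, LinearMap.sum_apply, Finset.sum_eq_single b]
  · rw [LinearMap.smulRight_apply]
    change (inner ℝ (A.e b y) (A.e b y) : ℝ) • A.e b x = _
    rw [A.inner_eq hy, if_pos rfl, one_smul]
  · intro a _ ha
    rw [LinearMap.smulRight_apply]
    change (inner ℝ (A.e a y) (A.e b y) : ℝ) • A.e a x = _
    rw [A.inner_eq hy, if_neg ha, zero_smul]
  · intro h
    exact absurd (Finset.mem_univ b) h

/-- Keep the components constant in the frame and multiply by a cutoff. The extension vanishes on
the same frame tuples as the form at `x`, so it has the same weight at all points of the frame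
domain. -/
theorem exists_extension_form (hx : x ∈ A.N) (α : TotalForm (TangentSpace (𝓡 n) x)) :
    ∃ (ψ : FieldOfForms n M) (ρ : M → ℝ), IsSmoothFormOn Set.univ ψ ∧ ρ x = 1 ∧
      ∀ y ∈ A.N, ∀ (k : ℕ) (I : Fin k → Fin n),
        ψ y k (fun i => A.e (I i) y) = ρ y * α k (fun i => A.e (I i) x) := by
  obtain ⟨ρ, hρ, h1, hs⟩ := exists_cutoff (n := n) A.isOpen hx
  let ψ : FieldOfForms n M := fun y k => ρ y • (α k).compLinearMap (A.transport x y)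
  refine ⟨ψ, ρ, ?_, h1.self_of_nhds, ?_⟩
  · refine SmoothFamilyOn.isSmoothFormOn (D := Set.univ) (θ := fun _ => ψ) ?_ (Set.mem_univ 0)
    intro k x₀ u hu _ z _
    by_cases hN : (extChartAt (𝓡 n) x₀).symm u ∈ A.N
    · refine (A.contDiffAt_chartRep_iff x₀ hu hN (fun _ => ψ) k z).mpr fun I => ?_
      have h2 : ContDiffAt ℝ ∞ (fun v => ρ ((extChartAt (𝓡 n) x₀).symm v)) u := by
        rw [← contMDiffAt_iff_contDiffAt]
        exact hρ.contMDiffAt.comp _ ((contMDiffOn_extChartAt_symm (I := 𝓡 n) (n := ∞) x₀).contMDiffAt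
          ((isOpen_extChartAt_target x₀).mem_nhds hu))
      have h3 : ContDiffAt ℝ ∞ (fun q : ℂ × ModelSpace n => ρ ((extChartAt (𝓡 n) x₀).symm q.2) *
          α k (fun i => A.e (I i) x)) (z, u) :=
        (h2.comp (z, u) contDiffAt_snd).mul contDiffAt_const
      refine h3.congr_of_eventuallyEq ?_
      have h4 : ∀ᶠ q in nhds (z, u), q.2 ∈ (extChartAt (𝓡 n) x₀).target ∧
          (extChartAt (𝓡 n) x₀).symm q.2 ∈ A.N :=
        (continuous_snd.tendsto (z, u)).eventually (eventually_mem_charts x₀ hu A.isOpen hN)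
      filter_upwards [h4] with q hq
      change ρ _ * α k (fun i => A.transport x _ (A.e (I i) _)) = _
      simp only [A.transport_apply hq.2]
    · have h4 : ∀ᶠ q in nhds (z, u), q.2 ∈ (extChartAt (𝓡 n) x₀).target ∧
          (extChartAt (𝓡 n) x₀).symm q.2 ∈ (tsupport ρ)ᶜ :=
        (continuous_snd.tendsto (z, u)).eventually (eventually_mem_charts x₀ hu
          (isClosed_tsupport ρ).isOpen_compl fun h => hN (hs h))
      refine (contDiffAt_const (c := 0)).congr_of_eventuallyEq ?_
      filter_upwards [h4] with q hq
      ext v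
      change ρ _ * _ = (0 : ℝ)
      rw [image_eq_zero_of_notMem_tsupport hq.2, zero_mul]
  · intro y hy k I
    change ρ y * α k (fun i => A.transport x y (A.e (I i) y)) = _
    simp only [A.transport_apply hy]

theorem ceDifferential_altDilation (hx : x ∈ A.N) (k : ℕ)
    (α : (TangentSpace (𝓡 n) x) [⋀^Fin k]→ₗ[ℝ] ℝ) :
    ceDifferential (F.tangentBracket x) k (altDilation (A.basis hx) A.w k α) =
      altDilation (A.basis hx) A.w (k + 1) (ceDifferential (F.tangentBracket x) k α) :=
  FilteredRiemannian.ceDifferential_altDilation (A.basis hx) A.w (A.dilation_tangentBracket hx) k α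

theorem ceDifferential_mem (hx : x ∈ A.N) {p k : ℕ} {α : (TangentSpace (𝓡 n) x) [⋀^Fin k]→ₗ[ℝ] ℝ}
    (hα : α ∈ F.weightFilt x p k) :
    ceDifferential (F.tangentBracket x) k α ∈ F.weightFilt x p (k + 1) :=
  A.apply_mem_weightFilt hx _ (A.ceDifferential_altDilation hx k) hα

theorem exteriorD_mem (hx : x ∈ A.N) {ψ : FieldOfForms n M} {p k : ℕ}
    (hψ : ContDiffAt ℝ ∞ (chartRep x ψ k) (extChartAt (𝓡 n) x x))
    (hp : ∀ᶠ y in nhds x, ψ y k ∈ F.weightFilt y p k) :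
    exteriorD ψ x (k + 1) ∈ F.weightFilt x p (k + 1) := by
  have h1 := A.exteriorD_sub_mem hx hψ hp
  have h2 := A.ceDifferential_mem hx hp.self_of_nhds
  have h3 : exteriorD ψ x (k + 1) - ceDifferential (F.tangentBracket x) k (ψ x k) ∈
      F.weightFilt x p (k + 1) := fun m v hv hm => h1 m v hv (hm.trans (Nat.lt_succ_self p))
  simpa using Submodule.add_mem _ h3 h2

end OrthoFrame

/-- Deduced from `d² = 0` instead of the Jacobi identity. Extend a pure form of weight `p`; since
`d` agrees with `d₀` up to higher weight, `d² = 0` puts `d₀²α` in weight at least `p + 1`. But `d₀`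
is homogeneous, so `d₀²α` is pure of weight `p` and must vanish. -/
theorem ceDifferential_tangentBracket_comp (F : ManifoldFiltration n M) (x : M) (k : ℕ) :
    ceDifferential (F.tangentBracket x) (k + 1) ∘ₗ ceDifferential (F.tangentBracket x) k = 0 := by
  obtain ⟨A, hx⟩ := exists_orthoFrame F x
  refine eq_zero_of_pure (A.basis hx) A.w _ fun p α hα => ?_
  have hαp : α ∈ F.weightFilt x p k := by
    rw [A.weightFilt_eq hx]
    exact mem_weightGE_of_altDilation (A.basis hx) A.w hα
  obtain ⟨ψ, ρ, hψ, hρ, hψe⟩ := A.exists_extension_form hx (Pi.single k α)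
  have hψx : ψ x k = α := by
    refine altForm_ext_basis (A.basis hx).toBasis fun I => ?_
    simp only [OrthonormalBasis.coe_toBasis, OrthoFrame.basis_apply]
    rw [hψe x hx, hρ, one_mul, Pi.single_eq_same]
  have hψw : ∀ y ∈ A.N, ψ y k ∈ F.weightFilt y p k := fun y hy => by
    rw [A.mem_weightFilt_iff hy]
    intro I hI
    rw [hψe y hy, Pi.single_eq_same, (A.mem_weightFilt_iff hx).mp hαp I hI, mul_zero]
  have hev : ∀ y ∈ A.N, ∀ᶠ y' in nhds y, ψ y' k ∈ F.weightFilt y' p k := fun y hy =>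
    Filter.mem_of_superset (A.eventually_mem hy) hψw
  have hdψ : IsSmoothFormOn Set.univ (exteriorD ψ) := hψ.exteriorD isOpen_univ
  have h1 : exteriorD (exteriorD ψ) x (k + 2) -
      ceDifferential (F.tangentBracket x) (k + 1) (exteriorD ψ x (k + 1)) ∈
        F.weightFilt x (p + 1) (k + 2) := by
    refine A.exteriorD_sub_mem hx (hdψ.contDiffAt_self isOpen_univ _ (Set.mem_univ x)) ?_
    filter_upwards [A.eventually_mem hx] with y hy
    exact A.exteriorD_mem hy (hψ.contDiffAt_self isOpen_univ _ (Set.mem_univ y)) (hev y hy)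
  have h2 := A.ceDifferential_mem hx
    (A.exteriorD_sub_mem hx (hψ.contDiffAt_self isOpen_univ _ (Set.mem_univ x)) (hev x hx))
  have h3 : exteriorD (exteriorD ψ) x (k + 2) = 0 :=
    congrFun (exteriorD_exteriorD isOpen_univ hψ (Set.mem_univ x)) (k + 2)
  rw [h3, zero_sub] at h1
  rw [hψx, map_sub] at h2
  have h5 : ceDifferential (F.tangentBracket x) (k + 1) (ceDifferential (F.tangentBracket x) k α) ∈
      F.weightFilt x (p + 1) (k + 2) := by
    have h4 := Submodule.neg_mem _ (Submodule.add_mem _ h1 h2)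
    rwa [neg_add_eq_sub, sub_sub_cancel_left, neg_neg] at h4
  rw [A.weightFilt_eq hx] at h5
  refine eq_zero_of_altDilation_of_mem (A.basis hx) A.w (p := p) ?_ h5
  rw [LinearMap.comp_apply, ← A.ceDifferential_altDilation hx, ← A.ceDifferential_altDilation hx, hα,
    map_smul, map_smul]

end SquareZero

/-! ### Conjugation of operators by isometries -/

section Conjugation

variable {V W V' W' : Type*} [NormedAddCommGroup V] [InnerProductSpace ℝ V] [FiniteDimensional ℝ V]
  [NormedAddCommGroup W] [InnerProductSpace ℝ W] [FiniteDimensional ℝ W]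
  [NormedAddCommGroup V'] [InnerProductSpace ℝ V'] [FiniteDimensional ℝ V']
  [NormedAddCommGroup W'] [InnerProductSpace ℝ W'] [FiniteDimensional ℝ W']

/-- A linear map conjugated by isometries. -/
def conjIsometry (f : V ≃ₗᵢ[ℝ] V') (g : W ≃ₗᵢ[ℝ] W') (L : V →ₗ[ℝ] W) : V' →ₗ[ℝ] W' :=
  g.toLinearEquiv.toLinearMap ∘ₗ L ∘ₗ f.symm.toLinearEquiv.toLinearMap

@[simp] theorem conjIsometry_apply (f : V ≃ₗᵢ[ℝ] V') (g : W ≃ₗᵢ[ℝ] W') (L : V →ₗ[ℝ] W) (v : V') :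
    conjIsometry f g L v = g (L (f.symm v)) := rfl

theorem conjIsometry_apply_map (f : V ≃ₗᵢ[ℝ] V') (g : W ≃ₗᵢ[ℝ] W') (L : V →ₗ[ℝ] W) (v : V) :
    conjIsometry f g L (f v) = g (L v) := by
  rw [conjIsometry_apply, f.symm_apply_apply]

theorem conjIsometry_comp {Z Z' : Type*} [NormedAddCommGroup Z] [InnerProductSpace ℝ Z]
    [NormedAddCommGroup Z'] [InnerProductSpace ℝ Z'] (f : V ≃ₗᵢ[ℝ] V') (g : W ≃ₗᵢ[ℝ] W')
    (h : Z ≃ₗᵢ[ℝ] Z') (L : V →ₗ[ℝ] W) (L' : W →ₗ[ℝ] Z) :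
    h.toLinearEquiv.toLinearMap ∘ₗ (L' ∘ₗ L) ∘ₗ f.symm.toLinearEquiv.toLinearMap =
      (h.toLinearEquiv.toLinearMap ∘ₗ L' ∘ₗ g.symm.toLinearEquiv.toLinearMap) ∘ₗ conjIsometry f g L := by
  ext v
  simp

theorem conjIsometry_adjoint (f : V ≃ₗᵢ[ℝ] V') (g : W ≃ₗᵢ[ℝ] W') (L : V →ₗ[ℝ] W) :
    conjIsometry g f (LinearMap.adjoint L) = LinearMap.adjoint (conjIsometry f g L) := by
  ext w
  refine ext_inner_right ℝ fun v => ?_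
  rw [LinearMap.adjoint_inner_left, conjIsometry_apply, conjIsometry_apply]
  have h1 := f.inner_map_map (LinearMap.adjoint L (g.symm w)) (f.symm v)
  have h2 := g.inner_map_map (g.symm w) (L (f.symm v))
  rw [f.apply_symm_apply] at h1
  rw [g.apply_symm_apply] at h2
  rw [h1, h2, LinearMap.adjoint_inner_left]

theorem finrank_range_conjIsometry (f : V ≃ₗᵢ[ℝ] V') (g : W ≃ₗᵢ[ℝ] W') (L : V →ₗ[ℝ] W) :
    finrank ℝ (LinearMap.range (conjIsometry f g L)) = finrank ℝ (LinearMap.range L) := by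
  rw [conjIsometry, LinearMap.range_comp, LinearMap.range_comp, LinearEquiv.range, Submodule.map_top]
  exact LinearEquiv.finrank_eq (g.toLinearEquiv.submoduleMap _).symm

theorem map_ring_inverse {A A' : Type*} [Ring A] [Algebra ℝ A] [Ring A'] [Algebra ℝ A'] (e : A ≃ₐ[ℝ] A')
    (a : A) : e (Ring.inverse a) = Ring.inverse (e a) := by
  by_cases ha : IsUnit a
  · obtain ⟨u, rfl⟩ := ha
    rw [Ring.inverse_unit]
    exact (Ring.inverse_unit (Units.map (e : A →* A') u)).symm
  · rw [Ring.inverse_non_unit _ ha, map_zero, Ring.inverse_non_unit]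
    intro h
    exact ha ((MulEquiv.isUnit_map e).mp h)

theorem map_gapInverse {A A' : Type*} [Ring A] [Algebra ℝ A] [Ring A'] [Algebra ℝ A'] (e : A ≃ₐ[ℝ] A')
    (T pr : A) (z : ℂ) : e (gapInverse T pr z) = gapInverse (e T) (e pr) z := by
  have h1 : e (normSqPoly T z) = normSqPoly (e T) z := map_normSqPoly e.toAlgHom T z
  rw [gapInverse, map_mul, map_ring_inverse, map_add, map_mul, map_sub, map_one, h1]
  rfl

theorem conjIsometry_gapInverse (f : V ≃ₗᵢ[ℝ] V') (T pr : Module.End ℝ V) (z : ℂ) :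
    conjIsometry f f (gapInverse T pr z) = gapInverse (A := Module.End ℝ V') (conjIsometry f f T) (conjIsometry f f pr) z :=
  map_gapInverse (f.toLinearEquiv.conjAlgEquiv ℝ) T pr z

theorem isUnit_conjIsometry (f : V ≃ₗᵢ[ℝ] V') {T pr : Module.End ℝ V} {z : ℂ}
    (h : IsUnit (normSqPoly T z * pr + (1 - pr))) :
    IsUnit (normSqPoly (A := Module.End ℝ V') (conjIsometry f f T) z * conjIsometry f f pr +
      (1 - conjIsometry f f pr)) := by
  have h2 := h.map (f.toLinearEquiv.conjAlgEquiv ℝ)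
  have h1 := map_normSqPoly (f.toLinearEquiv.conjAlgEquiv ℝ).toAlgHom T z
  rw [map_add, map_mul, map_sub, map_one] at h2
  refine Eq.mp (congrArg IsUnit ?_) h2
  exact congrArg (fun a => a * (conjIsometry f f pr : Module.End ℝ V') +
    (1 - (conjIsometry f f pr : Module.End ℝ V'))) h1

end Conjugation

/-! ### Operators on forms read in an orthonormal frame -/

section LocalModel

variable {n : ℕ} {M : Type*} [TopologicalSpace M] [ChartedSpace (ModelSpace n) M]
  [IsManifold (𝓡 n) ∞ M] [RiemannianBundle (fun x : M => TangentSpace (𝓡 n) x)]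
  [IsContMDiffRiemannianBundle (𝓡 n) ∞ (EuclideanSpace ℝ (Fin n)) (fun x : M => TangentSpace (𝓡 n) x)]
  {F : ManifoldFiltration n M}

/-- The forms of degree `k` on the tangent space at `y`. -/
abbrev FormAt (n : ℕ) {M : Type*} [TopologicalSpace M] [ChartedSpace (ModelSpace n) M] (y : M) (k : ℕ) :
    Type _ := (TangentSpace (𝓡 n) y) [⋀^Fin k]→ₗ[ℝ] ℝ

/-- The forms of degree `k` on the model space. -/
abbrev ModelForm (n k : ℕ) : Type := (ModelSpace n) [⋀^Fin k]→ₗ[ℝ] ℝ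

namespace OrthoFrame

variable (A : OrthoFrame F)

/-- The components of a form in the frame, as a form on the model space. -/
def toModel (y : M) (k : ℕ) : FormAt n y k →ₗ[ℝ] ModelForm n k where
  toFun α := α.compLinearMap (frameMap fun a => A.e a y)
  map_add' _ _ := rfl
  map_smul' _ _ := rfl

/-- The form with given components in the frame. -/
def ofModel (y : M) (k : ℕ) : ModelForm n k →ₗ[ℝ] FormAt n y k where
  toFun α := α.compLinearMap (∑ a, (innerSL ℝ (A.e a y)).toLinearMap.smulRight (stdBasis n a))
  map_add' _ _ := rfl
  map_smul' _ _ := rfl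

/-- A linear map between forms at `y`, read in the frame. -/
def localOp (y : M) (k l : ℕ) (L : FormAt n y k →ₗ[ℝ] FormAt n y l) : ModelForm n k →ₗ[ℝ] ModelForm n l :=
  A.toModel y l ∘ₗ L ∘ₗ A.ofModel y k

/-- The isometry of the model space and the tangent space given by the frame. -/
def iso {y : M} (hy : y ∈ A.N) : ModelSpace n ≃ₗᵢ[ℝ] TangentSpace (𝓡 n) y := (A.basis hy).repr.symm

theorem iso_apply {y : M} (hy : y ∈ A.N) (v : ModelSpace n) :
    A.iso hy v = frameMap (fun a => A.e a y) v := by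
  rw [frameMap_apply]
  have h := (A.basis hy).sum_repr ((A.basis hy).repr.symm v)
  rw [LinearIsometryEquiv.apply_symm_apply] at h
  simp only [basis_apply] at h
  exact h.symm

theorem iso_symm_apply {y : M} (hy : y ∈ A.N) (v : TangentSpace (𝓡 n) y) : (A.iso hy).symm v =
    (∑ a, (innerSL ℝ (A.e a y)).toLinearMap.smulRight (stdBasis n a) :
      TangentSpace (𝓡 n) y →ₗ[ℝ] ModelSpace n) v := by
  rw [LinearIsometryEquiv.symm_apply_eq, iso_apply, LinearMap.sum_apply, map_sum]
  refine (A.sum_inner_smul hy v).symm.trans (Finset.sum_congr rfl fun a _ => ?_)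
  rw [LinearMap.smulRight_apply, map_smul, frameMap_basis]
  rfl

theorem toModel_eq {y : M} (hy : y ∈ A.N) (k : ℕ) (α : FormAt n y k) :
    A.toModel y k α = altPullback (A.iso hy) k α := by
  ext v
  rw [altPullback_apply]
  simp only [iso_apply]
  rfl

theorem ofModel_eq {y : M} (hy : y ∈ A.N) (k : ℕ) (α : ModelForm n k) :
    A.ofModel y k α = (altPullback (A.iso hy) k).symm α := by
  ext v
  rw [altPullback_symm_apply]
  simp only [iso_symm_apply]
  rfl

theorem localOp_eq {y : M} (hy : y ∈ A.N) (k l : ℕ) (L : FormAt n y k →ₗ[ℝ] FormAt n y l) :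
    A.localOp y k l L = conjIsometry (altPullback (A.iso hy) k) (altPullback (A.iso hy) l) L := by
  ext1 α
  rw [conjIsometry_apply, ← A.ofModel_eq hy, ← A.toModel_eq hy]
  rfl

theorem localOp_toModel {y : M} (hy : y ∈ A.N) (k l : ℕ) (L : FormAt n y k →ₗ[ℝ] FormAt n y l)
    (α : FormAt n y k) : A.localOp y k l L (A.toModel y k α) = A.toModel y l (L α) := by
  rw [A.localOp_eq hy, conjIsometry_apply, A.toModel_eq hy, A.toModel_eq hy,
    LinearIsometryEquiv.symm_apply_apply]

theorem toModel_apply_basis (y : M) (k : ℕ) (α : FormAt n y k) (I : Fin k → Fin n) :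
    A.toModel y k α (fun i => stdBasis n (I i)) = α (fun i => A.e (I i) y) := by
  change α (fun i => frameMap (fun a => A.e a y) (stdBasis n (I i))) = _
  simp only [frameMap_basis]

end OrthoFrame

variable (F) in
/-- Smoothness of families of linear maps between spaces of forms. -/
def SmoothOpOn (D : Set ℂ) (U : Set M) (k l : ℕ)
    (L : ℂ → ∀ y : M, FormAt n y k →ₗ[ℝ] FormAt n y l) : Prop :=
  ∀ (A : OrthoFrame F) (x₀ : M) (u : ModelSpace n), u ∈ (extChartAt (𝓡 n) x₀).target →
    (extChartAt (𝓡 n) x₀).symm u ∈ U → (extChartAt (𝓡 n) x₀).symm u ∈ A.N → ∀ z ∈ D,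
      SmoothLinearAt (fun q : ℂ × ModelSpace n => A.localOp ((extChartAt (𝓡 n) x₀).symm q.2) k l
        (L q.1 ((extChartAt (𝓡 n) x₀).symm q.2))) (z, u)

theorem eventually_chart {D : Set ℂ} (hD : IsOpen D) {N : Set M} (hN : IsOpen N) {x₀ : M}
    {u : ModelSpace n} (hu : u ∈ (extChartAt (𝓡 n) x₀).target)
    (hx : (extChartAt (𝓡 n) x₀).symm u ∈ N) {z : ℂ} (hz : z ∈ D) :
    ∀ᶠ q in nhds (z, u), q.1 ∈ D ∧ (extChartAt (𝓡 n) x₀).symm q.2 ∈ N := by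
  have h1 : ∀ᶠ q in nhds (z, u), q.1 ∈ D := continuousAt_fst.preimage_mem_nhds (hD.mem_nhds hz)
  have h2 : ∀ᶠ q in nhds (z, u), q.2 ∈ (extChartAt (𝓡 n) x₀).target ∧
      (extChartAt (𝓡 n) x₀).symm q.2 ∈ N :=
    (continuous_snd.tendsto (z, u)).eventually (eventually_mem_charts x₀ hu hN hx)
  filter_upwards [h1, h2] with q hq1 hq2 using ⟨hq1, hq2.2⟩

namespace SmoothOpOn

variable {D : Set ℂ} {U : Set M} {k l m : ℕ} {L : ℂ → ∀ y : M, FormAt n y k →ₗ[ℝ] FormAt n y l}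

theorem comp {L' : ℂ → ∀ y : M, FormAt n y l →ₗ[ℝ] FormAt n y m} (h' : SmoothOpOn F D U l m L')
    (h : SmoothOpOn F D U k l L) : SmoothOpOn F D U k m fun z y => L' z y ∘ₗ L z y := by
  intro A x₀ u hu hx hN z hz
  refine ((h' A x₀ u hu hx hN z hz).comp (h A x₀ u hu hx hN z hz)).congr ?_
  filter_upwards [eventually_chart isOpen_univ A.isOpen hu hN (Set.mem_univ z)] with q hq
  rw [A.localOp_eq hq.2, A.localOp_eq hq.2, A.localOp_eq hq.2]
  exact conjIsometry_comp _ _ _ _ _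

theorem adjoint (h : SmoothOpOn F D U k l L) :
    SmoothOpOn F D U l k fun z y => LinearMap.adjoint (L z y) := by
  intro A x₀ u hu hx hN z hz
  refine (h A x₀ u hu hx hN z hz).adjoint.congr ?_
  filter_upwards [eventually_chart isOpen_univ A.isOpen hu hN (Set.mem_univ z)] with q hq
  rw [A.localOp_eq hq.2, A.localOp_eq hq.2, conjIsometry_adjoint]

theorem penroseInverse (hD : IsOpen D) (hU : IsOpen U) (h : SmoothOpOn F D U k l L)
    {X : ℂ → ∀ y : M, FormAt n y l →ₗ[ℝ] FormAt n y k}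
    (hX : ∀ z ∈ D, ∀ y ∈ U, IsPenroseInverse (L z y) (X z y))
    (hr : ∀ z ∈ D, ∀ x ∈ U, ∃ N : Set M, IsOpen N ∧ x ∈ N ∧ ∀ w ∈ D, ∀ y ∈ N,
      finrank ℝ (LinearMap.range (L w y)) = finrank ℝ (LinearMap.range (L z x))) :
    SmoothOpOn F D U l k X := by
  intro A x₀ u hu hx hN z hz
  refine (h A x₀ u hu hx hN z hz).penroseInverse ?_ ?_
  · filter_upwards [eventually_chart hD (hU.inter A.isOpen) hu ⟨hx, hN⟩ hz] with q hq
    rw [A.localOp_eq hq.2.2, A.localOp_eq hq.2.2]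
    exact (hX q.1 hq.1 _ hq.2.1).conj (altPullback (A.iso hq.2.2) k) (altPullback (A.iso hq.2.2) l)
      (conjIsometry_apply_map _ _ _) (conjIsometry_apply_map _ _ _)
  · obtain ⟨N, hNo, hxN, hrk⟩ := hr z hz _ hx
    filter_upwards [eventually_chart hD (hNo.inter A.isOpen) hu ⟨hxN, hN⟩ hz] with q hq
    rw [A.localOp_eq hq.2.2, A.localOp_eq hN, finrank_range_conjIsometry, finrank_range_conjIsometry,
      hrk q.1 hq.1 _ hq.2.1]

theorem gapInverse {T pr : ℂ → ∀ y : M, FormAt n y k →ₗ[ℝ] FormAt n y k}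
    (hT : SmoothOpOn F D U k k T) (hpr : SmoothOpOn F D U k k pr)
    (hu : ∀ z ∈ D, ∀ y ∈ U, IsUnit (normSqPoly (T z y : Module.End ℝ (FormAt n y k)) z * pr z y + (1 - pr z y))) :
    SmoothOpOn F D U k k fun z y =>
      FilteredRiemannian.gapInverse (A := Module.End ℝ (FormAt n y k)) (T z y) (pr z y) z := by
  intro A x₀ u hu' hx hN z hz
  have h1 := SmoothLinearAt.gapInverse (hT A x₀ u hu' hx hN z hz) (hpr A x₀ u hu' hx hN z hz)
    (z := fun q => q.1) contDiffAt_fst ?_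
  · refine h1.congr ?_
    filter_upwards [eventually_chart isOpen_univ A.isOpen hu' hN (Set.mem_univ z)] with q hq
    rw [A.localOp_eq hq.2, A.localOp_eq hq.2, A.localOp_eq hq.2]
    exact conjIsometry_gapInverse _ _ _ _
  · rw [A.localOp_eq hN, A.localOp_eq hN]
    exact isUnit_conjIsometry _ (hu z hz _ hx)

/-- Smooth families of linear maps send smooth families of forms to smooth families of forms. -/
theorem contDiffAt_apply (h : SmoothOpOn F D U k l L) {θ η : ℂ → FieldOfForms n M}
    (hη : ∀ z y, η z y l = L z y (θ z y k)) {x₀ : M} {u : ModelSpace n}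
    (hu : u ∈ (extChartAt (𝓡 n) x₀).target) (hx : (extChartAt (𝓡 n) x₀).symm u ∈ U) {z : ℂ} (hz : z ∈ D)
    (hθ : ContDiffAt ℝ ∞ (fun q : ℂ × ModelSpace n => chartRep x₀ (θ q.1) k q.2) (z, u)) :
    ContDiffAt ℝ ∞ (fun q : ℂ × ModelSpace n => chartRep x₀ (η q.1) l q.2) (z, u) := by
  obtain ⟨A, hN⟩ := exists_orthoFrame F ((extChartAt (𝓡 n) x₀).symm u)
  refine (FilteredRiemannian.contDiffAt_chartRep_iff x₀ hu (fun a => A.smooth a _ hN)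
    (A.orthonormal _ hN).linearIndependent η l z).mpr fun I => ?_
  have h1 := (FilteredRiemannian.contDiffAt_chartRep_iff x₀ hu (fun a => A.smooth a _ hN)
    (A.orthonormal _ hN).linearIndependent θ k z).mp hθ
  have h2 : ContDiffAt ℝ ∞ (fun q : ℂ × ModelSpace n =>
      A.toModel ((extChartAt (𝓡 n) x₀).symm q.2) k (θ q.1 ((extChartAt (𝓡 n) x₀).symm q.2) k)) (z, u) := by
    refine (contDiffAt_altForm_iff (stdBasis n).toBasis).mpr fun J => ?_
    simp only [OrthonormalBasis.coe_toBasis]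
    refine (h1 J).congr_of_eventuallyEq (Filter.Eventually.of_forall fun q => ?_)
    exact A.toModel_apply_basis _ k _ J
  have h3 := (contDiffAt_altForm_iff (stdBasis n).toBasis).mp
    ((h A x₀ u hu hx hN z hz).apply h2) I
  simp only [OrthonormalBasis.coe_toBasis] at h3
  refine h3.congr_of_eventuallyEq ?_
  filter_upwards [eventually_chart isOpen_univ A.isOpen hu hN (Set.mem_univ z)] with q hq
  rw [A.localOp_toModel hq.2, ← hη]
  exact (A.toModel_apply_basis _ l _ I).symm

end SmoothOpOn

end LocalModel

/-! ### Smoothness of `d₀` and `d₀⁻¹`; spectrum of the base box -/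

section BasicOperators

theorem SmoothLinearAt.sum {V W P ι : Type*} [NormedAddCommGroup V] [InnerProductSpace ℝ V]
    [FiniteDimensional ℝ V] [NormedAddCommGroup W] [InnerProductSpace ℝ W] [FiniteDimensional ℝ W]
    [NormedAddCommGroup P] [NormedSpace ℝ P] (s : Finset ι) {D : ι → P → V →ₗ[ℝ] W} {p : P}
    (h : ∀ i ∈ s, SmoothLinearAt (D i) p) : SmoothLinearAt (fun q => ∑ i ∈ s, D i q) p := by
  classical
  induction s using Finset.induction_on with
  | empty => simpa using smoothLinearAt_const (0 : V →ₗ[ℝ] W) p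
  | insert a s ha ih =>
    simp only [Finset.sum_insert ha]
    exact (h a (Finset.mem_insert_self a s)).add (ih fun i hi => h i (Finset.mem_insert_of_mem hi))

variable {n : ℕ} {M : Type*} [TopologicalSpace M] [ChartedSpace (ModelSpace n) M]
  [IsManifold (𝓡 n) ∞ M]

theorem contDiffAt_comp_chart_symm {f : M → ℝ} {x₀ : M} {u : ModelSpace n}
    (hu : u ∈ (extChartAt (𝓡 n) x₀).target)
    (hf : ContMDiffAt (𝓡 n) 𝓘(ℝ, ℝ) ∞ f ((extChartAt (𝓡 n) x₀).symm u)) :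
    ContDiffAt ℝ ∞ (fun v => f ((extChartAt (𝓡 n) x₀).symm v)) u := by
  rw [← contMDiffAt_iff_contDiffAt]
  exact hf.comp _ ((contMDiffOn_extChartAt_symm (I := 𝓡 n) (n := ∞) x₀).contMDiffAt
    ((isOpen_extChartAt_target x₀).mem_nhds hu))

/-- The elementary bracket on the model space. -/
def modelBracket (a b c : Fin n) : ModelSpace n →ₗ[ℝ] ModelSpace n →ₗ[ℝ] ModelSpace n :=
  (EuclideanSpace.proj (𝕜 := ℝ) (ι := Fin n) a).toLinearMap.smulRight
    ((EuclideanSpace.proj (𝕜 := ℝ) (ι := Fin n) b).toLinearMap.smulRight (stdBasis n c))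

theorem modelBracket_apply (a b c : Fin n) (u v : ModelSpace n) :
    modelBracket a b c u v = u a • v b • stdBasis n c := rfl

variable [RiemannianBundle (fun x : M => TangentSpace (𝓡 n) x)]

namespace ManifoldFiltration

variable (F : ManifoldFiltration n M)

/-- The base differential `d₀` in degree `k`. -/
def formD (x : M) (k : ℕ) : FormAt n x k →ₗ[ℝ] FormAt n x (k + 1) :=
  (F.flag x).baseD (F.osculatingBracket x) k

/-- Its transpose. -/
def formDt (x : M) (k : ℕ) : FormAt n x (k + 1) →ₗ[ℝ] FormAt n x k :=
  (F.flag x).baseDTranspose (F.osculatingBracket x) k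

/-- Its partial inverse. -/
def formX (x : M) (k : ℕ) : FormAt n x (k + 1) →ₗ[ℝ] FormAt n x k :=
  (F.flag x).baseDInv (F.osculatingBracket x) k

/-- The transpose of the partial inverse. -/
def formXt (x : M) (k : ℕ) : FormAt n x k →ₗ[ℝ] FormAt n x (k + 1) :=
  LinearMap.adjoint (F.formX x k)

/-- The operator `d₀ᵗ d₀` in degree `k`. -/
def formT (x : M) (k : ℕ) : Module.End ℝ (FormAt n x k) := F.formDt x k ∘ₗ F.formD x k

/-- The orthogonal projection onto the image of `d₀ᵗ`. -/
def formPr (x : M) (k : ℕ) : Module.End ℝ (FormAt n x k) := F.formX x k ∘ₗ F.formD x k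

/-- The inverse of `|z - d₀ᵗ d₀|²` on the image of `d₀ᵗ`. -/
def formW (z : ℂ) (x : M) (k : ℕ) : Module.End ℝ (FormAt n x k) :=
  gapInverse (F.formT x k) (F.formPr x k) z

theorem formDt_eq (x : M) (k : ℕ) : F.formDt x k = LinearMap.adjoint (F.formD x k) := rfl

theorem isPenroseInverse_formX (x : M) (k : ℕ) : IsPenroseInverse (F.formD x k) (F.formX x k) :=
  (F.flag x).isPenroseInverse_baseDInv _ k

end ManifoldFiltration

variable [T2Space M]
  [IsContMDiffRiemannianBundle (𝓡 n) ∞ (EuclideanSpace ℝ (Fin n)) (fun x : M => TangentSpace (𝓡 n) x)]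

namespace ManifoldFiltration

variable (F : ManifoldFiltration n M)

theorem formD_eq (x : M) (k : ℕ) : F.formD x k = ceDifferential (F.tangentBracket x) k :=
  (F.flag x).baseD_eq _ k

theorem formD_formD (x : M) (k : ℕ) (α : FormAt n x k) : F.formD x (k + 1) (F.formD x k α) = 0 := by
  rw [formD_eq, formD_eq]
  exact LinearMap.congr_fun (ceDifferential_tangentBracket_comp F x k) α

theorem formDt_formDt (x : M) (k : ℕ) (α : FormAt n x (k + 2)) :
    F.formDt x k (F.formDt x (k + 1) α) = 0 := by
  refine ext_inner_right ℝ fun v => ?_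
  rw [formDt_eq, formDt_eq, LinearMap.adjoint_inner_left, LinearMap.adjoint_inner_left,
    formD_formD, inner_zero_right, inner_zero_left]

/-- A bound from below for the spectrum of `d₀ᵗ d₀` given by the spectral gap. -/
theorem HasSpectralGap.le_abs {F : ManifoldFiltration n M} {U : Set M} {r : ℝ}
    (h : F.HasSpectralGap U r) {x : M} (hx : x ∈ U) {k : ℕ} {l : ℝ} (hl : l ≠ 0) {v : FormAt n x k}
    (hv : v ≠ 0) (hlv : F.formDt x k (F.formD x k v) = l • v) : r ≤ |l| := by
  refine h x hx l hl ?_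
  refine Module.End.hasEigenvalue_of_hasEigenvector (x := Pi.single k v) ⟨?_, ?_⟩
  · rw [Module.End.mem_eigenspace_iff]
    funext j
    have h1 : F.baseBoxAt x (Pi.single k v) j = F.baseDAt x (F.baseDTransposeAt x (Pi.single k v)) j +
      F.formDt x j (F.formD x j ((Pi.single k v : TotalForm (TangentSpace (𝓡 n) x)) j)) := rfl
    have h2 : F.baseDAt x (F.baseDTransposeAt x (Pi.single k v)) j = 0 := by
      cases j with
      | zero => rfl
      | succ j =>
        change F.formD x j (F.formDt x j ((Pi.single k v : TotalForm (TangentSpace (𝓡 n) x)) (j + 1))) = 0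
        by_cases hj : j + 1 = k
        · subst hj
          rw [Pi.single_eq_same]
          -- The eigenvector lies in `Im δ₀`, so the other half `d₀δ₀` of the base box kills it.
          have h3 : v = l⁻¹ • F.formDt x (j + 1) (F.formD x (j + 1) v) := by
            rw [hlv, smul_smul, inv_mul_cancel₀ hl, one_smul]
          rw [h3, map_smul, formDt_formDt, smul_zero, map_zero]
        · rw [Pi.single_eq_of_ne hj, map_zero, map_zero]
    rw [h1, h2, zero_add]
    by_cases hj : j = k
    · subst hj
      rw [Pi.smul_apply, Pi.single_eq_same, hlv]
    · rw [Pi.smul_apply, Pi.single_eq_of_ne hj, map_zero, map_zero, smul_zero]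
  · intro h0
    exact hv (by simpa using congrFun h0 k)

/-- The nonzero eigenvalues of the base box come from `d₀ᵗ d₀`. -/
theorem exists_formT_eigenvector {x : M} {l : ℝ} (hl : l ≠ 0)
    (h : (F.baseBoxAt x).HasEigenvalue l) : ∃ (k : ℕ) (v : FormAt n x k), v ≠ 0 ∧
      F.formDt x k (F.formD x k v) = l • v := by
  obtain ⟨α, hα, hα0⟩ := h.exists_hasEigenvector
  rw [Module.End.mem_eigenspace_iff] at hα
  obtain ⟨k, hk⟩ : ∃ k, α k ≠ 0 := by
    by_contra hc
    push Not at hc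
    exact hα0 (funext hc)
  -- The operators `d₀δ₀` and `δ₀d₀` share their nonzero eigenvalues: `δ₀` carries eigenvectors of
  -- the first to eigenvectors of the second.
  have key : ∀ (j : ℕ) (β : FormAt n x (j + 1)), β ≠ 0 → F.formD x j (F.formDt x j β) = l • β →
      ∃ (k : ℕ) (v : FormAt n x k), v ≠ 0 ∧ F.formDt x k (F.formD x k v) = l • v := by
    intro j β hβ hβl
    refine ⟨j, F.formDt x j β, fun h0 => ?_, by rw [hβl, map_smul]⟩
    rw [h0, map_zero] at hβl
    exact (smul_ne_zero hl hβ) hβl.symm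
  have h1 : F.baseDAt x (F.baseDTransposeAt x α) k + F.formDt x k (F.formD x k (α k)) = l • α k :=
    congrFun hα k
  by_cases hD : F.formD x k (α k) = 0
  · rw [hD, map_zero, add_zero] at h1
    cases k with
    | zero => exact absurd h1.symm (smul_ne_zero hl hk)
    | succ k => exact key k (α (k + 1)) hk h1
  -- Applying `d₀` to the eigenvalue equation removes the `d₀δ₀` term, so `d₀α` is an eigenvector of
  -- `d₀δ₀` one degree higher.
  · refine key k _ hD ?_
    have h2 : F.formD x k (F.baseDAt x (F.baseDTransposeAt x α) k) = 0 := by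
      cases k with
      | zero => exact map_zero (F.formD x 0)
      | succ k => exact F.formD_formD x k _
    have h3 := congrArg (F.formD x k) h1
    rwa [map_add, h2, zero_add, map_smul] at h3

theorem isUnit_formW {U : Set M} {r : ℝ} (h : F.HasSpectralGap U r) {x : M} (hx : x ∈ U) (k : ℕ)
    {z : ℂ} (hz : ‖z‖ < r) : IsUnit (normSqPoly (F.formT x k) z * F.formPr x k + (1 - F.formPr x k)) :=
  (F.isPenroseInverse_formX x k).isGapInverse (fun _ hl _ hv hlv => h.le_abs hx hl hv hlv) hz

theorem isGapInverse_formW {U : Set M} {r : ℝ} (h : F.HasSpectralGap U r) {x : M} (hx : x ∈ U) (k : ℕ)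
    {z : ℂ} (hz : ‖z‖ < r) : IsGapInverse (F.formT x k) (F.formPr x k) z (F.formW z x k) :=
  isGapInverse_gapInverse (F.isPenroseInverse_formX x k).proj_mul_self
    (F.isPenroseInverse_formX x k).commute_proj (F.isUnit_formW h hx k hz)

end ManifoldFiltration

variable {F : ManifoldFiltration n M}

namespace OrthoFrame

variable (A : OrthoFrame F)

/-- The bracket read in the frame. -/
def frameBracket (y : M) : ModelSpace n →ₗ[ℝ] ModelSpace n →ₗ[ℝ] ModelSpace n :=
  ∑ a, ∑ b, ∑ c, (if A.w c = A.w a + A.w b then A.structureFun a b c y else 0) • modelBracket a b c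

theorem frameMap_frameBracket {y : M} (hy : y ∈ A.N) (u v : ModelSpace n) :
    frameMap (fun a => A.e a y) (A.frameBracket y u v) =
      F.tangentBracket y (frameMap (fun a => A.e a y) u) (frameMap (fun a => A.e a y) v) := by
  rw [frameMap_apply _ u, frameMap_apply _ v]
  simp only [frameBracket, LinearMap.sum_apply, LinearMap.smul_apply, modelBracket_apply, map_sum,
    map_smul, frameMap_basis, A.tangentBracket_apply hy]
  rw [Finset.sum_comm]
  refine Finset.sum_congr rfl fun b _ => ?_
  rw [Finset.smul_sum]
  refine Finset.sum_congr rfl fun a _ => ?_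
  rw [Finset.smul_sum, Finset.smul_sum]
  refine Finset.sum_congr rfl fun c _ => ?_
  simp only [smul_smul]
  congr 1
  ring

theorem localOp_formD {y : M} (hy : y ∈ A.N) (k : ℕ) :
    A.localOp y k (k + 1) (F.formD y k) = ceDifferential (A.frameBracket y) k := by
  ext1 α
  have h1 : A.toModel y k (A.ofModel y k α) = α := by
    rw [A.toModel_eq hy, A.ofModel_eq hy, LinearIsometryEquiv.apply_symm_apply]
  conv_lhs => rw [← h1]
  rw [A.localOp_toModel hy]
  have h2 := ceDifferential_compLinearMap (frameMap fun a => A.e a y) (A.frameMap_frameBracket hy) k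
    (A.ofModel y k α)
  rw [F.formD_eq]
  refine h2.symm.trans ?_
  exact congrArg _ h1

end OrthoFrame

/-- The differential is linear in the bracket, so in the frame `d₀` is a combination of constant
operators with structure functions as coefficients. -/
theorem smoothOpOn_formD (F : ManifoldFiltration n M) (D : Set ℂ) (U : Set M) (k : ℕ) :
    SmoothOpOn F D U k (k + 1) fun _ y => F.formD y k := by
  intro A x₀ u hu _ hN z _
  have h1 : SmoothLinearAt (fun q : ℂ × ModelSpace n =>
      ∑ a, ∑ b, ∑ c, (if A.w c = A.w a + A.w b then
        A.structureFun a b c ((extChartAt (𝓡 n) x₀).symm q.2) else 0) •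
          ceDifferential (modelBracket a b c) k) (z, u) := by
    refine SmoothLinearAt.sum _ fun a _ => SmoothLinearAt.sum _ fun b _ => SmoothLinearAt.sum _ fun c _ => ?_
    refine SmoothLinearAt.smul ?_ (smoothLinearAt_const _ _)
    split_ifs
    · exact (contDiffAt_comp_chart_symm hu (A.contMDiffAt_structureFun hN a b c)).comp (z, u) contDiffAt_snd
    · exact contDiffAt_const
  refine h1.congr ?_
  filter_upwards [eventually_chart isOpen_univ A.isOpen hu hN (Set.mem_univ z)] with q hq
  rw [A.localOp_formD hq.2]
  change ceDifferentialHom (ModelSpace n) k (A.frameBracket _) = _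
  simp only [OrthoFrame.frameBracket, map_sum, map_smul]
  rfl

variable (F) in
/-- The ranks of the osculating differentials are locally constant. -/
def ManifoldFiltration.ConstantRank : Prop :=
  ∀ k : ℕ, IsLocallyConstant fun x : M => finrank ℝ (LinearMap.range (F.osculatingD x k))

/-- This is where local constancy of the rank enters; `Φ` does not change ranks, so the hypothesis
on the osculating differential passes to `d₀`. -/
theorem smoothOpOn_formX (hrank : F.ConstantRank) (D : Set ℂ) (hD : IsOpen D) {U : Set M} (hU : IsOpen U) (k : ℕ) :
    SmoothOpOn F D U (k + 1) k fun _ y => F.formX y k := by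
  refine (smoothOpOn_formD F D U k).penroseInverse hD hU (fun _ _ y _ => F.isPenroseInverse_formX y k) ?_
  intro z _ x _
  obtain ⟨N, hN, hx, h⟩ := (hrank k).exists_open x
  refine ⟨N, hN, hx, fun _ _ y hy => ?_⟩
  have := h y hy
  rw [ManifoldFiltration.formD, ManifoldFiltration.formD, FiniteFlag.finrank_range_baseD,
    FiniteFlag.finrank_range_baseD]
  exact this

end BasicOperators

/-! ### Operators on forms of all degrees and the spectral gap -/

section TotalOperators

variable {n : ℕ} {M : Type*} [TopologicalSpace M] [ChartedSpace (ModelSpace n) M]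
  [IsManifold (𝓡 n) ∞ M]

theorem norm_sq_of_adjoint_apply {V W : Type*} [NormedAddCommGroup V] [InnerProductSpace ℝ V]
    [FiniteDimensional ℝ V] [NormedAddCommGroup W] [InnerProductSpace ℝ W] [FiniteDimensional ℝ W]
    {D : V →ₗ[ℝ] W} {v : V} {l : ℝ} (h : LinearMap.adjoint D (D v) = l • v) :
    ‖D v‖ ^ 2 = l * ‖v‖ ^ 2 := by
  rw [← real_inner_self_eq_norm_sq, ← LinearMap.adjoint_inner_left, h, real_inner_smul_left,
    real_inner_self_eq_norm_sq]

/-- A family of operators on forms sending smooth families to smooth families. -/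
def PreservesSmooth (D : Set ℂ) (U : Set M)
    (T : ℂ → ∀ x : M, TotalForm (TangentSpace (𝓡 n) x) →ₗ[ℝ] TotalForm (TangentSpace (𝓡 n) x)) : Prop :=
  ∀ θ : ℂ → FieldOfForms n M, SmoothFamilyOn D U θ → SmoothFamilyOn D U fun z => pointwise (T z) (θ z)

variable [RiemannianBundle (fun x : M => TangentSpace (𝓡 n) x)] [T2Space M]
  [IsContMDiffRiemannianBundle (𝓡 n) ∞ (EuclideanSpace ℝ (Fin n)) (fun x : M => TangentSpace (𝓡 n) x)]
  {F : ManifoldFiltration n M} {D : Set ℂ} {U : Set M}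

theorem preservesSmooth_raise {L : ℂ → ∀ (y : M) (k : ℕ), FormAt n y k →ₗ[ℝ] FormAt n y (k + 1)}
    (h : ∀ k, SmoothOpOn F D U k (k + 1) fun z y => L z y k) :
    PreservesSmooth D U fun z y => raiseDegree (L z y) := by
  intro θ hθ k x₀ u hu hx z hz
  cases k with
  | zero =>
    refine (contDiffAt_const (c := 0)).congr_of_eventuallyEq (Filter.Eventually.of_forall fun q => ?_)
    ext v; rfl
  | succ k =>
    exact (h k).contDiffAt_apply (θ := θ) (η := fun z => pointwise (fun y => raiseDegree (L z y)) (θ z))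
      (fun _ _ => rfl) hu hx hz (hθ k x₀ u hu hx z hz)

theorem preservesSmooth_lower {L : ℂ → ∀ (y : M) (k : ℕ), FormAt n y (k + 1) →ₗ[ℝ] FormAt n y k}
    (h : ∀ k, SmoothOpOn F D U (k + 1) k fun z y => L z y k) :
    PreservesSmooth D U fun z y => lowerDegree (L z y) := by
  intro θ hθ k x₀ u hu hx z hz
  exact (h k).contDiffAt_apply (θ := θ) (η := fun z => pointwise (fun y => lowerDegree (L z y)) (θ z))
    (fun _ _ => rfl) hu hx hz (hθ (k + 1) x₀ u hu hx z hz)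

/-- The operator on forms of all degrees acting by `L k` in degree `k`. -/
def inDegrees {V : Type*} [AddCommGroup V] [Module ℝ V] (L : ∀ k : ℕ, Module.End ℝ (V [⋀^Fin k]→ₗ[ℝ] ℝ)) :
    TotalForm V →ₗ[ℝ] TotalForm V :=
  LinearMap.pi fun k => L k ∘ₗ LinearMap.proj k

theorem preservesSmooth_inDegrees {L : ℂ → ∀ (y : M) (k : ℕ), Module.End ℝ (FormAt n y k)}
    (h : ∀ k, SmoothOpOn F D U k k fun z y => L z y k) :
    PreservesSmooth D U fun z y => inDegrees (L z y) := by
  intro θ hθ k x₀ u hu hx z hz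
  exact (h k).contDiffAt_apply (θ := θ) (η := fun z => pointwise (fun y => inDegrees (L z y)) (θ z))
    (fun _ _ => rfl) hu hx hz (hθ k x₀ u hu hx z hz)

theorem OrthoFrame.norm_apply_le {F : ManifoldFiltration n M} (A : OrthoFrame F) {y : M} (hy : y ∈ A.N) {k l : ℕ}
    (L : FormAt n y k →ₗ[ℝ] FormAt n y l) {C : ℝ}
    (hC : ‖LinearMap.toContinuousLinearMap (A.localOp y k l L)‖ ≤ C) (α : FormAt n y k) :
    ‖L α‖ ≤ C * ‖α‖ := by
  have h := (LinearMap.toContinuousLinearMap (A.localOp y k l L)).le_of_opNorm_le hC (A.toModel y k α)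
  rw [LinearMap.coe_toContinuousLinearMap', A.localOp_toModel hy, A.toModel_eq hy, A.toModel_eq hy,
    LinearIsometryEquiv.norm_map, LinearIsometryEquiv.norm_map] at h
  exact h

namespace ManifoldFiltration

variable (F)

/-- The transpose of `d₀⁻¹` at `x`. -/
def baseDInvTransposeAt (x : M) : TotalForm (TangentSpace (𝓡 n) x) →ₗ[ℝ] TotalForm (TangentSpace (𝓡 n) x) :=
  raiseDegree (F.formXt x)

/-- The inverse of `|z - d₀ᵗ d₀|²` on the image of `d₀ᵗ`, at `x`. -/
def gapInverseAt (z : ℂ) (x : M) : TotalForm (TangentSpace (𝓡 n) x) →ₗ[ℝ] TotalForm (TangentSpace (𝓡 n) x) :=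
  inDegrees (F.formW z x)

variable {F}

theorem preservesSmooth_baseDAt (D : Set ℂ) (U : Set M) : PreservesSmooth D U fun _ => F.baseDAt :=
  preservesSmooth_raise (smoothOpOn_formD F D U)

theorem preservesSmooth_baseDTransposeAt (D : Set ℂ) (U : Set M) :
    PreservesSmooth D U fun _ => F.baseDTransposeAt :=
  preservesSmooth_lower fun k => (smoothOpOn_formD F D U k).adjoint

theorem preservesSmooth_baseDInvAt (hrank : F.ConstantRank) (hD : IsOpen D) (hU : IsOpen U) :
    PreservesSmooth D U fun _ => F.baseDInvAt :=
  preservesSmooth_lower fun k => smoothOpOn_formX hrank D hD hU k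

theorem preservesSmooth_baseDInvTransposeAt (hrank : F.ConstantRank) (hD : IsOpen D) (hU : IsOpen U) :
    PreservesSmooth D U fun _ => F.baseDInvTransposeAt :=
  preservesSmooth_raise fun k => (smoothOpOn_formX hrank D hD hU k).adjoint

theorem preservesSmooth_gapInverseAt (hrank : F.ConstantRank) (hU : IsOpen U) {r : ℝ}
    (hr : F.HasSpectralGap U r) : PreservesSmooth (Metric.ball (0 : ℂ) r) U F.gapInverseAt := by
  refine preservesSmooth_inDegrees (F := F) fun k => ?_
  have h1 := smoothOpOn_formD F (Metric.ball (0 : ℂ) r) U k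
  have h2 := smoothOpOn_formX hrank (Metric.ball (0 : ℂ) r) Metric.isOpen_ball hU k
  exact (h1.adjoint.comp h1).gapInverse (h2.comp h1) fun z hz y hy =>
    F.isUnit_formW hr hy k (mem_ball_zero_iff.mp hz)

/-- Every point has a neighbourhood with a spectral gap. -/
theorem exists_hasSpectralGap (hrank : F.ConstantRank) (x : M) :
    ∃ U : Set M, IsOpen U ∧ x ∈ U ∧ ∃ r : ℝ, 0 < r ∧ F.HasSpectralGap U r := by
  obtain ⟨A, hx⟩ := exists_orthoFrame F x
  -- Smoothness of `d₀⁻¹` makes its norm locally bounded. The bound is transferred to the varying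
  -- tangent spaces because the frame gives isometries with the model space.
  have hbound : ∀ k, ∃ C : ℝ, ∀ᶠ y in nhds x, ∀ α : FormAt n y (k + 1), ‖F.formX y k α‖ ≤ C * ‖α‖ := by
    intro k
    have h1 := smoothOpOn_formX hrank Set.univ isOpen_univ (isOpen_univ (X := M)) k A x
      (extChartAt (𝓡 n) x x) (mem_extChartAt_target x) (Set.mem_univ _)
      (by rwa [extChartAt_to_inv]) 0 (Set.mem_univ _)
    let g : M → ℝ := fun y => ‖LinearMap.toContinuousLinearMap (A.localOp y (k + 1) k (F.formX y k))‖
    have h2 : ContinuousAt (fun q : ℂ × ModelSpace n => g ((extChartAt (𝓡 n) x).symm q.2))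
        (0, extChartAt (𝓡 n) x x) := (ContDiffAt.continuousAt h1).norm
    have h3 : ContinuousAt (fun y : M => ((0 : ℂ), extChartAt (𝓡 n) x y)) x :=
      continuousAt_const.prodMk (continuousAt_extChartAt x)
    have h4 : ContinuousAt (fun y : M => g ((extChartAt (𝓡 n) x).symm (extChartAt (𝓡 n) x y))) x :=
      ContinuousAt.comp (f := fun y : M => ((0 : ℂ), extChartAt (𝓡 n) x y)) (x := x) h2 h3
    refine ⟨g ((extChartAt (𝓡 n) x).symm (extChartAt (𝓡 n) x x)) + 1, ?_⟩
    filter_upwards [h4.eventually_lt continuousAt_const (lt_add_one _), A.eventually_mem hx,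
      (isOpen_extChartAt_source (I := 𝓡 n) x).mem_nhds (mem_extChartAt_source x)] with y hy hyN hys α
    rw [(extChartAt (𝓡 n) x).left_inv hys] at hy
    exact A.norm_apply_le hyN _ hy.le α
  choose C hC using hbound
  have hev : ∀ᶠ y in nhds x, ∀ k ∈ Finset.range (n + 1), ∀ α : FormAt n y (k + 1),
      ‖F.formX y k α‖ ≤ C k * ‖α‖ := (Finset.eventually_all _).mpr fun k _ => hC k
  obtain ⟨U, hU, hUo, hxU⟩ := mem_nhds_iff.mp hev
  -- A common bound for the finitely many degrees in which forms are nonzero; the `1` makes it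
  -- positive. Its inverse is the gap.
  let K : ℝ := 1 + ∑ k ∈ Finset.range (n + 1), C k ^ 2
  have hK : 0 < K := add_pos_of_pos_of_nonneg one_pos (Finset.sum_nonneg fun k _ => sq_nonneg _)
  refine ⟨U, hUo, hxU, K⁻¹, inv_pos.mpr hK, fun y hy l hl hle => ?_⟩
  obtain ⟨k, v, hv, hlv⟩ := F.exists_formT_eigenvector hl hle
  have hk : k ∈ Finset.range (n + 1) := by
    rw [Finset.mem_range]
    by_contra hk
    exact hv (altForm_eq_zero_of_lt (by omega) v)
  -- An eigenvector for a nonzero eigenvalue lies in `Im δ₀`, where `d₀⁻¹d₀` is the identity. Thus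
  -- `‖v‖ ≤ C‖d₀v‖`, and `‖d₀v‖² = l‖v‖²` gives `1 ≤ C²l`.
  have h1 : F.formX y k (F.formD y k v) = v := by
    have h2 : v = F.formDt y k (l⁻¹ • F.formD y k v) := by
      rw [map_smul, hlv, smul_smul, inv_mul_cancel₀ hl, one_smul]
    have h3 := (F.isPenroseInverse_formX y k).xd_adjoint (l⁻¹ • F.formD y k v)
    rw [← formDt_eq, ← h2] at h3
    exact h3
  have h2 := hU hy k hk (F.formD y k v)
  rw [h1] at h2
  have h3 : ‖F.formD y k v‖ ^ 2 = l * ‖v‖ ^ 2 := norm_sq_of_adjoint_apply hlv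
  have hv0 : 0 < ‖v‖ := norm_pos_iff.mpr hv
  have h4 : ‖v‖ ^ 2 ≤ C k ^ 2 * (l * ‖v‖ ^ 2) := by
    rw [← h3, ← mul_pow]
    exact pow_le_pow_left₀ hv0.le h2 2
  have h5 : 1 ≤ C k ^ 2 * l := by
    have : 1 * ‖v‖ ^ 2 ≤ (C k ^ 2 * l) * ‖v‖ ^ 2 := by rw [one_mul, mul_assoc]; exact h4
    exact le_of_mul_le_mul_right this (by positivity)
  have hl0 : 0 ≤ l := by
    by_contra h
    nlinarith [sq_nonneg (C k)]
  have h6 : C k ^ 2 ≤ K := by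
    have := Finset.single_le_sum (f := fun k => C k ^ 2) (fun k _ => sq_nonneg _) hk
    change C k ^ 2 ≤ 1 + _
    linarith
  have h7 : 1 ≤ K * l := h5.trans (mul_le_mul_of_nonneg_right h6 hl0)
  rw [abs_of_nonneg hl0, inv_le_iff_one_le_mul₀ hK, mul_comm]
  exact h7

end ManifoldFiltration

end TotalOperators

/-! ### Operators on `Ω(U)` defined by formulas -/

section SmoothOperators

variable {n : ℕ} {M : Type*} [TopologicalSpace M] [ChartedSpace (ModelSpace n) M]
  {U : Set M}

theorem SmoothForms.ext_on {θ η : SmoothForms n U} (h : ∀ x ∈ U, θ.1 x = η.1 x) : θ = η := by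
  refine Subtype.ext (funext fun x => ?_)
  by_cases hx : x ∈ U
  · exact h x hx
  · rw [θ.2.2 x hx, η.2.2 x hx]

theorem smoothEnd_ext {A B : Module.End ℝ (SmoothForms n U)}
    (h : ∀ θ : SmoothForms n U, ∀ x ∈ U, (A θ).1 x = (B θ).1 x) : A = B :=
  LinearMap.ext fun θ => SmoothForms.ext_on (h θ)

theorem IsSmoothFormOn.congr {ψ ψ' : FieldOfForms n M} (h : IsSmoothFormOn U ψ)
    (h' : ∀ x ∈ U, ψ' x = ψ x) : IsSmoothFormOn U ψ' := fun k x₀ =>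
  (h k x₀).congr fun y hy => by
    simp only [chartRep]
    rw [h' _ hy.2]

open Classical in
/-- A formula sending smooth forms to smooth forms, linear on smooth forms, defines an operator. -/
theorem exists_realizes (T : FieldOfForms n M → FieldOfForms n M)
    (hs : ∀ ψ, IsSmoothFormOn U ψ → IsSmoothFormOn U (T ψ))
    (ha : ∀ ψ ψ', IsSmoothFormOn U ψ → IsSmoothFormOn U ψ' → ∀ x ∈ U, T (ψ + ψ') x = T ψ x + T ψ' x)
    (hm : ∀ (c : ℝ) ψ, IsSmoothFormOn U ψ → ∀ x ∈ U, T (c • ψ) x = c • T ψ x) :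
    ∃ A : Module.End ℝ (SmoothForms n U), Realizes U A T := by
  let g : SmoothForms n U → SmoothForms n U := fun θ => ⟨fun x => if x ∈ U then T θ.1 x else 0,
    (hs θ.1 θ.2.1).congr fun x hx => if_pos hx, fun x hx => if_neg hx⟩
  have hg : ∀ θ, ∀ x ∈ U, (g θ).1 x = T θ.1 x := fun θ x hx => if_pos hx
  refine ⟨{ toFun := g, map_add' := fun θ η => SmoothForms.ext_on fun x hx => ?_,
            map_smul' := fun c θ => SmoothForms.ext_on fun x hx => ?_ }, hg⟩
  · exact (hg _ x hx).trans ((ha _ _ θ.2.1 η.2.1 x hx).trans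
      (congrArg₂ (· + ·) (hg θ x hx) (hg η x hx)).symm)
  · exact (hg _ x hx).trans ((hm c _ θ.2.1 x hx).trans (congrArg (c • ·) (hg θ x hx)).symm)

open Classical in
/-- The operator on `Ω(U)` given by the formula `T`, if there is one. -/
def endOf (U : Set M) (T : FieldOfForms n M → FieldOfForms n M) : Module.End ℝ (SmoothForms n U) :=
  if h : ∃ A, Realizes U A T then h.choose else 0

theorem realizes_endOf {T : FieldOfForms n M → FieldOfForms n M} (h : ∃ A, Realizes U A T) :
    Realizes U (endOf U T) T := by
  rw [endOf, dif_pos h]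
  exact h.choose_spec

variable [IsManifold (𝓡 n) ∞ M]

/-- The de Rham differential on `Ω(U)`. -/
def deRham (U : Set M) : Module.End ℝ (SmoothForms n U) := endOf U exteriorD

/-- The operator on `Ω(U)` acting by `D x` at each point `x`. -/
def pointwiseEnd (U : Set M)
    (D : ∀ x : M, TotalForm (TangentSpace (𝓡 n) x) →ₗ[ℝ] TotalForm (TangentSpace (𝓡 n) x)) :
    Module.End ℝ (SmoothForms n U) := endOf U (pointwise D)

theorem realizes_deRham (hU : IsOpen U) : Realizes U (deRham U) (exteriorD (n := n)) :=
  realizes_endOf (exists_realizes _ (fun _ h => h.exteriorD hU)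
    (fun _ _ h h' _ hx => exteriorD_add hU h h' hx) fun c ψ _ x _ => exteriorD_smul c ψ x)

theorem PreservesSmooth.isSmoothFormOn {D : Set ℂ}
    {T : ℂ → ∀ x : M, TotalForm (TangentSpace (𝓡 n) x) →ₗ[ℝ] TotalForm (TangentSpace (𝓡 n) x)}
    (h : PreservesSmooth D U T) (hU : IsOpen U) {z : ℂ} (hz : z ∈ D) {ψ : FieldOfForms n M}
    (hψ : IsSmoothFormOn U ψ) : IsSmoothFormOn U (pointwise (T z) ψ) :=
  (h _ (hψ.smoothFamilyOn hU)).isSmoothFormOn hz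

theorem PreservesSmooth.realizes {D : Set ℂ}
    {T : ℂ → ∀ x : M, TotalForm (TangentSpace (𝓡 n) x) →ₗ[ℝ] TotalForm (TangentSpace (𝓡 n) x)}
    (h : PreservesSmooth D U T) (hU : IsOpen U) {z : ℂ} (hz : z ∈ D) :
    Realizes U (pointwiseEnd U (T z)) (pointwise (T z)) :=
  realizes_endOf (exists_realizes _ (fun _ hψ => h.isSmoothFormOn hU hz hψ)
    (fun ψ ψ' _ _ x _ => map_add (T z x) (ψ x) (ψ' x)) fun c ψ _ x _ => map_smul (T z x) c (ψ x))

theorem deRham_mul_deRham (hU : IsOpen U) :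
    (deRham U : Module.End ℝ (SmoothForms n U)) * deRham U = 0 := by
  refine smoothEnd_ext fun θ x hx => ?_
  have h := realizes_deRham (n := n) hU
  rw [Module.End.mul_apply, h _ x hx, exteriorD_congr hU (h θ) hx, exteriorD_exteriorD hU θ.2.1 hx]
  rfl

theorem pow_eq_zero_of_filtration {R V : Type*} [Ring R] [AddCommGroup V] [Module R V]
    {P : ℕ → Submodule R V} {N : ℕ} (h0 : P 0 = ⊤) (hN : P N = ⊥) {A : Module.End R V}
    (hA : ∀ p, ∀ v ∈ P p, A v ∈ P (p + 1)) : A ^ N = 0 := by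
  have h : ∀ p v, (A ^ p) v ∈ P p := fun p v => by
    induction p with
    | zero => rw [h0]; trivial
    | succ p ih => rw [pow_succ', Module.End.mul_apply]; exact hA p _ ih
  refine LinearMap.ext fun v => ?_
  have h1 := h N v
  rwa [hN, Submodule.mem_bot] at h1

theorem normSqPoly_end_apply {V : Type*} [AddCommGroup V] [Module ℝ V] (T : Module.End ℝ V) (z : ℂ)
    (v : V) : normSqPoly T z v =
      z.re • (z.re • v - T v) - T (z.re • v - T v) + z.im ^ 2 • v := by
  simp [normSqPoly, pow_two, Module.algebraMap_end_apply, smul_smul]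

end SmoothOperators

/-! ### The operators on `Ω(U)`: pointwise relations and action on the filtration -/

section Operators

variable {n : ℕ} {M : Type*} [TopologicalSpace M] [ChartedSpace (ModelSpace n) M]
  [IsManifold (𝓡 n) ∞ M] [RiemannianBundle (fun x : M => TangentSpace (𝓡 n) x)]

namespace ManifoldFiltration

variable (F : ManifoldFiltration n M) (U : Set M)

/-- `d₀` on `Ω(U)`. -/
def opD : Module.End ℝ (SmoothForms n U) := pointwiseEnd U F.baseDAt
/-- `d₀ᵗ` on `Ω(U)`. -/
def opDt : Module.End ℝ (SmoothForms n U) := pointwiseEnd U F.baseDTransposeAt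
/-- `d₀⁻¹` on `Ω(U)`. -/
def opX : Module.End ℝ (SmoothForms n U) := pointwiseEnd U F.baseDInvAt
/-- The transpose of `d₀⁻¹` on `Ω(U)`. -/
def opXt : Module.End ℝ (SmoothForms n U) := pointwiseEnd U F.baseDInvTransposeAt
/-- The inverse of `|z - d₀ᵗ d₀|²` on the image of `d₀ᵗ`, on `Ω(U)`. -/
def opW (z : ℂ) : Module.End ℝ (SmoothForms n U) := pointwiseEnd U (F.gapInverseAt z)

variable {F U} [T2Space M]
  [IsContMDiffRiemannianBundle (𝓡 n) ∞ (EuclideanSpace ℝ (Fin n)) (fun x : M => TangentSpace (𝓡 n) x)]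

theorem realizes_opD (hU : IsOpen U) : Realizes U (F.opD U) (pointwise F.baseDAt) :=
  (preservesSmooth_baseDAt Set.univ U).realizes hU (Set.mem_univ 0)

theorem realizes_opDt (hU : IsOpen U) : Realizes U (F.opDt U) (pointwise F.baseDTransposeAt) :=
  (preservesSmooth_baseDTransposeAt Set.univ U).realizes hU (Set.mem_univ 0)

theorem realizes_opX (hrank : F.ConstantRank) (hU : IsOpen U) :
    Realizes U (F.opX U) (pointwise F.baseDInvAt) :=
  (preservesSmooth_baseDInvAt hrank isOpen_univ hU).realizes hU (Set.mem_univ 0)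

theorem realizes_opXt (hrank : F.ConstantRank) (hU : IsOpen U) :
    Realizes U (F.opXt U) (pointwise F.baseDInvTransposeAt) :=
  (preservesSmooth_baseDInvTransposeAt hrank isOpen_univ hU).realizes hU (Set.mem_univ 0)

theorem realizes_opW (hrank : F.ConstantRank) (hU : IsOpen U) {r : ℝ} (hr : F.HasSpectralGap U r)
    {z : ℂ} (hz : ‖z‖ < r) : Realizes U (F.opW U z) (pointwise (F.gapInverseAt z)) :=
  (preservesSmooth_gapInverseAt hrank hU hr).realizes hU (mem_ball_zero_iff.mpr hz)

theorem opDt_apply (hU : IsOpen U) (θ : SmoothForms n U) {x : M} (hx : x ∈ U) (k : ℕ) :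
    (F.opDt U θ).1 x k = F.formDt x k (θ.1 x (k + 1)) := congrFun (realizes_opDt hU θ x hx) k

theorem opD_zero (hU : IsOpen U) (θ : SmoothForms n U) {x : M} (hx : x ∈ U) :
    (F.opD U θ).1 x 0 = 0 := congrFun (realizes_opD hU θ x hx) 0

theorem opD_succ (hU : IsOpen U) (θ : SmoothForms n U) {x : M} (hx : x ∈ U) (k : ℕ) :
    (F.opD U θ).1 x (k + 1) = F.formD x k (θ.1 x k) := congrFun (realizes_opD hU θ x hx) (k + 1)

theorem opX_apply (hrank : F.ConstantRank) (hU : IsOpen U) (θ : SmoothForms n U) {x : M} (hx : x ∈ U)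
    (k : ℕ) : (F.opX U θ).1 x k = F.formX x k (θ.1 x (k + 1)) :=
  congrFun (realizes_opX hrank hU θ x hx) k

theorem opXt_succ (hrank : F.ConstantRank) (hU : IsOpen U) (θ : SmoothForms n U) {x : M} (hx : x ∈ U)
    (k : ℕ) : (F.opXt U θ).1 x (k + 1) = F.formXt x k (θ.1 x k) :=
  congrFun (realizes_opXt hrank hU θ x hx) (k + 1)

theorem opW_apply (hrank : F.ConstantRank) (hU : IsOpen U) {r : ℝ} (hr : F.HasSpectralGap U r)
    {z : ℂ} (hz : ‖z‖ < r) (θ : SmoothForms n U) {x : M} (hx : x ∈ U) (k : ℕ) :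
    (F.opW U z θ).1 x k = F.formW z x k (θ.1 x k) :=
  congrFun (realizes_opW hrank hU hr hz θ x hx) k

theorem opDt_mul_opDt (hU : IsOpen U) : F.opDt U * F.opDt U = 0 := by
  refine smoothEnd_ext fun θ x hx => funext fun k => ?_
  rw [Module.End.mul_apply, opDt_apply hU _ hx, opDt_apply hU _ hx, formDt_formDt]
  rfl

theorem opX_opD_opX (hrank : F.ConstantRank) (hU : IsOpen U) :
    F.opX U * F.opD U * F.opX U = F.opX U := by
  refine smoothEnd_ext fun θ x hx => funext fun k => ?_
  rw [Module.End.mul_apply, Module.End.mul_apply, opX_apply hrank hU _ hx, opD_succ hU _ hx,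
    opX_apply hrank hU _ hx, (F.isPenroseInverse_formX x k).xdx]

theorem opX_eq_opDt_mul (hrank : F.ConstantRank) (hU : IsOpen U) :
    F.opX U = F.opDt U * F.opXt U * F.opX U := by
  refine smoothEnd_ext fun θ x hx => funext fun k => ?_
  rw [Module.End.mul_apply, Module.End.mul_apply, opDt_apply hU _ hx, opXt_succ hrank hU _ hx,
    opX_apply hrank hU _ hx]
  exact (F.isPenroseInverse_formX x k).eq_adjoint_adjoint _

theorem opX_eq_mul_opDt (hrank : F.ConstantRank) (hU : IsOpen U) :
    F.opX U = F.opX U * F.opXt U * F.opDt U := by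
  refine smoothEnd_ext fun θ x hx => funext fun k => ?_
  rw [Module.End.mul_apply, Module.End.mul_apply, opX_apply hrank hU _ hx, opX_apply hrank hU _ hx,
    opXt_succ hrank hU _ hx, opDt_apply hU _ hx]
  exact (F.isPenroseInverse_formX x k).eq_apply_adjoint _

theorem opDt_eq_mul_opX (hrank : F.ConstantRank) (hU : IsOpen U) :
    F.opDt U = F.opDt U * F.opD U * F.opX U := by
  refine smoothEnd_ext fun θ x hx => funext fun k => ?_
  rw [Module.End.mul_apply, Module.End.mul_apply, opDt_apply hU _ hx, opDt_apply hU _ hx,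
    opD_succ hU _ hx, opX_apply hrank hU _ hx]
  exact ((F.isPenroseInverse_formX x k).adjoint_apply_dx _).symm

theorem opDt_eq_opX_mul (hrank : F.ConstantRank) (hU : IsOpen U) :
    F.opDt U = F.opX U * F.opD U * F.opDt U := by
  refine smoothEnd_ext fun θ x hx => funext fun k => ?_
  rw [Module.End.mul_apply, Module.End.mul_apply, opX_apply hrank hU _ hx, opD_succ hU _ hx,
    opDt_apply hU _ hx]
  exact ((F.isPenroseInverse_formX x k).xd_adjoint _).symm

theorem opT_apply (hU : IsOpen U) (θ : SmoothForms n U) {x : M} (hx : x ∈ U) (k : ℕ) :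
    ((F.opDt U * F.opD U) θ).1 x k = F.formT x k (θ.1 x k) := by
  rw [Module.End.mul_apply, opDt_apply hU _ hx, opD_succ hU _ hx]
  rfl

theorem opPr_apply (hrank : F.ConstantRank) (hU : IsOpen U) (θ : SmoothForms n U) {x : M} (hx : x ∈ U)
    (k : ℕ) : ((F.opX U * F.opD U) θ).1 x k = F.formPr x k (θ.1 x k) := by
  rw [Module.End.mul_apply, opX_apply hrank hU _ hx, opD_succ hU _ hx]
  rfl

theorem normSqPoly_opT_apply (hU : IsOpen U) (z : ℂ) (θ : SmoothForms n U) {x : M} (hx : x ∈ U) (k : ℕ) :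
    (normSqPoly (F.opDt U * F.opD U) z θ).1 x k = normSqPoly (F.formT x k) z (θ.1 x k) := by
  have h := fun η : SmoothForms n U => opT_apply (F := F) hU η hx k
  rw [normSqPoly_end_apply (F.opDt U * F.opD U) z θ]
  refine Eq.trans ?_ (normSqPoly_end_apply (F.formT x k) z (θ.1 x k)).symm
  change z.re • (z.re • θ.1 x k - ((F.opDt U * F.opD U) θ).1 x k) -
    ((F.opDt U * F.opD U) (z.re • θ - (F.opDt U * F.opD U) θ)).1 x k + z.im ^ 2 • θ.1 x k = _
  rw [h, h]
  change _ - F.formT x k (z.re • θ.1 x k - ((F.opDt U * F.opD U) θ).1 x k) + _ = _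
  rw [h]

/-- The relations hold at each point of `U`, and `opW` acts pointwise. Smoothness of the pointwise
gap inverse is what makes it an operator on `Ω(U)`. -/
theorem isGapInverse_opW (hrank : F.ConstantRank) (hU : IsOpen U) {r : ℝ} (hr : F.HasSpectralGap U r)
    {z : ℂ} (hz : ‖z‖ < r) :
    IsGapInverse (F.opDt U * F.opD U) (F.opX U * F.opD U) z (F.opW U z) := by
  constructor <;> refine smoothEnd_ext fun θ x hx => funext fun k => ?_ <;>
    have h := isGapInverse_formW F hr hx k hz <;> rw [Module.End.mul_apply]
  · rw [opW_apply hrank hU hr hz _ hx, normSqPoly_opT_apply hU z _ hx, opPr_apply hrank hU _ hx]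
    exact LinearMap.congr_fun h.left _
  · rw [normSqPoly_opT_apply hU z _ hx, opW_apply hrank hU hr hz _ hx, opPr_apply hrank hU _ hx]
    exact LinearMap.congr_fun h.right _
  · rw [opPr_apply hrank hU _ hx, opW_apply hrank hU hr hz _ hx]
    exact LinearMap.congr_fun h.proj_mul _
  · rw [opW_apply hrank hU hr hz _ hx, opPr_apply hrank hU _ hx, opW_apply hrank hU hr hz _ hx]
    exact LinearMap.congr_fun h.mul_proj _

/-! ### The weight filtration of forms -/

variable (F U) in
/-- The forms on `U` of weight at least `p`. -/
def formFilt (p : ℕ) : Submodule ℝ (SmoothForms n U) where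
  carrier := {θ | ∀ x ∈ U, ∀ k, θ.1 x k ∈ F.weightFilt x p k}
  add_mem' hθ hη x hx k := (F.weightFilt x p k).add_mem (hθ x hx k) (hη x hx k)
  zero_mem' x _ k := (F.weightFilt x p k).zero_mem
  smul_mem' c _ hθ x hx k := (F.weightFilt x p k).smul_mem c (hθ x hx k)

theorem formFilt_zero : F.formFilt U 0 = ⊤ :=
  eq_top_iff.mpr fun θ _ x _ k => by rw [weightFilt_zero]; trivial

theorem formFilt_eq_bot {p : ℕ} (hp : n * F.step < p) : F.formFilt U p = ⊥ := by
  refine eq_bot_iff.mpr fun θ hθ => ?_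
  refine (Submodule.mem_bot ℝ).mpr (SmoothForms.ext_on fun x hx => funext fun k => ?_)
  have h := hθ x hx k
  rw [weightFilt_eq_bot F x k hp, Submodule.mem_bot] at h
  exact h

variable {p k : ℕ} {x : M}

theorem formD_altDilation (A : OrthoFrame F) (hx : x ∈ A.N) (α : FormAt n x k) :
    F.formD x k (altDilation (A.basis hx) A.w k α) = altDilation (A.basis hx) A.w (k + 1) (F.formD x k α) := by
  rw [formD_eq]
  exact A.ceDifferential_altDilation hx k α

theorem formX_altDilation (A : OrthoFrame F) (hx : x ∈ A.N) (α : FormAt n x (k + 1)) :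
    F.formX x k (altDilation (A.basis hx) A.w (k + 1) α) = altDilation (A.basis hx) A.w k (F.formX x k α) :=
  (F.isPenroseInverse_formX x k).commute (altDilation_isSymmetric _ _ _) (altDilation_isSymmetric _ _ _)
    (formD_altDilation A hx) α

theorem formDt_altDilation (A : OrthoFrame F) (hx : x ∈ A.N) (α : FormAt n x (k + 1)) :
    F.formDt x k (altDilation (A.basis hx) A.w (k + 1) α) = altDilation (A.basis hx) A.w k (F.formDt x k α) :=
  adjoint_commute (altDilation_isSymmetric _ _ _) (altDilation_isSymmetric _ _ _)
    (formD_altDilation A hx) α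

theorem formX_mem {α : FormAt n x (k + 1)} (hα : α ∈ F.weightFilt x p (k + 1)) :
    F.formX x k α ∈ F.weightFilt x p k := by
  obtain ⟨A, hx⟩ := exists_orthoFrame F x
  exact A.apply_mem_weightFilt hx _ (formX_altDilation A hx) hα

theorem formDt_mem {α : FormAt n x (k + 1)} (hα : α ∈ F.weightFilt x p (k + 1)) :
    F.formDt x k α ∈ F.weightFilt x p k := by
  obtain ⟨A, hx⟩ := exists_orthoFrame F x
  exact A.apply_mem_weightFilt hx _ (formDt_altDilation A hx) hα

theorem formD_mem {α : FormAt n x k} (hα : α ∈ F.weightFilt x p k) :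
    F.formD x k α ∈ F.weightFilt x p (k + 1) := by
  obtain ⟨A, hx⟩ := exists_orthoFrame F x
  exact A.apply_mem_weightFilt hx _ (formD_altDilation A hx) hα

/-- The gap inverse commutes with the dilations because `δ₀d₀` and `d₀⁻¹d₀` do. -/
theorem formW_mem {r : ℝ} (hr : F.HasSpectralGap U r) (hxU : x ∈ U) {z : ℂ} (hz : ‖z‖ < r)
    {α : FormAt n x k} (hα : α ∈ F.weightFilt x p k) : F.formW z x k α ∈ F.weightFilt x p k := by
  obtain ⟨A, hx⟩ := exists_orthoFrame F x
  have h1 : Commute (altDilation (A.basis hx) A.w k) (F.formT x k) := by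
    refine LinearMap.ext fun β => ?_
    change altDilation _ _ _ (F.formDt x k (F.formD x k β)) = F.formDt x k (F.formD x k (altDilation _ _ _ β))
    rw [formD_altDilation A hx, formDt_altDilation A hx]
  have h2 : Commute (altDilation (A.basis hx) A.w k) (F.formPr x k) := by
    refine LinearMap.ext fun β => ?_
    change altDilation _ _ _ (F.formX x k (F.formD x k β)) = F.formX x k (F.formD x k (altDilation _ _ _ β))
    rw [formD_altDilation A hx, formX_altDilation A hx]
  exact A.apply_mem_weightFilt hx _
    (fun β => (LinearMap.congr_fun ((isGapInverse_formW F hr hxU k hz).commute h1 h2).eq β).symm) hα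

variable {θ : SmoothForms n U}

theorem opX_mem (hrank : F.ConstantRank) (hU : IsOpen U) (hθ : θ ∈ F.formFilt U p) :
    F.opX U θ ∈ F.formFilt U p := fun x hx k => by
  rw [opX_apply hrank hU θ hx]
  exact formX_mem (hθ x hx (k + 1))

theorem opDt_mem (hU : IsOpen U) (hθ : θ ∈ F.formFilt U p) : F.opDt U θ ∈ F.formFilt U p := fun x hx k => by
  rw [opDt_apply hU θ hx]
  exact formDt_mem (hθ x hx (k + 1))

theorem opD_mem (hU : IsOpen U) (hθ : θ ∈ F.formFilt U p) : F.opD U θ ∈ F.formFilt U p := fun x hx k => by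
  cases k with
  | zero => rw [opD_zero hU θ hx]; exact Submodule.zero_mem _
  | succ k =>
    rw [opD_succ hU θ hx]
    exact formD_mem (hθ x hx k)

theorem opW_mem (hrank : F.ConstantRank) (hU : IsOpen U) {r : ℝ} (hr : F.HasSpectralGap U r)
    {z : ℂ} (hz : ‖z‖ < r) (hθ : θ ∈ F.formFilt U p) : F.opW U z θ ∈ F.formFilt U p := fun x hx k => by
  rw [opW_apply hrank hU hr hz θ hx]
  exact formW_mem hr hx hz (hθ x hx k)

theorem deRham_sub_opD_mem (hU : IsOpen U) (hθ : θ ∈ F.formFilt U p) :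
    (deRham U - F.opD U : Module.End ℝ (SmoothForms n U)) θ ∈ F.formFilt U (p + 1) := fun x hx k => by
  change (deRham U θ).1 x k - (F.opD U θ).1 x k ∈ _
  rw [realizes_deRham hU θ x hx]
  cases k with
  | zero => rw [opD_zero hU θ hx, exteriorD_zero, sub_zero]; exact Submodule.zero_mem _
  | succ k =>
    obtain ⟨A, hxA⟩ := exists_orthoFrame F x
    rw [opD_succ hU θ hx, formD_eq]
    refine A.exteriorD_sub_mem hxA (θ.2.1.contDiffAt_self hU k hx) ?_
    filter_upwards [hU.mem_nhds hx] with y hy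
    exact hθ y hy k

theorem isNilpotent_of_formFilt {A : Module.End ℝ (SmoothForms n U)}
    (hA : ∀ p, ∀ θ ∈ F.formFilt U p, A θ ∈ F.formFilt U (p + 1)) : IsNilpotent A :=
  ⟨_, pow_eq_zero_of_filtration formFilt_zero (formFilt_eq_bot (Nat.lt_succ_self _)) hA⟩

end ManifoldFiltration
end Operators

/-! ### Ring identities: the corrected inverse, the projection and the resolvent -/

section RuminAlgebra

theorem isUnit_one_sub_and_inverse_eq {A : Type*} [Ring A] {a : A} {m : ℕ} (h : a ^ m = 0) :
    IsUnit (1 - a) ∧ Ring.inverse (1 - a) = ∑ i ∈ Finset.range m, a ^ i := by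
  have h1 : (1 - a) * ∑ i ∈ Finset.range m, a ^ i = 1 := by rw [mul_neg_geom_sum, h, sub_zero]
  have h2 : (∑ i ∈ Finset.range m, a ^ i) * (1 - a) = 1 := by rw [geom_sum_mul_neg, h, sub_zero]
  exact ⟨⟨⟨_, _, h1, h2⟩, rfl⟩, Ring.inverse_unit ⟨_, _, h1, h2⟩⟩

variable {A : Type*} [Ring A]

/-- The algebraic relations between a differential `d`, its base part `d₀`, the transpose `δ` of `d₀`,
the partial inverse `X` of `d₀` and the transpose `Y` of `X`. -/
structure IsBaseComplex (d d₀ δ X Y : A) : Prop where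
  d_d : d * d = 0
  δ_δ : δ * δ = 0
  xdx : X * d₀ * X = X
  x_eq_δ_mul : X = δ * Y * X
  x_eq_mul_δ : X = X * Y * δ
  δ_eq_mul_x : δ = δ * d₀ * X
  δ_eq_x_mul : δ = X * d₀ * δ
  nilpotent : IsNilpotent (X * (d - d₀))
  nilpotent' : IsNilpotent ((d - d₀) * X)

/-- The relations satisfied by the corrected partial inverse `Q` and the projection `pr` on `Im δ`. -/
structure IsRetraction (d δ pr Q : A) : Prop where
  d_d : d * d = 0
  q_q : Q * Q = 0
  δ_q : δ * Q = 0
  q_δ : Q * δ = 0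
  δ_d_q : δ * d * Q = δ
  q_d_δ : Q * d * δ = δ
  q_d_q : Q * d * Q = Q
  pr_q : pr * Q = Q

theorem IsRetraction.map {B : Type*} [Ring B] {d δ pr Q : A} (h : IsRetraction d δ pr Q) (f : A →+* B) :
    IsRetraction (f d) (f δ) (f pr) (f Q) := by
  constructor <;> simp only [← map_mul, h.d_d, h.q_q, h.δ_q, h.q_δ, h.δ_d_q, h.q_d_δ, h.q_d_q, h.pr_q, map_zero]

namespace IsBaseComplex

variable {d d₀ δ X Y : A}

theorem left_eq (d d₀ X : A) : X * d₀ - X * d = -(X * (d - d₀)) := by noncomm_ring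

theorem right_eq (d d₀ X : A) : d₀ * X - d * X = -((d - d₀) * X) := by noncomm_ring

theorem isNilpotent_left (h : IsBaseComplex d d₀ δ X Y) : IsNilpotent (X * d₀ - X * d) := by
  rw [left_eq]; exact h.nilpotent.neg

theorem isNilpotent_right (h : IsBaseComplex d d₀ δ X Y) : IsNilpotent (d₀ * X - d * X) := by
  rw [right_eq]; exact h.nilpotent'.neg

theorem isUnit_left (h : IsBaseComplex d d₀ δ X Y) : IsUnit (1 - (X * d₀ - X * d)) :=
  h.isNilpotent_left.isUnit_one_sub

theorem isUnit_right (h : IsBaseComplex d d₀ δ X Y) : IsUnit (1 - (d₀ * X - d * X)) :=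
  h.isNilpotent_right.isUnit_one_sub

theorem left_mul_x : (X * d₀ - X * d) * X = X * (d₀ * X - d * X) := by noncomm_ring

theorem inverse_mul_x (h : IsBaseComplex d d₀ δ X Y) : Ring.inverse (1 - (X * d₀ - X * d)) * X =
    X * Ring.inverse (1 - (d₀ * X - d * X)) := by
  have h1 : X * (1 - (d₀ * X - d * X)) = (1 - (X * d₀ - X * d)) * X := by
    rw [mul_sub, sub_mul, left_mul_x, mul_one, one_mul]
  calc Ring.inverse (1 - (X * d₀ - X * d)) * X
      = Ring.inverse (1 - (X * d₀ - X * d)) * (X * (1 - (d₀ * X - d * X))) *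
          Ring.inverse (1 - (d₀ * X - d * X)) := by
        rw [mul_assoc, mul_assoc, Ring.mul_inverse_cancel _ h.isUnit_right, mul_one]
    _ = _ := by rw [h1, ← mul_assoc, Ring.inverse_mul_cancel _ h.isUnit_left, one_mul]

/-- The corrected partial inverse `(1 - b)⁻¹ d₀⁻¹`. -/
def corrected (d d₀ X : A) : A := Ring.inverse (1 - (X * d₀ - X * d)) * X

theorem corrected_eq (h : IsBaseComplex d d₀ δ X Y) :
    corrected d d₀ X = X * Ring.inverse (1 - (d₀ * X - d * X)) := h.inverse_mul_x

/-- Expand `(1 - b)Q = X`. As `Q` also equals `X(1 - b₁)⁻¹`, it satisfies `Xd₀Q = Q`, and what is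
left is `XdQ = X`. -/
theorem x_d_q (h : IsBaseComplex d d₀ δ X Y) : X * d * corrected d d₀ X = X := by
  have h1 : (1 - (X * d₀ - X * d)) * corrected d d₀ X = X := by
    rw [corrected, ← mul_assoc, Ring.mul_inverse_cancel _ h.isUnit_left, one_mul]
  have h2 : X * d₀ * corrected d d₀ X = corrected d d₀ X := by
    rw [h.corrected_eq, ← mul_assoc, h.xdx]
  rwa [sub_mul, sub_mul, one_mul, h2, sub_sub_cancel] at h1

/-- The mirror argument: expand `Q(1 - b₁) = X` and use `Qd₀X = Q`. -/
theorem q_d_x (h : IsBaseComplex d d₀ δ X Y) : corrected d d₀ X * d * X = X := by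
  have h1 : corrected d d₀ X * (1 - (d₀ * X - d * X)) = X := by
    rw [h.corrected_eq, mul_assoc, Ring.inverse_mul_cancel _ h.isUnit_right, mul_one]
  have h2 : corrected d d₀ X * (d₀ * X) = corrected d d₀ X := by
    rw [corrected, mul_assoc, ← mul_assoc X, h.xdx]
  rw [mul_sub, mul_sub, mul_one, h2, sub_sub_cancel] at h1
  rw [mul_assoc, h1]

theorem x_δ (h : IsBaseComplex d d₀ δ X Y) : X * δ = 0 := by
  rw [h.x_eq_mul_δ, mul_assoc, h.δ_δ, mul_zero]

theorem δ_x (h : IsBaseComplex d d₀ δ X Y) : δ * X = 0 := by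
  rw [h.x_eq_δ_mul, ← mul_assoc, ← mul_assoc, h.δ_δ, zero_mul, zero_mul]

theorem x_x (h : IsBaseComplex d d₀ δ X Y) : X * X = 0 := by
  nth_rewrite 1 [h.x_eq_mul_δ]
  rw [mul_assoc, h.δ_x, mul_zero]

/-- The relations for `δ` follow from `XdQ = X = QdX` because `δ` is a multiple of `X` on either
side; those for `Q` follow because `Q` is too. -/
theorem isRetraction (h : IsBaseComplex d d₀ δ X Y) : IsRetraction d δ (X * d₀) (corrected d d₀ X) where
  d_d := h.d_d
  q_q := by
    nth_rewrite 2 [h.corrected_eq]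
    rw [corrected, mul_assoc, ← mul_assoc X, h.x_x, zero_mul, mul_zero]
  δ_q := by rw [h.corrected_eq, ← mul_assoc, h.δ_x, zero_mul]
  q_δ := by rw [corrected, mul_assoc, h.x_δ, mul_zero]
  δ_d_q := by
    conv_lhs => rw [h.δ_eq_mul_x]
    rw [mul_assoc, mul_assoc (δ * d₀), ← mul_assoc X, h.x_d_q, ← h.δ_eq_mul_x]
  q_d_δ := by
    conv_lhs => rw [h.δ_eq_x_mul]
    rw [mul_assoc X, ← mul_assoc, h.q_d_x, ← mul_assoc, ← h.δ_eq_x_mul]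
  q_d_q := by
    nth_rewrite 2 [h.corrected_eq]
    rw [← mul_assoc, h.q_d_x, ← h.corrected_eq]
  pr_q := by rw [h.corrected_eq, ← mul_assoc, h.xdx]

end IsBaseComplex

namespace IsRetraction

variable {d δ pr Q : A}

theorem isIdempotentElem (h : IsRetraction d δ pr Q) : IsIdempotentElem (Q * d + d * Q) := by
  have h1 : (Q * d + d * Q) * (Q * d + d * Q) =
      Q * d * Q * d + Q * (d * d) * Q + d * (Q * Q) * d + d * (Q * d * Q) := by noncomm_ring
  rw [IsIdempotentElem, h1, h.d_d, h.q_q, h.q_d_q]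
  noncomm_ring

/-- After `d² = 0` and `δQ = 0`, the relation `δdQ = δ` restores both terms of the box. So the box
vanishes on the image of `1 - Π`, and its resolvent is `z⁻¹` there. -/
theorem box_mul (h : IsRetraction d δ pr Q) :
    (d * δ + δ * d) * (Q * d + d * Q) = d * δ + δ * d := by
  have h1 : (d * δ + δ * d) * (Q * d + d * Q) =
      d * (δ * Q) * d + d * (δ * d * Q) + δ * d * Q * d + δ * (d * d) * Q := by noncomm_ring
  rw [h1, h.d_d, h.δ_q, h.δ_d_q]
  noncomm_ring

theorem mul_box (h : IsRetraction d δ pr Q) :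
    (Q * d + d * Q) * (d * δ + δ * d) = d * δ + δ * d := by
  have h1 : (Q * d + d * Q) * (d * δ + δ * d) =
      Q * (d * d) * δ + (Q * d * δ) * d + d * (Q * d * δ) + d * (Q * δ) * d := by noncomm_ring
  rw [h1, h.d_d, h.q_δ, h.q_d_δ]
  noncomm_ring

end IsRetraction

section Resolvent

variable {B : Type*} [Ring B] [Algebra ℂ B]

/-- `K` is inverse to `z - δ d` on the image of the projection `pr`, and zero on its kernel. -/
structure IsPartialResolvent (d δ pr : B) (z : ℂ) (K : B) : Prop where
  left : (z • 1 - δ * d) * K = pr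
  right : K * (z • 1 - δ * d) * pr = pr
  proj_mul : pr * K = K
  mul_proj : K * pr = K

variable {d δ pr Q K L : B} {z w : ℂ}

/-- The resolvent of the box built from a partial resolvent. -/
def boxResolvent (d Q K : B) (z : ℂ) : B :=
  z⁻¹ • (1 - (Q * d + d * Q)) + K * (Q * d) + d * K * Q

/-- The box acts on `Im pr` as `δd`, because `δ pr = 0`, and on `d(Im pr)` as `dδ`, which `d`
intertwines with `δd`. Hence `K` inverts `z - □` on the summand `Qd` of `Π`, and conjugation by `d`
handles `dQ`. -/
theorem mul_boxResolvent (h : IsRetraction d δ pr Q) (hK : IsPartialResolvent d δ pr z K)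
    (hδ : δ * pr = 0) (hz : z ≠ 0) :
    (z • 1 - (d * δ + δ * d)) * boxResolvent d Q K z = 1 := by
  have hδK : δ * K = 0 := by rw [← hK.proj_mul, ← mul_assoc, hδ, zero_mul]
  have h0 : z • K = pr + δ * d * K := by
    rw [← hK.left, sub_mul, smul_mul_assoc, one_mul, sub_add_cancel]
  have h1 : (z • 1 - (d * δ + δ * d)) * (1 - (Q * d + d * Q)) = z • (1 - (Q * d + d * Q)) := by
    rw [sub_mul, smul_mul_assoc, one_mul, mul_sub, mul_one, h.box_mul, sub_self, sub_zero]
  have h2 : (z • 1 - (d * δ + δ * d)) * (K * (Q * d)) = Q * d := by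
    rw [← mul_assoc, sub_mul, add_mul, smul_mul_assoc, one_mul, h0, mul_assoc d δ K, hδK, mul_zero,
      zero_add, add_sub_cancel_right, ← mul_assoc, h.pr_q]
  have h3 : (z • 1 - (d * δ + δ * d)) * (d * K * Q) = d * Q := by
    have h4 : (z • 1 - (d * δ + δ * d)) * (d * K * Q) =
        d * (z • K) * Q - d * (δ * d * K) * Q - δ * (d * d) * K * Q := by
      rw [sub_mul, smul_mul_assoc, one_mul, mul_smul_comm, smul_mul_assoc]
      noncomm_ring
    rw [h4, h.d_d, h0, mul_zero, zero_mul, zero_mul, sub_zero, ← sub_mul, ← mul_sub,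
      add_sub_cancel_right, mul_assoc, h.pr_q]
  rw [boxResolvent, mul_add, mul_add, mul_smul_comm, h1, h2, h3, inv_smul_smul₀ hz]
  abel

/-- The key relation is `zKQ = Q + Kδ`, obtained from `K(z - δd)Q = Q` and `δdQ = δ`; it turns every
term into one without a resolvent or into cancelling pairs. -/
theorem boxResolvent_mul (h : IsRetraction d δ pr Q) (hK : IsPartialResolvent d δ pr z K)
    (hz : z ≠ 0) : boxResolvent d Q K z * (z • 1 - (d * δ + δ * d)) = 1 := by
  have h0 : z • (K * Q) = Q + K * δ := by
    have h4 := congrArg (· * Q) hK.right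
    simp only [mul_assoc, h.pr_q] at h4
    rw [sub_mul, smul_mul_assoc, one_mul, mul_sub, mul_smul_comm, h.δ_d_q, sub_eq_iff_eq_add] at h4
    exact h4
  have h1 : (1 - (Q * d + d * Q)) * (z • 1 - (d * δ + δ * d)) = z • (1 - (Q * d + d * Q)) := by
    rw [mul_sub, mul_smul_comm, mul_one, sub_mul, one_mul, h.mul_box, sub_self, sub_zero]
  have h2 : K * (Q * d) * (z • 1 - (d * δ + δ * d)) = Q * d := by
    have h4 : K * (Q * d) * (z • 1 - (d * δ + δ * d)) =
        z • (K * Q) * d - K * Q * (d * d) * δ - K * (Q * d * δ) * d := by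
      rw [mul_sub, mul_smul_comm, mul_one, smul_mul_assoc]
      noncomm_ring
    rw [h4, h.d_d, h.q_d_δ, h0]
    noncomm_ring
  have h3 : d * K * Q * (z • 1 - (d * δ + δ * d)) = d * Q := by
    have h4 : d * K * Q * (z • 1 - (d * δ + δ * d)) =
        d * (z • (K * Q)) - d * K * (Q * d * δ) - d * K * (Q * δ) * d := by
      rw [mul_sub, mul_smul_comm, mul_one, mul_smul_comm]
      noncomm_ring
    rw [h4, h.q_δ, h.q_d_δ, h0]
    noncomm_ring
  rw [boxResolvent, add_mul, add_mul, smul_mul_assoc, h1, h2, h3, inv_smul_smul₀ hz]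
  abel

/-- The resolvent identity. -/
theorem IsPartialResolvent.sub_eq (hK : IsPartialResolvent d δ pr z K)
    (hL : IsPartialResolvent d δ pr w L) : K - L = (w - z) • (K * L) := by
  have h1 : K * (w • 1 - δ * d) * L = K := by rw [mul_assoc, hL.left, hK.mul_proj]
  have h2 : K * (z • 1 - δ * d) * L = L := by
    rw [← hL.proj_mul, ← mul_assoc, hK.right]
  have h3 : ∀ t : ℂ, K * (t • 1 - δ * d) * L = t • (K * L) - K * (δ * d) * L := fun t => by
    rw [mul_sub, sub_mul, mul_smul_comm, mul_one, smul_mul_assoc]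
  rw [h3] at h1 h2
  rw [sub_smul]
  nth_rewrite 1 [← h1]
  nth_rewrite 3 [← h2]
  abel

/-- The perturbation series for the partial resolvent of `δ d = T + N`, given the partial
resolvent `S` of `T`. -/
def perturbedResolvent (S N : B) (m : ℕ) : B := (∑ i ∈ Finset.range m, (S * N) ^ i) * S

/-- The Neumann series is finite, and the two forms `K = S + SNK = S + KNS` give the two one-sided
relations. The perturbation `N` has image in `Im pr` but need not vanish on `ker pr`, which is why
the second relation is stated only after multiplication by `pr`. -/
theorem isPartialResolvent_perturbed {S T N : B} {m : ℕ} (hm : (S * N) ^ m = 0) (hT : T + N = δ * d)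
    (hprN : pr * N = N) (hpp : pr * pr = pr) (h1 : (z • 1 - T) * S = pr) (h2 : S * (z • 1 - T) = pr)
    (h3 : pr * S = S) (h4 : S * pr = S) :
    IsPartialResolvent d δ pr z (perturbedResolvent S N m) := by
  set K := perturbedResolvent S N m with hK
  have e1 : K = S + S * N * K := by
    have h5 : (1 - S * N) * ∑ i ∈ Finset.range m, (S * N) ^ i = 1 := by rw [mul_neg_geom_sum, hm, sub_zero]
    have h6 : (1 - S * N) * K = S := by rw [hK, perturbedResolvent, ← mul_assoc, h5, one_mul]
    rw [sub_mul, one_mul] at h6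
    exact sub_eq_iff_eq_add.mp h6
  have e2 : K = S + K * N * S := by
    have h5 : (∑ i ∈ Finset.range m, (S * N) ^ i) * (1 - S * N) = 1 := by rw [geom_sum_mul_neg, hm, sub_zero]
    have h6 := congrArg (· * S) h5
    simp only [mul_sub, sub_mul, mul_one, one_mul, ← mul_assoc] at h6
    exact sub_eq_iff_eq_add.mp h6
  have e3 : pr * K = K := by
    rw [e1, mul_add, ← mul_assoc, ← mul_assoc, h3]
  have e4 : K * pr = K := by
    rw [hK, perturbedResolvent, mul_assoc, h4]
  have e5 : z • (1 : B) - δ * d = (z • 1 - T) - N := by rw [← hT]; abel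
  refine ⟨?_, ?_, e3, e4⟩
  · rw [e5, sub_mul]
    nth_rewrite 1 [e1]
    rw [mul_add, h1, mul_assoc S, ← mul_assoc _ S, h1, ← mul_assoc, hprN]
    abel
  · rw [e5, mul_sub]
    nth_rewrite 1 [e2]
    rw [add_mul, h2, mul_assoc (K * N), h2, sub_mul, add_mul, hpp, mul_assoc _ pr, hpp]
    abel

end Resolvent

end RuminAlgebra

/-! ### Range and kernel of the projection -/

section RangeKer

variable {V : Type*} [AddCommGroup V] [Module ℝ V] {d d₀ δ X Y : Module.End ℝ V}

namespace IsBaseComplex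

/-- One inclusion uses that `Q` is `X` followed on the right by an invertible factor; for the other,
`Π` fixes both `X` and `dX`. -/
theorem range_eq (h : IsBaseComplex d d₀ δ X Y) :
    LinearMap.range (corrected d d₀ X * d + d * corrected d d₀ X) =
      LinearMap.range X ⊔ LinearMap.range (d * X) := by
  apply le_antisymm
  · rintro _ ⟨v, rfl⟩
    rw [h.corrected_eq, LinearMap.add_apply]
    exact Submodule.add_mem_sup ⟨_, rfl⟩ ⟨Ring.inverse (1 - (d₀ * X - d * X)) v, rfl⟩
  · have h1 : (corrected d d₀ X * d + d * corrected d d₀ X) * X = X := by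
      rw [add_mul, h.q_d_x, mul_assoc, corrected, mul_assoc, h.x_x, mul_zero, mul_zero, add_zero]
    have h2 : (corrected d d₀ X * d + d * corrected d d₀ X) * (d * X) = d * X := by
      rw [add_mul, mul_assoc _ d, ← mul_assoc d d, h.d_d, zero_mul, mul_zero, zero_add, mul_assoc,
        ← mul_assoc _ d, h.q_d_x]
    refine sup_le ?_ ?_
    · rintro _ ⟨v, rfl⟩; exact ⟨X v, LinearMap.congr_fun h1 v⟩
    · rintro _ ⟨v, rfl⟩; exact ⟨(d * X) v, LinearMap.congr_fun h2 v⟩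

/-- The identities `XΠ = X` and `XdΠ = Xd` force the kernel to be small; conversely `Q` is an
operator applied after `X`, so `Π` kills what `X` and `Xd` kill. -/
theorem ker_eq (h : IsBaseComplex d d₀ δ X Y) :
    LinearMap.ker (corrected d d₀ X * d + d * corrected d d₀ X) =
      LinearMap.ker X ⊓ LinearMap.ker (X * d) := by
  apply le_antisymm
  · have h0 : X * corrected d d₀ X = 0 := by rw [h.corrected_eq, ← mul_assoc, h.x_x, zero_mul]
    have h1 : X * (corrected d d₀ X * d + d * corrected d d₀ X) = X := by
      rw [mul_add, ← mul_assoc, h0, zero_mul, zero_add, ← mul_assoc, h.x_d_q]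
    have h2 : X * d * (corrected d d₀ X * d + d * corrected d d₀ X) = X * d := by
      rw [mul_add, ← mul_assoc, h.x_d_q, mul_assoc X d (d * _), ← mul_assoc d d, h.d_d, zero_mul, mul_zero, add_zero]
    intro v hv
    rw [LinearMap.mem_ker] at hv
    constructor
    · rw [SetLike.mem_coe, LinearMap.mem_ker, ← h1, Module.End.mul_apply, hv, map_zero]
    · rw [SetLike.mem_coe, LinearMap.mem_ker, ← h2, Module.End.mul_apply, hv, map_zero]
  · rintro v ⟨h1, h2⟩
    rw [SetLike.mem_coe, LinearMap.mem_ker] at h1 h2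
    rw [Module.End.mul_apply] at h2
    rw [LinearMap.mem_ker, LinearMap.add_apply, corrected, Module.End.mul_apply, Module.End.mul_apply,
      Module.End.mul_apply, Module.End.mul_apply, h1, h2, map_zero, map_zero, add_zero]

theorem range_δ (h : IsBaseComplex d d₀ δ X Y) : LinearMap.range X = LinearMap.range δ := by
  apply le_antisymm
  · rintro _ ⟨v, rfl⟩; exact ⟨(Y * X) v, (LinearMap.congr_fun h.x_eq_δ_mul v).symm⟩
  · rintro _ ⟨v, rfl⟩; exact ⟨(d₀ * δ) v, (LinearMap.congr_fun h.δ_eq_x_mul v).symm⟩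

theorem ker_δ (h : IsBaseComplex d d₀ δ X Y) : LinearMap.ker X = LinearMap.ker δ := by
  ext v
  rw [LinearMap.mem_ker, LinearMap.mem_ker]
  constructor <;> intro hv
  · rw [h.δ_eq_mul_x, Module.End.mul_apply, hv, map_zero]
  · rw [h.x_eq_mul_δ, Module.End.mul_apply, hv, map_zero]

end IsBaseComplex

theorem range_mul_congr {d X δ : Module.End ℝ V} (h : LinearMap.range X = LinearMap.range δ) :
    LinearMap.range (d * X) = LinearMap.range (d * δ) := by
  rw [Module.End.mul_eq_comp, Module.End.mul_eq_comp, LinearMap.range_comp, LinearMap.range_comp, h]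

theorem ker_mul_congr {d X δ : Module.End ℝ V} (h : LinearMap.ker X = LinearMap.ker δ) :
    LinearMap.ker (X * d) = LinearMap.ker (δ * d) := by
  rw [Module.End.mul_eq_comp, Module.End.mul_eq_comp, LinearMap.ker_comp, LinearMap.ker_comp, h]

/-- Used to move restriction to `U` past `(1 - b)⁻¹`, which is given only as an inverse in the ring.
-/
theorem comp_inverse_of_comp {V W : Type*} [AddCommGroup V] [Module ℝ V] [AddCommGroup W] [Module ℝ W]
    {ρ : V →ₗ[ℝ] W} {A : Module.End ℝ V} {B : Module.End ℝ W} (hA : IsUnit A) (hB : IsUnit B)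
    (h : ∀ v, ρ (A v) = B (ρ v)) (v : V) : ρ (Ring.inverse A v) = Ring.inverse B (ρ v) := by
  have h1 : B (ρ (Ring.inverse A v)) = ρ v := by
    rw [← h, ← Module.End.mul_apply A, Ring.mul_inverse_cancel _ hA, Module.End.one_apply]
  rw [← h1, ← Module.End.mul_apply _ B, Ring.inverse_mul_cancel _ hB, Module.End.one_apply]

end RangeKer

/-! ### Stability of differential operators -/

section DifferentialOperators

theorem commutator_neg {A : Type*} [Ring A] (s f : A) : -s * f - f * -s = -(s * f - f * s) := by
  noncomm_ring

theorem commutator_mul {A : Type*} [Ring A] (s t f : A) :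
    s * t * f - f * (s * t) = s * (t * f - f * t) + (s * f - f * s) * t := by
  noncomm_ring

variable {n : ℕ} {M : Type*} [TopologicalSpace M] [ChartedSpace (ModelSpace n) M] [IsManifold (𝓡 n) ∞ M]
  {S T : Module.End ℝ (SmoothForms n (Set.univ : Set M))}

theorem hasOrderLE_zero (m : ℕ) : HasOrderLE m (0 : Module.End ℝ (SmoothForms n (Set.univ : Set M))) := by
  induction m with
  | zero => intro f; rw [zero_mul, mul_zero]
  | succ m ih => intro f; rwa [zero_mul, mul_zero, sub_zero]

theorem HasOrderLE.succ {m : ℕ} (h : HasOrderLE m T) : HasOrderLE (m + 1) T := by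
  induction m generalizing T with
  | zero => intro f; rw [h f, sub_self]; exact hasOrderLE_zero 0
  | succ m ih => exact fun f => ih (h f)

theorem HasOrderLE.mono {m m' : ℕ} (h : HasOrderLE m T) (hm : m ≤ m') : HasOrderLE m' T := by
  induction m', hm using Nat.le_induction with
  | base => exact h
  | succ m' _ ih => exact ih.succ

theorem HasOrderLE.add {m : ℕ} (h : HasOrderLE m S) (h' : HasOrderLE m T) : HasOrderLE m (S + T) := by
  induction m generalizing S T with
  | zero => intro f; rw [add_mul, mul_add, h f, h' f]
  | succ m ih =>
    intro f
    have h1 : (S + T) * mulForm f - mulForm f * (S + T) =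
        (S * mulForm f - mulForm f * S) + (T * mulForm f - mulForm f * T) := by noncomm_ring
    rw [h1]
    exact ih (h f) (h' f)

theorem HasOrderLE.neg {m : ℕ} (h : HasOrderLE m T) : HasOrderLE m (-T) := by
  induction m generalizing T with
  | zero => exact fun f => (neg_mul T (mulForm f)).trans ((congrArg Neg.neg (h f)).trans (mul_neg (mulForm f) T).symm)
  | succ m ih =>
    intro f
    have h1 : -T * mulForm f - mulForm f * -T = -(T * mulForm f - mulForm f * T) :=
      commutator_neg T (mulForm f)
    rw [h1]
    exact ih (h f)

/-- The commutator with a function is a derivation, so each of the two terms it produces has total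
order one less. An order zero factor commutes with functions, and its term vanishes. -/
theorem HasOrderLE.mul {a b : ℕ} (hS : HasOrderLE a S) (hT : HasOrderLE b T) :
    HasOrderLE (a + b) (S * T) := by
  generalize hN : a + b = N
  induction N generalizing a b S T with
  | zero =>
    obtain ⟨rfl, rfl⟩ : a = 0 ∧ b = 0 := by omega
    intro f
    rw [mul_assoc, hT f, ← mul_assoc, hS f, mul_assoc]
  | succ N ih =>
    intro f
    have h1 : S * T * mulForm f - mulForm f * (S * T) =
        S * (T * mulForm f - mulForm f * T) + (S * mulForm f - mulForm f * S) * T :=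
      commutator_mul S T (mulForm f)
    rw [h1]
    refine HasOrderLE.add ?_ ?_
    · cases b with
      | zero => rw [hT f, sub_self, mul_zero]; exact hasOrderLE_zero N
      | succ b => exact ih hS (hT f) (by omega)
    · cases a with
      | zero => rw [hS f, sub_self, zero_mul]; exact hasOrderLE_zero N
      | succ a => exact ih (hS f) hT (by omega)

theorem IsDifferentialOperator.add (hS : IsDifferentialOperator S) (hT : IsDifferentialOperator T) :
    IsDifferentialOperator (S + T) := by
  obtain ⟨a, ha⟩ := hS
  obtain ⟨b, hb⟩ := hT
  exact ⟨max a b, (ha.mono (le_max_left a b)).add (hb.mono (le_max_right a b))⟩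

theorem IsDifferentialOperator.neg (hT : IsDifferentialOperator T) : IsDifferentialOperator (-T) :=
  ⟨_, hT.choose_spec.neg⟩

theorem IsDifferentialOperator.mul (hS : IsDifferentialOperator S) (hT : IsDifferentialOperator T) :
    IsDifferentialOperator (S * T) := ⟨_, hS.choose_spec.mul hT.choose_spec⟩

theorem isDifferentialOperator_one :
    IsDifferentialOperator (1 : Module.End ℝ (SmoothForms n (Set.univ : Set M))) :=
  ⟨0, fun f => by rw [one_mul, mul_one]⟩

theorem IsDifferentialOperator.sub (hS : IsDifferentialOperator S) (hT : IsDifferentialOperator T) :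
    IsDifferentialOperator (S - T) := by
  rw [sub_eq_add_neg]; exact hS.add hT.neg

theorem IsDifferentialOperator.pow (hT : IsDifferentialOperator T) (m : ℕ) :
    IsDifferentialOperator (T ^ m) := by
  induction m with
  | zero => rw [pow_zero]; exact isDifferentialOperator_one
  | succ m ih => rw [pow_succ]; exact ih.mul hT

/-- Nilpotency replaces the inverse by a finite geometric series. -/
theorem IsDifferentialOperator.inverse_one_sub (hT : IsDifferentialOperator T) (h : IsNilpotent T) :
    IsDifferentialOperator (Ring.inverse (1 - T)) := by
  obtain ⟨m, hm⟩ := h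
  rw [(isUnit_one_sub_and_inverse_eq hm).2]
  exact Finset.sum_induction _ _ (fun _ _ => IsDifferentialOperator.add) ⟨0, hasOrderLE_zero 0⟩
    fun i _ => hT.pow i

theorem isDifferentialOperator_of_realizes_pointwise
    {D : ∀ x : M, TotalForm (TangentSpace (𝓡 n) x) →ₗ[ℝ] TotalForm (TangentSpace (𝓡 n) x)}
    (h : Realizes Set.univ T (pointwise D)) : IsDifferentialOperator T := by
  refine ⟨0, fun f => smoothEnd_ext fun θ x hx => ?_⟩
  rw [Module.End.mul_apply, h _ x hx]
  change D x (f x • θ.1 x) = f x • (T θ).1 x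
  rw [h _ x hx, map_smul]
  rfl

/-- By the Leibniz rule, the commutator of `d` with a function acts pointwise, so it has order zero.
-/
theorem isDifferentialOperator_of_realizes_exteriorD (h : Realizes Set.univ T exteriorD) :
    IsDifferentialOperator T := by
  refine ⟨1, fun f g => smoothEnd_ext fun θ x hx => ?_⟩
  obtain ⟨L, hL⟩ := exists_exteriorD_mul f.contMDiff x
  have h1 : ∀ η : SmoothForms n (Set.univ : Set M), ((T * mulForm f - mulForm f * T) η).1 x = L (η.1 x) := by
    intro η
    change (T (mulForm f η)).1 x - f x • (T η).1 x = _
    rw [h _ x hx, h _ x hx]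
    refine (congrArg (· - f x • exteriorD η.1 x) (hL η.1 η.2.1)).trans ?_
    exact add_sub_cancel_left _ _
  refine (h1 _).trans ?_
  change L (g x • θ.1 x) = g x • ((T * mulForm f - mulForm f * T) θ).1 x
  rw [h1, map_smul]

end DifferentialOperators

/-! ### Restriction to open subsets -/

section Restriction

variable {n : ℕ} {M : Type*} [TopologicalSpace M] [ChartedSpace (ModelSpace n) M] [IsManifold (𝓡 n) ∞ M]
  {U : Set M} {A : Module.End ℝ (SmoothForms n (Set.univ : Set M))} {B : Module.End ℝ (SmoothForms n U)}

theorem restrictForm_apply (θ : SmoothForms n (Set.univ : Set M)) {x : M} (hx : x ∈ U) :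
    (restrictForm U θ).1 x = θ.1 x := if_pos hx

theorem restrictForm_pointwise
    {D : ∀ x : M, TotalForm (TangentSpace (𝓡 n) x) →ₗ[ℝ] TotalForm (TangentSpace (𝓡 n) x)}
    (hA : Realizes Set.univ A (pointwise D)) (hB : Realizes U B (pointwise D))
    (θ : SmoothForms n (Set.univ : Set M)) : restrictForm U (A θ) = B (restrictForm U θ) := by
  refine SmoothForms.ext_on fun x hx => ?_
  rw [restrictForm_apply _ hx, hA _ x (Set.mem_univ x), hB _ x hx]
  exact congrArg (D x) (restrictForm_apply θ hx).symm

theorem restrictForm_exteriorD (hU : IsOpen U) (hA : Realizes Set.univ A exteriorD)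
    (hB : Realizes U B exteriorD) (θ : SmoothForms n (Set.univ : Set M)) :
    restrictForm U (A θ) = B (restrictForm U θ) := by
  refine SmoothForms.ext_on fun x hx => ?_
  rw [restrictForm_apply _ hx, hA _ x (Set.mem_univ x), hB _ x hx]
  exact exteriorD_congr hU (fun y hy => (restrictForm_apply θ hy).symm) hx

end Restriction

/-! ### The relations and the projection on `Ω(U)` -/

namespace ManifoldFiltration

variable {n : ℕ} {M : Type*} [TopologicalSpace M] [ChartedSpace (ModelSpace n) M]
  [IsManifold (𝓡 n) ∞ M] [RiemannianBundle (fun x : M => TangentSpace (𝓡 n) x)] [T2Space M]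
  [IsContMDiffRiemannianBundle (𝓡 n) ∞ (EuclideanSpace ℝ (Fin n)) (fun x : M => TangentSpace (𝓡 n) x)]
  {F : ManifoldFiltration n M} {U : Set M}

theorem isBaseComplex (hrank : F.ConstantRank) (hU : IsOpen U) :
    IsBaseComplex (deRham U) (F.opD U) (F.opDt U) (F.opX U) (F.opXt U) where
  d_d := deRham_mul_deRham hU
  δ_δ := opDt_mul_opDt hU
  xdx := opX_opD_opX hrank hU
  x_eq_δ_mul := opX_eq_opDt_mul hrank hU
  x_eq_mul_δ := opX_eq_mul_opDt hrank hU
  δ_eq_mul_x := opDt_eq_mul_opX hrank hU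
  δ_eq_x_mul := opDt_eq_opX_mul hrank hU
  nilpotent := isNilpotent_of_formFilt fun _ _ h => opX_mem hrank hU (deRham_sub_opD_mem hU h)
  nilpotent' := isNilpotent_of_formFilt fun _ _ h => deRham_sub_opD_mem hU (opX_mem hrank hU h)

variable (F U) in
/-- The projection `Π` on `Ω(U)`. -/
def opPi : Module.End ℝ (SmoothForms n U) :=
  IsBaseComplex.corrected (deRham U) (F.opD U) (F.opX U) * deRham U +
    deRham U * IsBaseComplex.corrected (deRham U) (F.opD U) (F.opX U)

/-- The contour integral is computed on `U`, whereas the projection in the statement lives on `M`.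
Every ingredient is local, and the inverse is handled by invertibility of `1 - b` on both sides. -/
theorem restrictForm_opPi (hrank : F.ConstantRank) (hU : IsOpen U)
    (θ : SmoothForms n (Set.univ : Set M)) :
    restrictForm U (F.opPi Set.univ θ) = F.opPi U (restrictForm U θ) := by
  have hd := restrictForm_exteriorD (n := n) hU (realizes_deRham isOpen_univ) (realizes_deRham hU)
  have h0 := restrictForm_pointwise (realizes_opD (F := F) isOpen_univ) (realizes_opD hU)
  have hx := restrictForm_pointwise (realizes_opX hrank isOpen_univ) (realizes_opX hrank hU)
  have hq : ∀ θ : SmoothForms n (Set.univ : Set M),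
      restrictForm U (IsBaseComplex.corrected (deRham Set.univ) (F.opD Set.univ) (F.opX Set.univ) θ) =
      IsBaseComplex.corrected (deRham U) (F.opD U) (F.opX U) (restrictForm U θ) := by
    intro θ
    rw [IsBaseComplex.corrected, IsBaseComplex.corrected, Module.End.mul_apply, Module.End.mul_apply, ← hx]
    refine comp_inverse_of_comp (isBaseComplex hrank isOpen_univ).isUnit_left
      (isBaseComplex hrank hU).isUnit_left (fun η => ?_) _
    simp only [LinearMap.sub_apply, Module.End.one_apply, Module.End.mul_apply, map_sub, hx, h0, hd]
  simp only [opPi, LinearMap.add_apply, Module.End.mul_apply, map_add, hq, hd]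

end ManifoldFiltration

/-! ### Complex resolvents from real operators -/

section Complexification

/-- The resolvent of `T` on the image of the projection, built from the inverse `G` of `|z - T|²`. -/
def conjMul {B : Type*} [Ring B] [Algebra ℂ B] (T G : B) (z : ℂ) : B :=
  ((starRingEnd ℂ) z • 1 - T) * G

variable {B : Type*} [Ring B] [Algebra ℝ B] [Algebra ℂ B] [IsScalarTower ℝ ℂ B] {T pr G : B} {z : ℂ}

theorem normSqPoly_eq_mul (T : B) (z : ℂ) :
    normSqPoly T z = (z • 1 - T) * ((starRingEnd ℂ) z • 1 - T) := by
  have h : ∀ t : ℝ, algebraMap ℝ B t = (t : ℂ) • (1 : B) := fun t => by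
    rw [IsScalarTower.algebraMap_apply ℝ ℂ B, Algebra.algebraMap_eq_smul_one]; rfl
  set a : B := (z.re : ℂ) • 1 with ha
  set c : B := (z.im * Complex.I : ℂ) • 1 with hc
  have h1 : z • (1 : B) = a + c := by rw [ha, hc, ← add_smul, Complex.re_add_im]
  have h2 : (starRingEnd ℂ) z • (1 : B) = a - c := by
    rw [ha, hc, ← sub_smul]
    congr 1
    apply Complex.ext <;> simp
  have h3 : ((z.im ^ 2 : ℝ) : ℂ) • (1 : B) = -(c * c) := by
    rw [hc, smul_mul_smul_comm, one_mul, ← neg_smul]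
    congr 1
    rw [mul_mul_mul_comm, Complex.I_mul_I]
    push_cast
    ring
  have h4 : c * (a - T) = (a - T) * c := by
    rw [hc, smul_mul_assoc, one_mul, mul_smul_comm, mul_one]
  have h5 : (a + c - T) * (a - c - T) = (a - T) * (a - T) + c * (a - T) - (a - T) * c - c * c := by
    noncomm_ring
  rw [normSqPoly, h, h, h1, h2, h3, ← ha, h5, h4, pow_two]
  abel

theorem commute_smul_one_sub (T : B) (z w : ℂ) : Commute (z • (1 : B) - T) (w • 1 - T) := by
  have h : ∀ (t : ℂ) (b : B), Commute (t • (1 : B)) b := fun t b => by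
    rw [← Algebra.algebraMap_eq_smul_one]; exact Algebra.commutes t b
  exact (h z _).sub_left ((h w T).symm.sub_right (Commute.refl T))

/-- On `Im pr` the inverse of `z - T` is `(z̄ - T)|z - T|⁻²`. The non-real scalars enter only in the
factor `z̄ - T`, so the pointwise inversion could be done over `ℝ`. -/
theorem IsGapInverse.conjMul_spec (h : IsGapInverse T pr z G) (hc : Commute T pr) :
    (z • 1 - T) * conjMul T G z = pr ∧ conjMul T G z * (z • 1 - T) = pr ∧
      pr * conjMul T G z = conjMul T G z ∧ conjMul T G z * pr = conjMul T G z := by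
  have hs : ∀ (t : ℂ) (b : B), Commute (t • (1 : B)) b := fun t b => by
    rw [← Algebra.algebraMap_eq_smul_one]; exact Algebra.commutes t b
  have h1 : Commute T G := h.commute (Commute.refl T) hc
  refine ⟨?_, ?_, ?_, ?_⟩
  · rw [conjMul, ← mul_assoc, ← normSqPoly_eq_mul, h.right]
  · have h2 : Commute (z • 1 - T) G := (hs z G).sub_left h1
    rw [conjMul, mul_assoc, ← h2.eq, ← mul_assoc, (commute_smul_one_sub T _ _).eq, ← normSqPoly_eq_mul, h.right]
  · have h2 : Commute pr ((starRingEnd ℂ) z • 1 - T) := (hs _ pr).symm.sub_right hc.symm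
    rw [conjMul, ← mul_assoc, h2.eq, mul_assoc, h.proj_mul]
  · rw [conjMul, mul_assoc, h.mul_proj]

variable {V : Type*} [AddCommGroup V] [Module ℝ V]

/-- The extension of operators to the complexification. -/
def cplx (V : Type*) [AddCommGroup V] [Module ℝ V] :
    Module.End ℝ V →ₐ[ℝ] Module.End ℂ (ℂ ⊗[ℝ] V) := Module.End.baseChangeHom ℝ ℂ V

theorem cplx_eq (A : Module.End ℝ V) : cplx V A = LinearMap.baseChange ℂ A := rfl

theorem cplx_tmul (A : Module.End ℝ V) (c : ℂ) (v : V) : cplx V A (c ⊗ₜ v) = c ⊗ₜ A v := rfl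

theorem cplx_mem_baseChange {P Q : Submodule ℝ V} {A : Module.End ℝ V} (h : ∀ v ∈ P, A v ∈ Q)
    {ξ : ℂ ⊗[ℝ] V} (hξ : ξ ∈ P.baseChange ℂ) : cplx V A ξ ∈ Q.baseChange ℂ := by
  rw [Submodule.baseChange_eq_span] at hξ
  induction hξ using Submodule.span_induction with
  | mem ξ hξ =>
    obtain ⟨v, hv, rfl⟩ := hξ
    exact Submodule.tmul_mem_baseChange_of_mem 1 (h v hv)
  | zero => rw [map_zero]; exact Submodule.zero_mem _
  | add ξ η _ _ h1 h2 => rw [map_add]; exact Submodule.add_mem _ h1 h2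
  | smul c ξ _ h1 => rw [map_smul]; exact Submodule.smul_mem _ c h1

theorem exists_re_im (ξ : ℂ ⊗[ℝ] V) : ∃ a b : V, ξ = 1 ⊗ₜ a + Complex.I ⊗ₜ b := by
  induction ξ using TensorProduct.induction_on with
  | zero => exact ⟨0, 0, by simp⟩
  | tmul c v =>
    refine ⟨c.re • v, c.im • v, ?_⟩
    rw [← TensorProduct.smul_tmul, ← TensorProduct.smul_tmul, ← TensorProduct.add_tmul]
    congr 1
    rw [Complex.real_smul, Complex.real_smul, mul_one, Complex.re_add_im]
  | add ξ η h1 h2 =>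
    obtain ⟨a, b, rfl⟩ := h1
    obtain ⟨a', b', rfl⟩ := h2
    exact ⟨a + a', b + b', by rw [TensorProduct.tmul_add, TensorProduct.tmul_add]; abel⟩

theorem smul_re_im (z : ℂ) (a b : V) : z • ((1 : ℂ) ⊗ₜ[ℝ] a + Complex.I ⊗ₜ b) =
    (1 : ℂ) ⊗ₜ[ℝ] (z.re • a + (-z.im) • b) + Complex.I ⊗ₜ (z.re • b + z.im • a) := by
  simp only [TensorProduct.tmul_add, ← TensorProduct.smul_tmul, smul_add, TensorProduct.smul_tmul']
  have h1 : (z • (1 : ℂ)) ⊗ₜ[ℝ] a = (z.re • (1 : ℂ)) ⊗ₜ[ℝ] a + (z.im • Complex.I) ⊗ₜ[ℝ] a := by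
    rw [← TensorProduct.add_tmul]
    congr 1
    simp
  have h2 : (z • Complex.I) ⊗ₜ[ℝ] b = (-z.im • (1 : ℂ)) ⊗ₜ[ℝ] b + (z.re • Complex.I) ⊗ₜ[ℝ] b := by
    rw [← TensorProduct.add_tmul]
    congr 1
    apply Complex.ext <;> simp
  rw [h1, h2]
  abel

end Complexification

/-! ### Smooth and holomorphic dependence on the spectral parameter -/

section Evaluation

variable {n : ℕ} {M : Type*} [TopologicalSpace M] [ChartedSpace (ModelSpace n) M]
  {U : Set M} {x : M} {k : ℕ} {v : Fin k → TangentSpace (𝓡 n) x}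

theorem evalForm_tmul (c : ℂ) (θ : SmoothForms n U) :
    evalForm U x k v (c ⊗ₜ θ) = (θ.1 x k v : ℂ) * c := by
  change (TensorProduct.rid ℝ ℂ) (c ⊗ₜ θ.1 x k v) = _
  rw [TensorProduct.rid_tmul, Complex.real_smul]

theorem evalForm_smul (c : ℂ) (ξ : ℂ ⊗[ℝ] SmoothForms n U) :
    evalForm U x k v (c • ξ) = c * evalForm U x k v ξ := by
  induction ξ using TensorProduct.induction_on with
  | zero => rw [smul_zero, map_zero, mul_zero]
  | tmul a θ => rw [TensorProduct.smul_tmul', evalForm_tmul, evalForm_tmul, smul_eq_mul]; ring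
  | add ξ η h1 h2 => rw [smul_add, map_add, map_add, h1, h2, mul_add]

variable [IsManifold (𝓡 n) ∞ M] {D : Set ℂ}

/-- A family of complex forms on `U` which is smooth in the parameter `z ∈ D` and the point. -/
def IsComplexFamily (D : Set ℂ) (Ξ : ℂ → ℂ ⊗[ℝ] SmoothForms n U) : Prop :=
  ∃ a b : ℂ → SmoothForms n U, SmoothFamilyOn D U (fun z => (a z).1) ∧
    SmoothFamilyOn D U (fun z => (b z).1) ∧ ∀ z ∈ D, Ξ z = 1 ⊗ₜ a z + Complex.I ⊗ₜ b z

/-- A family of operators on complex forms sending smooth families to smooth families. -/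
def PreservesFamilies (D : Set ℂ) (A : ℂ → Module.End ℂ (ℂ ⊗[ℝ] SmoothForms n U)) : Prop :=
  ∀ Ξ, IsComplexFamily D Ξ → IsComplexFamily D fun z => A z (Ξ z)

variable {Ξ Ξ' : ℂ → ℂ ⊗[ℝ] SmoothForms n U}

theorem isComplexFamily_const (hU : IsOpen U) (ξ : ℂ ⊗[ℝ] SmoothForms n U) :
    IsComplexFamily D fun _ => ξ := by
  obtain ⟨a, b, h⟩ := exists_re_im ξ
  exact ⟨fun _ => a, fun _ => b, a.2.1.smoothFamilyOn hU, b.2.1.smoothFamilyOn hU, fun _ _ => h⟩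

theorem IsComplexFamily.add (h : IsComplexFamily D Ξ) (h' : IsComplexFamily D Ξ') :
    IsComplexFamily D fun z => Ξ z + Ξ' z := by
  obtain ⟨a, b, ha, hb, h⟩ := h
  obtain ⟨a', b', ha', hb', h'⟩ := h'
  refine ⟨fun z => a z + a' z, fun z => b z + b' z, ha.add ha', hb.add hb', fun z hz => ?_⟩
  beta_reduce
  rw [h z hz, h' z hz, TensorProduct.tmul_add, TensorProduct.tmul_add]
  abel

theorem IsComplexFamily.smul {c : ℂ → ℂ} (hc : ContDiff ℝ ∞ c) (h : IsComplexFamily D Ξ) :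
    IsComplexFamily D fun z => c z • Ξ z := by
  obtain ⟨a, b, ha, hb, h⟩ := h
  have hre : ContDiff ℝ ∞ fun z => (c z).re := Complex.reCLM.contDiff.comp hc
  have him : ContDiff ℝ ∞ fun z => (c z).im := Complex.imCLM.contDiff.comp hc
  refine ⟨fun z => (c z).re • a z + (-(c z).im) • b z, fun z => (c z).re • b z + (c z).im • a z,
    (ha.smul hre).add (hb.smul him.neg), (hb.smul hre).add (ha.smul him), fun z hz => ?_⟩
  beta_reduce
  rw [h z hz, smul_re_im]

theorem preservesFamilies_cplx {A : ℂ → Module.End ℝ (SmoothForms n U)}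
    (h : ∀ θ : ℂ → SmoothForms n U, SmoothFamilyOn D U (fun z => (θ z).1) →
      SmoothFamilyOn D U fun z => (A z (θ z)).1) :
    PreservesFamilies D fun z => cplx (SmoothForms n U) (A z) := by
  rintro Ξ ⟨a, b, ha, hb, hΞ⟩
  refine ⟨fun z => A z (a z), fun z => A z (b z), h a ha, h b hb, fun z hz => ?_⟩
  beta_reduce
  rw [hΞ z hz, map_add, cplx_tmul, cplx_tmul]

variable {A A' : ℂ → Module.End ℂ (ℂ ⊗[ℝ] SmoothForms n U)}

namespace PreservesFamilies

theorem mul (h : PreservesFamilies D A) (h' : PreservesFamilies D A') :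
    PreservesFamilies D fun z => A z * A' z := fun Ξ hΞ => h _ (h' Ξ hΞ)

theorem add (h : PreservesFamilies D A) (h' : PreservesFamilies D A') :
    PreservesFamilies D fun z => A z + A' z := fun Ξ hΞ => (h Ξ hΞ).add (h' Ξ hΞ)

theorem smul {c : ℂ → ℂ} (hc : ContDiff ℝ ∞ c) (h : PreservesFamilies D A) :
    PreservesFamilies D fun z => c z • A z := fun Ξ hΞ => (h Ξ hΞ).smul hc

theorem one : PreservesFamilies D fun _ => (1 : Module.End ℂ (ℂ ⊗[ℝ] SmoothForms n U)) :=
  fun _ hΞ => hΞ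

theorem sub (h : PreservesFamilies D A) (h' : PreservesFamilies D A') :
    PreservesFamilies D fun z => A z - A' z := fun Ξ hΞ => by
  have h1 := (h Ξ hΞ).add ((h' Ξ hΞ).smul (contDiff_const (c := (-1 : ℂ))))
  simpa only [neg_smul, one_smul, ← sub_eq_add_neg, LinearMap.sub_apply] using h1

theorem perturbed {S N : ℂ → Module.End ℂ (ℂ ⊗[ℝ] SmoothForms n U)} (hU : IsOpen U)
    (hS : PreservesFamilies D S) (hN : PreservesFamilies D N) (m : ℕ) :
    PreservesFamilies D fun z => perturbedResolvent (S z) (N z) m := by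
  refine PreservesFamilies.mul ?_ hS
  induction m with
  | zero =>
    intro Ξ _
    simp only [Finset.range_zero, Finset.sum_empty, LinearMap.zero_apply]
    exact isComplexFamily_const hU 0
  | succ m ih =>
    have h : PreservesFamilies D fun z => (S z * N z) ^ m := by
      clear ih
      induction m with
      | zero => simp only [pow_zero]; exact one
      | succ m ih => simp only [pow_succ]; exact ih.mul (hS.mul hN)
    simp only [Finset.sum_range_succ]
    exact ih.add h

end PreservesFamilies

theorem IsComplexFamily.continuousAt (h : IsComplexFamily D Ξ) (hD : IsOpen D) (hx : x ∈ U) {w : ℂ}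
    (hw : w ∈ D) : ContinuousAt (fun z => evalForm U x k v (Ξ z)) w := by
  obtain ⟨a, b, ha, hb, h⟩ := h
  have key : ∀ a : ℂ → SmoothForms n U, SmoothFamilyOn D U (fun z => (a z).1) →
      ContinuousAt (fun z => (a z).1 x k v) w := by
    intro a ha
    have h1 := (ha k x _ (mem_extChartAt_target x) (by rwa [extChartAt_to_inv]) w hw).continuousAt
    have h2 : ContinuousAt (fun z : ℂ => chartRep x (a z).1 k (extChartAt (𝓡 n) x x)) w :=
      ContinuousAt.comp (f := fun z : ℂ => (z, extChartAt (𝓡 n) x x)) (x := w) h1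
        (continuousAt_id.prodMk continuousAt_const)
    have h3 : Continuous fun α : (ModelSpace n) [⋀^Fin k]→L[ℝ] ℝ =>
        α (fun i => mfderiv (𝓡 n) 𝓘(ℝ, ModelSpace n) (extChartAt (𝓡 n) x) x (v i)) :=
      (ContinuousAlternatingMap.apply ℝ (ModelSpace n) ℝ _).continuous
    refine (h3.continuousAt.comp h2).congr (Filter.Eventually.of_forall fun z => ?_)
    exact chartRep_self x _ k v
  have h1 : ContinuousAt (fun z => ((a z).1 x k v : ℂ) * 1 + ((b z).1 x k v : ℂ) * Complex.I) w :=
    ((Complex.continuous_ofReal.continuousAt.comp (key a ha)).mul continuousAt_const).add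
      ((Complex.continuous_ofReal.continuousAt.comp (key b hb)).mul continuousAt_const)
  refine h1.congr ?_
  filter_upwards [hD.mem_nhds hw] with z hz
  rw [h z hz, map_add, evalForm_tmul, evalForm_tmul]

/-- Values of the partial resolvents are holomorphic. -/
theorem differentiableAt_evalForm {d δ pr L : Module.End ℂ (ℂ ⊗[ℝ] SmoothForms n U)}
    {K : ℂ → Module.End ℂ (ℂ ⊗[ℝ] SmoothForms n U)} (hD : IsOpen D) (hU : IsOpen U)
    (hK : ∀ z ∈ D, IsPartialResolvent d δ pr z (K z)) (hKs : PreservesFamilies D K)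
    (hL : PreservesFamilies D fun _ => L) (hx : x ∈ U) (ξ : ℂ ⊗[ℝ] SmoothForms n U) {w : ℂ} (hw : w ∈ D) :
    DifferentiableAt ℂ (fun z => evalForm U x k v (L (K z ξ))) w := by
  have h1 : ContinuousAt (fun z => evalForm U x k v (L (K z (K w ξ)))) w :=
    IsComplexFamily.continuousAt ((hL.mul hKs) _ (isComplexFamily_const hU (K w ξ))) hD hx hw
  -- The resolvent identity expresses the difference quotient at `w` as minus the value at `z` of a
  -- family already known to be continuous. So continuity in `z` suffices for complex
  -- differentiability.
  have h2 : ∀ z ∈ D, evalForm U x k v (L (K z ξ)) - evalForm U x k v (L (K w ξ)) =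
      (w - z) * evalForm U x k v (L (K z (K w ξ))) := by
    intro z hz
    have h3 := LinearMap.congr_fun ((hK z hz).sub_eq (hK w hw)) ξ
    rw [LinearMap.sub_apply, LinearMap.smul_apply, Module.End.mul_apply] at h3
    rw [← map_sub, ← map_sub, h3, map_smul, evalForm_smul]
  have h4 : HasDerivAt (fun z => evalForm U x k v (L (K z ξ))) (-evalForm U x k v (L (K w (K w ξ)))) w := by
    rw [hasDerivAt_iff_tendsto_slope]
    refine ((h1.neg).tendsto.mono_left nhdsWithin_le_nhds).congr' ?_
    filter_upwards [self_mem_nhdsWithin, nhdsWithin_le_nhds (hD.mem_nhds hw)] with z hzw hz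
    rw [slope_def_field, h2 z hz, eq_div_iff (sub_ne_zero.mpr hzw), Pi.neg_apply]
    ring
  exact h4.differentiableAt

end Evaluation

/-! ### The resolvent of the box and its contour integral -/

section BoxResolvent

variable {n : ℕ} {M : Type*} [TopologicalSpace M] [ChartedSpace (ModelSpace n) M]
  [IsManifold (𝓡 n) ∞ M] {U : Set M} {D : Set ℂ}

theorem conjMul_apply {W : Type*} [AddCommGroup W] [Module ℂ W] (T G : Module.End ℂ W) (z : ℂ) (w : W) :
    conjMul T G z w = (starRingEnd ℂ) z • G w - T (G w) := rfl

theorem PreservesSmooth.preservesFamilies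
    {T : ℂ → ∀ x : M, TotalForm (TangentSpace (𝓡 n) x) →ₗ[ℝ] TotalForm (TangentSpace (𝓡 n) x)}
    (h : PreservesSmooth D U T) (hD : IsOpen D) (hU : IsOpen U)
    {A : ℂ → Module.End ℝ (SmoothForms n U)} (hA : ∀ z ∈ D, Realizes U (A z) (pointwise (T z))) :
    PreservesFamilies D fun z => cplx (SmoothForms n U) (A z) :=
  preservesFamilies_cplx fun θ hθ => (h _ hθ).congr hD hU fun z hz x hx => hA z hz (θ z) x hx

theorem preservesFamilies_deRham (hD : IsOpen D) (hU : IsOpen U) :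
    PreservesFamilies D fun _ => cplx (SmoothForms n U) (deRham U) :=
  preservesFamilies_cplx fun θ hθ => (hθ.exteriorD hD hU).congr hD hU fun z _ x hx =>
    realizes_deRham hU (θ z) x hx

variable [RiemannianBundle (fun x : M => TangentSpace (𝓡 n) x)] [T2Space M]
  [IsContMDiffRiemannianBundle (𝓡 n) ∞ (EuclideanSpace ℝ (Fin n)) (fun x : M => TangentSpace (𝓡 n) x)]

namespace ManifoldFiltration

variable (F : ManifoldFiltration n M) (U)

/-- The box `dδ₀ + δ₀d` on `Ω(U)`. -/
def opBox : Module.End ℝ (SmoothForms n U) := deRham U * F.opDt U + F.opDt U * deRham U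

/-- The resolvent of `δ₀d₀` on the image of `δ₀`, on complex forms. -/
def baseResolvent (z : ℂ) : Module.End ℂ (ℂ ⊗[ℝ] SmoothForms n U) :=
  conjMul (cplx _ (F.opDt U * F.opD U)) (cplx _ (F.opW U z)) z

/-- The resolvent of `δ₀d` on the image of `δ₀`, on complex forms. -/
def partialResolvent (z : ℂ) : Module.End ℂ (ℂ ⊗[ℝ] SmoothForms n U) :=
  perturbedResolvent (F.baseResolvent U z) (cplx _ (F.opDt U * (deRham U - F.opD U))) (n * F.step + 1)

variable {F U} {r : ℝ} {z : ℂ}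

theorem baseResolvent_spec (hrank : F.ConstantRank) (hU : IsOpen U) (hr : F.HasSpectralGap U r)
    (hz : ‖z‖ < r) :
    (z • 1 - cplx _ (F.opDt U * F.opD U)) * F.baseResolvent U z = cplx _ (F.opX U * F.opD U) ∧
    F.baseResolvent U z * (z • 1 - cplx _ (F.opDt U * F.opD U)) = cplx _ (F.opX U * F.opD U) ∧
    cplx _ (F.opX U * F.opD U) * F.baseResolvent U z = F.baseResolvent U z ∧
    F.baseResolvent U z * cplx _ (F.opX U * F.opD U) = F.baseResolvent U z := by
  refine ((isGapInverse_opW hrank hU hr hz).map (cplx _)).conjMul_spec ?_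
  have h : Commute (F.opDt U * F.opD U) (F.opX U * F.opD U) := by
    change F.opDt U * F.opD U * (F.opX U * F.opD U) = F.opX U * F.opD U * (F.opDt U * F.opD U)
    rw [← mul_assoc, ← opDt_eq_mul_opX hrank hU, ← mul_assoc, ← opDt_eq_opX_mul hrank hU]
  exact h.map (cplx (SmoothForms n U))

/-- The base resolvent preserves weights and `δ₀(d - d₀)` raises them, so their product is nilpotent
uniformly in `z`, of order at most `n * step + 1`. -/
theorem baseResolvent_mul_mem (hrank : F.ConstantRank) (hU : IsOpen U) (hr : F.HasSpectralGap U r)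
    (hz : ‖z‖ < r) (p : ℕ) (ξ : ℂ ⊗[ℝ] SmoothForms n U) (hξ : ξ ∈ (F.formFilt U p).baseChange ℂ) :
    (F.baseResolvent U z * cplx (SmoothForms n U) (F.opDt U * (deRham U - F.opD U)) :
      Module.End ℂ (ℂ ⊗[ℝ] SmoothForms n U)) ξ ∈
      (F.formFilt U (p + 1)).baseChange ℂ := by
  have h0 : ∀ θ ∈ F.formFilt U p, (F.opDt U * (deRham U - F.opD U) : Module.End ℝ (SmoothForms n U)) θ ∈
      F.formFilt U (p + 1) := fun θ hθ => by
    rw [Module.End.mul_apply]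
    exact opDt_mem hU (deRham_sub_opD_mem hU hθ)
  have h1 : cplx (SmoothForms n U) (F.opDt U * (deRham U - F.opD U)) ξ ∈ (F.formFilt U (p + 1)).baseChange ℂ :=
    cplx_mem_baseChange h0 hξ
  have h2 := cplx_mem_baseChange (A := F.opW U z) (Q := F.formFilt U (p + 1))
    (fun θ hθ => opW_mem hrank hU hr hz hθ) h1
  have h3 := cplx_mem_baseChange (A := F.opDt U * F.opD U) (Q := F.formFilt U (p + 1))
    (fun θ hθ => opDt_mem hU (opD_mem hU hθ)) h2
  rw [Module.End.mul_apply, baseResolvent, conjMul_apply]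
  exact Submodule.sub_mem _ (Submodule.smul_mem _ ((starRingEnd ℂ) z) h2) h3

theorem isPartialResolvent (hrank : F.ConstantRank) (hU : IsOpen U) (hr : F.HasSpectralGap U r)
    (hz : ‖z‖ < r) : IsPartialResolvent (cplx _ (deRham U)) (cplx _ (F.opDt U))
      (cplx _ (F.opX U * F.opD U)) z (F.partialResolvent U z) := by
  obtain ⟨h1, h2, h3, h4⟩ := baseResolvent_spec hrank hU hr hz
  refine isPartialResolvent_perturbed ?_ ?_ ?_ ?_ h1 h2 h3 h4
  · refine pow_eq_zero_of_filtration (P := fun p => (F.formFilt U p).baseChange ℂ) ?_ ?_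
      (baseResolvent_mul_mem hrank hU hr hz)
    · change (F.formFilt U 0).baseChange ℂ = ⊤
      rw [formFilt_zero, Submodule.baseChange_top]
    · change (F.formFilt U (n * F.step + 1)).baseChange ℂ = ⊥
      rw [formFilt_eq_bot (Nat.lt_succ_self _), Submodule.baseChange_bot]
  · rw [← map_add, ← map_mul, ← mul_add, add_sub_cancel]
  · rw [← map_mul, ← mul_assoc, ← opDt_eq_opX_mul hrank hU]
  · rw [← map_mul, ← mul_assoc, opX_opD_opX hrank hU]

theorem preservesFamilies_partialResolvent (hrank : F.ConstantRank) (hU : IsOpen U)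
    (hr : F.HasSpectralGap U r) :
    PreservesFamilies (Metric.ball (0 : ℂ) r) (F.partialResolvent U) := by
  have hB := Metric.isOpen_ball (x := (0 : ℂ)) (ε := r)
  have hD := (preservesSmooth_baseDAt (F := F) (Metric.ball (0 : ℂ) r) U).preservesFamilies hB hU
    fun _ _ => realizes_opD hU
  have hδ := (preservesSmooth_baseDTransposeAt (F := F) (Metric.ball (0 : ℂ) r) U).preservesFamilies hB hU
    fun _ _ => realizes_opDt hU
  have hW := (preservesSmooth_gapInverseAt hrank hU hr).preservesFamilies hB hU
    fun z hz => realizes_opW hrank hU hr (mem_ball_zero_iff.mp hz)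
  have hd := preservesFamilies_deRham (n := n) hB hU
  have hT : PreservesFamilies (Metric.ball (0 : ℂ) r) fun _ => cplx _ (F.opDt U * F.opD U) := by
    simp only [map_mul]; exact hδ.mul hD
  have hN : PreservesFamilies (Metric.ball (0 : ℂ) r)
      fun _ => cplx _ (F.opDt U * (deRham U - F.opD U)) := by
    simp only [map_mul, map_sub]; exact hδ.mul (hd.sub hD)
  have hS : PreservesFamilies (Metric.ball (0 : ℂ) r) (F.baseResolvent U) :=
    -- The factor `z̄` is only smooth over `ℝ`; this is enough, since only continuity in `z` is
    -- extracted here and holomorphy comes from the resolvent identity.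
    ((PreservesFamilies.one.smul Complex.conjCLE.contDiff).sub hT).mul hW
  exact PreservesFamilies.perturbed hU hS hN _

variable (F U) in
/-- The corrected partial inverse of `d₀` on `Ω(U)`. -/
def opQ : Module.End ℝ (SmoothForms n U) :=
  IsBaseComplex.corrected (deRham U) (F.opD U) (F.opX U)

theorem opPi_eq : F.opPi U = F.opQ U * deRham U + deRham U * F.opQ U := rfl

variable (F U) in
/-- The resolvent of the box on complex forms. -/
def fullResolvent (z : ℂ) : Module.End ℂ (ℂ ⊗[ℝ] SmoothForms n U) :=
  boxResolvent (cplx _ (deRham U)) (cplx _ (F.opQ U)) (F.partialResolvent U z) z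

theorem fullResolvent_mul (hrank : F.ConstantRank) (hU : IsOpen U) (hr : F.HasSpectralGap U r)
    (hz0 : z ≠ 0) (hz : ‖z‖ < r) :
    (algebraMap ℂ _ z - LinearMap.baseChange ℂ (F.opBox U)) * F.fullResolvent U z = 1 ∧
      F.fullResolvent U z * (algebraMap ℂ _ z - LinearMap.baseChange ℂ (F.opBox U)) = 1 := by
  have h := (isBaseComplex hrank hU).isRetraction.map (cplx (SmoothForms n U)).toRingHom
  have hK := isPartialResolvent hrank hU hr hz
  have hδ : cplx _ (F.opDt U) * cplx _ (F.opX U * F.opD U) = 0 := by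
    rw [← map_mul, ← mul_assoc, (isBaseComplex hrank hU).δ_x, zero_mul, map_zero]
  rw [← cplx_eq, opBox, map_add, map_mul, map_mul, Algebra.algebraMap_eq_smul_one]
  exact ⟨mul_boxResolvent h hK hδ hz0, boxResolvent_mul h hK hz0⟩

theorem mem_resolventSet_opBox (hrank : F.ConstantRank) (hU : IsOpen U) (hr : F.HasSpectralGap U r)
    (hz0 : z ≠ 0) (hz : ‖z‖ < r) : z ∈ resolventSet ℂ
      (LinearMap.baseChange ℂ (F.opBox U) : Module.End ℂ (ℂ ⊗[ℝ] SmoothForms n U)) :=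
  ⟨⟨_, _, (fullResolvent_mul hrank hU hr hz0 hz).1, (fullResolvent_mul hrank hU hr hz0 hz).2⟩, rfl⟩

theorem resolvent_opBox (hrank : F.ConstantRank) (hU : IsOpen U) (hr : F.HasSpectralGap U r)
    (hz0 : z ≠ 0) (hz : ‖z‖ < r) :
    resolvent (LinearMap.baseChange ℂ (F.opBox U) : Module.End ℂ (ℂ ⊗[ℝ] SmoothForms n U)) z =
      F.fullResolvent U z :=
  Ring.inverse_unit ⟨_, _, (fullResolvent_mul hrank hU hr hz0 hz).1, (fullResolvent_mul hrank hU hr hz0 hz).2⟩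

variable {x : M} {k : ℕ} {v : Fin k → TangentSpace (𝓡 n) x}

variable (F) in
/-- The part of the resolvent which is holomorphic at `0`, evaluated at a point. -/
def holomorphicPart (θ : SmoothForms n U) (x : M) (k : ℕ) (v : Fin k → TangentSpace (𝓡 n) x) (z : ℂ) : ℂ :=
  evalForm U x k v (F.partialResolvent U z (1 ⊗ₜ F.opQ U (deRham U θ))) +
    evalForm U x k v (cplx _ (deRham U) (F.partialResolvent U z (1 ⊗ₜ F.opQ U θ)))

/-- Splits off the simple pole at `0`, with residue `1 - Π`. The remaining part involves only the
partial resolvent, which is defined on the whole disc, `0` included. -/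
theorem resolventValue_opBox (hrank : F.ConstantRank) (hU : IsOpen U) (hr : F.HasSpectralGap U r)
    (hz0 : z ≠ 0) (hz : ‖z‖ < r) (θ : SmoothForms n U) :
    resolventValue (F.opBox U) θ x k v z =
      z⁻¹ * ((((1 - F.opPi U) θ).1 x k v : ℝ) : ℂ) + F.holomorphicPart θ x k v z := by
  have h1 : 1 - (cplx _ (F.opQ U) * cplx _ (deRham U) + cplx _ (deRham U) * cplx _ (F.opQ U)) =
      cplx (SmoothForms n U) (1 - F.opPi U) := by
    rw [opPi_eq, map_sub, map_add, map_mul, map_mul, map_one]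
  rw [resolventValue, resolvent_opBox hrank hU hr hz0 hz, fullResolvent, boxResolvent, h1, ← map_mul,
    LinearMap.add_apply, LinearMap.add_apply, LinearMap.smul_apply, map_add, map_add, evalForm_smul,
    cplx_tmul, evalForm_tmul, mul_one, add_assoc]
  rfl

theorem differentiableAt_holomorphicPart (hrank : F.ConstantRank) (hU : IsOpen U)
    (hr : F.HasSpectralGap U r) (hx : x ∈ U) (θ : SmoothForms n U) (hz : ‖z‖ < r) :
    DifferentiableAt ℂ (F.holomorphicPart θ x k v) z := by
  have hB := Metric.isOpen_ball (x := (0 : ℂ)) (ε := r)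
  have hK : ∀ z ∈ Metric.ball (0 : ℂ) r, _ := fun z hz =>
    isPartialResolvent hrank hU hr (mem_ball_zero_iff.mp hz)
  have hKs := preservesFamilies_partialResolvent hrank hU hr
  exact (differentiableAt_evalForm hB hU hK hKs PreservesFamilies.one hx _ (mem_ball_zero_iff.mpr hz)).add
    (differentiableAt_evalForm hB hU hK hKs (preservesFamilies_deRham hB hU) hx _ (mem_ball_zero_iff.mpr hz))

/-- The contour integral of the resolvent of the box is the projection `1 - Π`. -/
theorem contourProjection_opBox (hrank : F.ConstantRank) (hU : IsOpen U) (hr : F.HasSpectralGap U r)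
    {ε : ℝ} (hε : 0 < ε) (hεr : ε < r) (θ : SmoothForms n U) (hx : x ∈ U) :
    CircleIntegrable (resolventValue (F.opBox U) θ x k v) 0 ε ∧
      contourProjection (F.opBox U) ε θ x k v = ((((1 - F.opPi U) θ).1 x k v : ℝ) : ℂ) := by
  set c : ℂ := ((((1 - F.opPi U) θ).1 x k v : ℝ) : ℂ) with hc
  have heq : Set.EqOn (resolventValue (F.opBox U) θ x k v)
      (fun z => z⁻¹ * c + F.holomorphicPart θ x k v z) (Metric.sphere 0 ε) := fun z hz => by
    have hz' : ‖z‖ = ε := mem_sphere_zero_iff_norm.mp hz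
    exact resolventValue_opBox hrank hU hr (norm_pos_iff.mp (hz' ▸ hε)) (hz' ▸ hεr) θ
  have hcont1 : ContinuousOn (fun z : ℂ => z⁻¹ * c) (Metric.sphere 0 ε) := fun z hz => by
    have hz' : ‖z‖ = ε := mem_sphere_zero_iff_norm.mp hz
    exact ((continuousAt_inv₀ (norm_pos_iff.mp (hz' ▸ hε))).mul continuousAt_const).continuousWithinAt
  have hdiff : ∀ z ∈ Metric.closedBall (0 : ℂ) ε, DifferentiableAt ℂ (F.holomorphicPart θ x k v) z :=
    fun z hz => differentiableAt_holomorphicPart hrank hU hr hx θ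
      ((mem_closedBall_zero_iff.mp hz).trans_lt hεr)
  have hcont : ContinuousOn (F.holomorphicPart θ x k v) (Metric.closedBall 0 ε) := fun z hz =>
    (hdiff z hz).continuousAt.continuousWithinAt
  have hcont2 := hcont.mono Metric.sphere_subset_closedBall
  refine ⟨((hcont1.add hcont2).congr heq).circleIntegrable hε.le, ?_⟩
  -- Cauchy's theorem on the closed disc of radius `ε < r`, where this part has no singularity.
  have h0 : (∮ z in C(0, ε), F.holomorphicPart θ x k v z) = 0 :=
    Complex.circleIntegral_eq_zero_of_differentiable_on_off_countable hε.le Set.countable_empty hcont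
      fun z hz => hdiff z (Metric.ball_subset_closedBall hz.1)
  have h1 : (∮ z in C(0, ε), z⁻¹ * c) = 2 * Real.pi * Complex.I * c := by
    have h2 := circleIntegral.integral_smul_const (fun z : ℂ => z⁻¹) c 0 ε
    simp only [smul_eq_mul] at h2
    rw [h2]
    have h3 := circleIntegral.integral_sub_center_inv (0 : ℂ) hε.ne'
    simp only [sub_zero] at h3
    rw [h3]
  rw [contourProjection, circleIntegral.integral_congr hε.le heq,
    circleIntegral.integral_add (hcont1.circleIntegrable hε.le) (hcont2.circleIntegrable hε.le), h0, h1, add_zero,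
    inv_mul_cancel_left₀ Complex.two_pi_I_ne_zero]

theorem realizes_opBox (hU : IsOpen U) :
    Realizes U (F.opBox U) (fun θ => exteriorD (pointwise F.baseDTransposeAt θ) +
      pointwise F.baseDTransposeAt (exteriorD θ)) := by
  intro θ x hx
  have hd := realizes_deRham (n := n) hU
  have hδ := realizes_opDt (F := F) hU
  refine congrArg₂ (· + ·) ((hd _ x hx).trans (exteriorD_congr hU (hδ θ) hx)) ?_
  exact (hδ _ x hx).trans (congrArg (F.baseDTransposeAt x) (hd θ x hx))

end ManifoldFiltration

end BoxResolvent

end FilteredRiemannian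

end FilteredRiemannianProofs

/-! ### Assembly of the statement -/

open FilteredRiemannian
theorem mainTheorem4 {n : ℕ} {M : Type*} [TopologicalSpace M] [T2Space M]
    [ChartedSpace (EuclideanSpace ℝ (Fin n)) M] [IsManifold (𝓡 n) ∞ M]
    [RiemannianBundle (fun x : M => TangentSpace (𝓡 n) x)]
    [IsContMDiffRiemannianBundle (𝓡 n) ∞ (EuclideanSpace ℝ (Fin n))
      (fun x : M => TangentSpace (𝓡 n) x)]
    (F : ManifoldFiltration n M)
    (hrank : ∀ k : ℕ, IsLocallyConstant
      fun x : M => finrank ℝ (LinearMap.range (F.osculatingD x k))) :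
    (∀ x : M, F.IsOsculatingBracket x (F.osculatingBracket x)) ∧
    ∃ d d₀ δ₀ d₀inv b b₁ Pi : Module.End ℝ (SmoothForms n (Set.univ : Set M)),
      Realizes Set.univ d exteriorD ∧
      Realizes Set.univ d₀ (pointwise F.baseDAt) ∧
      Realizes Set.univ δ₀ (pointwise F.baseDTransposeAt) ∧
      Realizes Set.univ d₀inv (pointwise F.baseDInvAt) ∧
      b = d₀inv * d₀ - d₀inv * d ∧ b = -(d₀inv * (d - d₀)) ∧
      b₁ = d₀ * d₀inv - d * d₀inv ∧ b₁ = -((d - d₀) * d₀inv) ∧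
      IsNilpotent b ∧ IsNilpotent b₁ ∧
      IsDifferentialOperator b ∧ IsDifferentialOperator b₁ ∧
      IsUnit (1 - b) ∧ IsUnit (1 - b₁) ∧
      IsDifferentialOperator (Ring.inverse (1 - b)) ∧
      IsDifferentialOperator (Ring.inverse (1 - b₁)) ∧
      b * d₀inv = d₀inv * b₁ ∧
      Ring.inverse (1 - b) * d₀inv = d₀inv * Ring.inverse (1 - b₁) ∧
      Pi = Ring.inverse (1 - b) * d₀inv * d + d * Ring.inverse (1 - b) * d₀inv ∧
      Pi = d₀inv * Ring.inverse (1 - b₁) * d + d * d₀inv * Ring.inverse (1 - b₁) ∧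
      IsDifferentialOperator Pi ∧
      IsIdempotentElem Pi ∧
      LinearMap.range Pi = LinearMap.range d₀inv ⊔ LinearMap.range (d * d₀inv) ∧
      LinearMap.range Pi = LinearMap.range δ₀ ⊔ LinearMap.range (d * δ₀) ∧
      LinearMap.ker Pi = LinearMap.ker d₀inv ⊓ LinearMap.ker (d₀inv * d) ∧
      LinearMap.ker Pi = LinearMap.ker δ₀ ⊓ LinearMap.ker (δ₀ * d) ∧
      (∀ x : M, ∃ U : Set M, IsOpen U ∧ x ∈ U ∧ ∃ r : ℝ, 0 < r ∧ F.HasSpectralGap U r) ∧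
      ∀ (U : Set M) (r : ℝ), IsOpen U → 0 < r → F.HasSpectralGap U r →
        ∃ box : Module.End ℝ (SmoothForms n U),
          Realizes U box (fun θ => exteriorD (pointwise F.baseDTransposeAt θ) +
            pointwise F.baseDTransposeAt (exteriorD θ)) ∧
          (∀ z : ℂ, 0 < ‖z‖ → ‖z‖ < r → z ∈ resolventSet ℂ
            (LinearMap.baseChange ℂ box : Module.End ℂ (ℂ ⊗[ℝ] SmoothForms n U))) ∧
          ∀ ε : ℝ, 0 < ε → ε < r → ∀ θ : SmoothForms n (Set.univ : Set M),
            ∀ x ∈ U, ∀ (k : ℕ) (v : Fin k → TangentSpace (𝓡 n) x),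
              CircleIntegrable (resolventValue box (restrictForm U θ) x k v) 0 ε ∧
              contourProjection box ε (restrictForm U θ) x k v =
                ((((1 - Pi) θ).1 x k v : ℝ) : ℂ) := by
  have hc : F.ConstantRank := hrank
  have hb := ManifoldFiltration.isBaseComplex hc isOpen_univ
  have od := isDifferentialOperator_of_realizes_exteriorD (realizes_deRham (n := n) (M := M) isOpen_univ)
  have o0 := isDifferentialOperator_of_realizes_pointwise (F.realizes_opD isOpen_univ)
  have ox := isDifferentialOperator_of_realizes_pointwise (F.realizes_opX hc isOpen_univ)
  have ob := (ox.mul o0).sub (ox.mul od)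
  have ob₁ := (o0.mul ox).sub (od.mul ox)
  have oi := ob.inverse_one_sub hb.isNilpotent_left
  have oi₁ := ob₁.inverse_one_sub hb.isNilpotent_right
  refine ⟨isOsculatingBracket_osculatingBracket F, deRham Set.univ, F.opD Set.univ, F.opDt Set.univ,
    F.opX Set.univ, _, _, F.opPi Set.univ, realizes_deRham isOpen_univ,
    ManifoldFiltration.realizes_opD isOpen_univ, ManifoldFiltration.realizes_opDt isOpen_univ,
    ManifoldFiltration.realizes_opX hc isOpen_univ, rfl, IsBaseComplex.left_eq _ _ _, rfl,
    IsBaseComplex.right_eq _ _ _, hb.isNilpotent_left, hb.isNilpotent_right, ob, ob₁,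
    hb.isUnit_left, hb.isUnit_right, oi, oi₁, IsBaseComplex.left_mul_x, hb.inverse_mul_x, ?_, ?_,
    ((oi.mul ox).mul od).add (od.mul (oi.mul ox)), hb.isRetraction.isIdempotentElem, hb.range_eq, ?_,
    hb.ker_eq, ?_, fun x => ManifoldFiltration.exists_hasSpectralGap hc x, fun U r hU _ hr => ?_⟩
  · rw [mul_assoc (deRham Set.univ)]
    rfl
  · rw [mul_assoc (deRham Set.univ), ← hb.inverse_mul_x]
    rfl
  · rw [← hb.range_δ, ← range_mul_congr hb.range_δ]
    exact hb.range_eq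
  · rw [← hb.ker_δ, ← ker_mul_congr hb.ker_δ]
    exact hb.ker_eq
  · refine ⟨F.opBox U, ManifoldFiltration.realizes_opBox hU, fun z hz0 hz =>
      ManifoldFiltration.mem_resolventSet_opBox hc hU hr (norm_pos_iff.mp hz0) hz,
      fun ε hε hεr θ x hx k v => ?_⟩
    obtain ⟨h1, h2⟩ := ManifoldFiltration.contourProjection_opBox (k := k) (v := v) hc hU hr hε hεr
      (restrictForm U θ) hx
    refine ⟨h1, h2.trans ?_⟩
    -- The residue computed on `U` is the restriction of the global one, so its value at `x` does
    -- not depend on `U`, `r` or `ε`.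
    have h3 : (1 - F.opPi U) (restrictForm U θ) = restrictForm U ((1 - F.opPi Set.univ) θ) := by
      rw [LinearMap.sub_apply, LinearMap.sub_apply, map_sub, ManifoldFiltration.restrictForm_opPi hc hU]
      rfl
    rw [h3, restrictForm_apply _ hx]
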